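/- **Setup.** A population unit is $(Y(1),Y(0),X^*,X)$, where $X=X^*$ if $|X^*|\ge d$ and $|X|<d$ if $|X^*|<d$; the functions $x\mapsto E(Y(t)\mid X^*=x)$, $t\in\{0,1\}$, are continuous; $T=1\{X\ge 0\}$ and $Y=Y(T)$. Put $\mu^*(x)=E(Y\mid X^*=x)$, $\mu(x)=E(Y\mid X=x)$, $\sigma^2(x)=V(Y\mid X=x)$, $\sigma_i^2=\sigma^2(X_i)$. For $M>0$, $\mathcal F(M)$ is the class of functions $m_1(x)1\{x\ge0\}+m_0(x)1\{x<0\}$ with $m_0,m_1$ twice continuously differentiable and $\|m_t''\|_\infty\le M$. It is maintained that $\mu^*\in\mathcal F(M)$ and $\mu^*(x)=\mu(x)$ for $|x|>d$; the null hypothesis is $H_0:\mu^*(x)=\mu(x)$ for all $|x|<d$. The data are $n$ i.i.d. copies of $(Y,X)$. **Estimators and test.** For $0\le d<h$, $\widehat\tau(h,d)=\sum_i w_i(h,d)Y_i$ is the first coordinate of the minimizer over $\beta\in\mathbb R^4$ of $\sum_i K(X_i/h)\,1\{|X_i|\ge d\}\,(Y_i-(T_i,X_i,T_iX_i,1)^\top\beta)^2$.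 Let $v_i=w_i(h,d)-w_i(h,0)$, $\widehat\Delta=\widehat\tau(h,d)-\widehat\tau(h,0)=\sum_i v_iY_i$, $b_\Delta(m)=\sum_i v_i m(X_i)$, $s_\Delta^2=\sum_i v_i^2\sigma_i^2$, $\widehat s_\Delta^2=\sum_i v_i^2\widehat\sigma_i^2$ with estimates $\widehat\sigma_i^2$ that are functions of the data, $t_\Delta=\widehat\Delta/\widehat s_\Delta$, and $\bar b_\Delta=-\frac M2\sum_i v_iX_i^2\,\mathrm{sign}(X_i)$. Let $\mathrm{cv}_{1-\alpha}(r)$ be the $1-\alpha$ quantile of $|N(r,1)|$, $\alpha\in(0,1)$. (Conventions: $x/0=0$; the weights are $0$ if the least squares design is singular.) **Assumptions.** (i) $K$ is a symmetric probability density, continuous on $[-1,1]$ and zero outside, with $\int_c^1K>0$ for all $c\in[0,1)$; and either (small donut) $d=ch$ for a fixed $c\in[0,1)$, $h\to0$, $nh\to\infty$, or (large donut) $d$ is fixed, $h>d$, $h\to d$, $n(h-d)\to\infty$, and there is a constant $C$ with $(1-c)\max_{[c,1]}K\le C\int_c^1K$ for all $c\in[0,1)$ (as for the uniform, triangular and Epanechnikov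 kernels). (ii) $X$ has a density that does not vary with $n$ or $\mu^*$ and is continuous, bounded and bounded away from zero on a fixed open interval that, for all large $n$, contains $[-d,d]$; for some $q>2$, $E(|Y-\mu(X)|^q\mid X=x)$ is bounded uniformly; $\sigma^2$ is Lipschitz on either side of $0$ on the support of $X$ and bounded away from zero there except possibly at $0$. All constants are uniform in $n$ and $\mu^*$; apart from this the population law may depend on $n$ and on $\mu^*$. (iii) $\mathcal G\subseteq\mathcal F(M)$ is a class of functions $\mu^*$ (for example $\mathcal G=\mathcal F(M)$ or a single function) over which $\widehat s_\Delta^2=s_\Delta^2(1+o_P(1))$ uniformly, i.e. $\sup_{\mu^*\in\mathcal G}P(|\widehat s_\Delta^2-s_\Delta^2|>\varepsilon s_\Delta^2)\to0$ for every $\varepsilon>0$. **Theorem 3.** (a) In finite samples, for all $n$, $0\le d<h$ and all values $X_1,\dots,X_n$ for which the least squares design of $\widehat\tau(h,d)$ is nonsingular, $\sup_{m\in\mathcal F(M)}|b_\Delta(m)|=\bar b_\Delta$. (b) Under $H_0$, $$\limsup_{n\to\infty}\ \sup_{\mu^*\in\mathcal G}P\Big(|t_\Delta|\ge \mathrm{cv}_{1-\alpha}\big(\bar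 b_\Delta/\widehat s_\Delta\big)\Big)\le\alpha ;$$ in particular, if the variance condition (iii) holds uniformly over $\mathcal F(M)$, the test that rejects $H_0$ when $|t_\Delta|>\mathrm{cv}_{1-\alpha}(\bar b_\Delta/\widehat s_\Delta)$ has asymptotic size at most $\alpha$ uniformly over $\mathcal F(M)$. -/

import Mathlib

open MeasureTheory ProbabilityTheory Filter Topology

noncomputable section

namespace DonutRD

/-! ### Local linear RD estimators with a donut hole -/

/-- Treatment indicator `T = 1{x ≥ 0}`. -/
def treat (x : ℝ) : ℝ := if 0 ≤ x then 1 else 0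

/-- Regressor vector `(T, x, T x, 1)`. -/
def regressor (x : ℝ) : Fin 4 → ℝ := ![treat x, x, treat x * x, 1]

/-- Weight `K(x/h) 1{|x| ≥ d}` given to an observation at `x`. -/
def kernelWeight (K : ℝ → ℝ) (h d x : ℝ) : ℝ := if d ≤ |x| then K (x / h) else 0

/-- Weighted least squares criterion. -/
def wlsObjective (K : ℝ → ℝ) (h d : ℝ) {n : ℕ} (x y : Fin n → ℝ) (β : Fin 4 → ℝ) : ℝ :=
  ∑ i, kernelWeight K h d (x i) * (y i - regressor (x i) ⬝ᵥ β) ^ 2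

/-- Weighted design (Gram) matrix. -/
def gram (K : ℝ → ℝ) (h d : ℝ) {n : ℕ} (x : Fin n → ℝ) : Matrix (Fin 4) (Fin 4) ℝ :=
  ∑ i, kernelWeight K h d (x i) • Matrix.vecMulVec (regressor (x i)) (regressor (x i))

/-- The least squares weights `w_i(h, d)`; they depend on the running variable only. -/
def rdWeight (K : ℝ → ℝ) (h d : ℝ) {n : ℕ} (x : Fin n → ℝ) (i : Fin n) : ℝ :=
  kernelWeight K h d (x i) * (Matrix.mulVec (gram K h d x)⁻¹ (regressor (x i))) 0

/-- The donut RD estimator with bandwidth `h` and donut size `d`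
(conventional estimator: `d = 0`). -/
def rdEstimate (K : ℝ → ℝ) (h d : ℝ) {n : ℕ} (x y : Fin n → ℝ) : ℝ :=
  ∑ i, rdWeight K h d x i * y i

/-- When the design is nonsingular, the least squares criterion has exactly one minimizer, and
`rdEstimate` is its first coordinate. -/
theorem rdEstimate_eq_argmin (K : ℝ → ℝ) (hK : ∀ u, 0 ≤ K u) (h d : ℝ) {n : ℕ}
    (x y : Fin n → ℝ) (hdet : IsUnit (gram K h d x).det) :
    ∃ β : Fin 4 → ℝ, (∀ γ, wlsObjective K h d x y β ≤ wlsObjective K h d x y γ) ∧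
      (∀ γ, (∀ δ, wlsObjective K h d x y γ ≤ wlsObjective K h d x y δ) → γ = β) ∧
      rdEstimate K h d x y = β 0 := by
  have hk : ∀ i, 0 ≤ kernelWeight K h d (x i) := by
    intro i; unfold kernelWeight; split_ifs
    · exact hK _
    · exact le_rfl
  have hg : ∀ v : Fin 4 → ℝ, Matrix.mulVec (gram K h d x) v =
      ∑ i, (kernelWeight K h d (x i) * (regressor (x i) ⬝ᵥ v)) • regressor (x i) := by
    intro v
    simp only [gram, Matrix.sum_mulVec, Matrix.smul_mulVec, Matrix.vecMulVec_mulVec]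
    refine Finset.sum_congr rfl fun i _ => ?_
    ext j
    simp [mul_comm, mul_left_comm]
  set b : Fin 4 → ℝ := ∑ i, (kernelWeight K h d (x i) * y i) • regressor (x i) with hb
  set β : Fin 4 → ℝ := Matrix.mulVec (gram K h d x)⁻¹ b with hβ
  have hn : Matrix.mulVec (gram K h d x) β = b := by
    rw [hβ, Matrix.mulVec_mulVec, Matrix.mul_nonsing_inv _ hdet, Matrix.one_mulVec]
  have horth : ∀ v : Fin 4 → ℝ, ∑ i, kernelWeight K h d (x i) *
      (y i - regressor (x i) ⬝ᵥ β) * (regressor (x i) ⬝ᵥ v) = 0 := by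
    intro v
    have h1 : (Matrix.mulVec (gram K h d x) β) ⬝ᵥ v = b ⬝ᵥ v := by rw [hn]
    rw [hg, hb, sum_dotProduct, sum_dotProduct] at h1
    simp only [smul_dotProduct, smul_eq_mul] at h1
    have h2 := sub_eq_zero.mpr h1.symm
    rw [← Finset.sum_sub_distrib] at h2
    rw [← h2]
    exact Finset.sum_congr rfl fun i _ => by ring
  have hdec : ∀ γ : Fin 4 → ℝ, wlsObjective K h d x y γ = wlsObjective K h d x y β +
      ∑ i, kernelWeight K h d (x i) * (regressor (x i) ⬝ᵥ (γ - β)) ^ 2 := by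
    intro γ
    have h1 := horth (γ - β)
    have h2 : wlsObjective K h d x y γ = wlsObjective K h d x y β +
        ∑ i, kernelWeight K h d (x i) * (regressor (x i) ⬝ᵥ (γ - β)) ^ 2 -
        2 * ∑ i, kernelWeight K h d (x i) *
          (y i - regressor (x i) ⬝ᵥ β) * (regressor (x i) ⬝ᵥ (γ - β)) := by
      simp only [wlsObjective, Finset.mul_sum, ← Finset.sum_add_distrib,
        ← Finset.sum_sub_distrib, dotProduct_sub]
      exact Finset.sum_congr rfl fun i _ => by ring
    rw [h2, h1]; ring
  have hnn : ∀ γ : Fin 4 → ℝ,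
      ∀ i, 0 ≤ kernelWeight K h d (x i) * (regressor (x i) ⬝ᵥ (γ - β)) ^ 2 :=
    fun γ i => mul_nonneg (hk i) (sq_nonneg _)
  refine ⟨β, fun γ => ?_, fun γ hγ => ?_, ?_⟩
  · rw [hdec γ]
    linarith [Finset.sum_nonneg fun i (_ : i ∈ Finset.univ) => hnn γ i]
  · have h0 : ∑ i, kernelWeight K h d (x i) * (regressor (x i) ⬝ᵥ (γ - β)) ^ 2 = 0 := by
      have h1 := hγ β
      rw [hdec γ] at h1
      linarith [Finset.sum_nonneg fun i (_ : i ∈ Finset.univ) => hnn γ i]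
    rw [Finset.sum_eq_zero_iff_of_nonneg fun i _ => hnn γ i] at h0
    have h3 : Matrix.mulVec (gram K h d x) (γ - β) = 0 := by
      rw [hg]
      refine Finset.sum_eq_zero fun i hi => ?_
      have h4 := h0 i hi
      rcases mul_eq_zero.mp h4 with h5 | h5
      · simp [h5]
      · simp [pow_eq_zero_iff (two_ne_zero) |>.mp h5]
    have h6 : Matrix.mulVec (gram K h d x)⁻¹ (Matrix.mulVec (gram K h d x) (γ - β)) = 0 := by
      rw [h3, Matrix.mulVec_zero]
    rw [Matrix.mulVec_mulVec, Matrix.nonsing_inv_mul _ hdet, Matrix.one_mulVec] at h6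
    exact sub_eq_zero.mp h6
  · rw [hβ, hb, Matrix.mulVec_sum, Finset.sum_apply, rdEstimate]
    refine Finset.sum_congr rfl fun i _ => ?_
    rw [Matrix.mulVec_smul, Pi.smul_apply, smul_eq_mul, rdWeight]
    ring

/-! ### The difference between the donut and the conventional estimate -/

/-- `w_i(h, d) - w_i(h, 0)`. -/
def diffWeight (K : ℝ → ℝ) (h d : ℝ) {n : ℕ} (x : Fin n → ℝ) (i : Fin n) : ℝ :=
  rdWeight K h d x i - rdWeight K h 0 x i

/-- Difference of the donut and the conventional estimate. -/
def diffEstimate (K : ℝ → ℝ) (h d : ℝ) {n : ℕ} (x y : Fin n → ℝ) : ℝ :=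
  rdEstimate K h d x y - rdEstimate K h 0 x y

/-- Conditional bias of the difference, given the running variable, if the regression function
is `m`. -/
def diffBias (K : ℝ → ℝ) (h d : ℝ) {n : ℕ} (x : Fin n → ℝ) (m : ℝ → ℝ) : ℝ :=
  ∑ i, diffWeight K h d x i * m (x i)

/-- The worst case bias bound. -/
def diffBiasBound (M : ℝ) (K : ℝ → ℝ) (h d : ℝ) {n : ℕ} (x : Fin n → ℝ) : ℝ :=
  -(M / 2) * ∑ i, diffWeight K h d x i * x i ^ 2 * Real.sign (x i)

/-- Conditional variance of the difference, for (true or estimated) variances `v i`. -/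
def diffVar (K : ℝ → ℝ) (h d : ℝ) {n : ℕ} (x v : Fin n → ℝ) : ℝ :=
  ∑ i, (rdWeight K h d x i ^ 2 + rdWeight K h 0 x i ^ 2
    - 2 * rdWeight K h d x i * rdWeight K h 0 x i) * v i

/-- `cv_{1-α}(r)`: the `1-α` quantile of `|N(r, 1)|`. -/
def criticalValue (α r : ℝ) : ℝ :=
  sInf {c : ℝ | 1 - α ≤ (gaussianReal r 1).real {z | |z| ≤ c}}

/-- The `t`-statistic, computed with variance estimates `v`. -/
def tStat (K : ℝ → ℝ) (h d : ℝ) {n : ℕ} (x y v : Fin n → ℝ) : ℝ :=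
  diffEstimate K h d x y / √(diffVar K h d x v)

/-- The critical value of the test, computed with variance estimates `v`. -/
def testCriticalValue (α M : ℝ) (K : ℝ → ℝ) (h d : ℝ) {n : ℕ} (x v : Fin n → ℝ) : ℝ :=
  criticalValue α (diffBiasBound M K h d x / √(diffVar K h d x v))

/-! ### Smoothness class, kernels and asymptotic frameworks -/

/-- The class `F(M)`: twice continuously differentiable except for the threshold `0`, with second
derivatives bounded by `M`. -/
def smoothClass (M : ℝ) : Set (ℝ → ℝ) :=
  {m | ∃ m₀ m₁ : ℝ → ℝ, ContDiff ℝ 2 m₀ ∧ ContDiff ℝ 2 m₁ ∧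
    (∀ x, |iteratedDeriv 2 m₀ x| ≤ M) ∧ (∀ x, |iteratedDeriv 2 m₁ x| ≤ M) ∧
    m = fun x => if 0 ≤ x then m₁ x else m₀ x}

/-- Kernel functions: symmetric densities, continuous on `[-1, 1]` and zero outside, whose support
reaches the end points `±1`. -/
structure IsKernel (K : ℝ → ℝ) : Prop where
  nonneg : ∀ u, 0 ≤ K u
  symm : ∀ u, K (-u) = K u
  continuousOn : ContinuousOn K (Set.Icc (-1) 1)
  eq_zero : ∀ u, 1 < |u| → K u = 0
  integral_eq_one : ∫ u, K u = 1
  mass_pos : ∀ c, 0 ≤ c → c < 1 → 0 < ∫ u in c..1, K u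

/-- The average of `K` over `[c, 1]` is at least a fixed fraction of its maximum over `[c, 1]`. -/
def EndpointRegular (K : ℝ → ℝ) : Prop :=
  ∃ C : ℝ, ∀ c, 0 ≤ c → c < 1 → ∀ u ∈ Set.Icc c 1, (1 - c) * K u ≤ C * ∫ t in c..1, K t

/-- Small donut asymptotics. -/
def SmallDonut (h d : ℕ → ℝ) : Prop :=
  (∀ n, 0 < h n) ∧ (∃ c : ℝ, 0 ≤ c ∧ c < 1 ∧ ∀ n, d n = c * h n) ∧
    Tendsto h atTop (𝓝 0) ∧ Tendsto (fun n : ℕ => (n : ℝ) * h n) atTop atTop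

/-- Large donut asymptotics. -/
def LargeDonut (h d : ℕ → ℝ) : Prop :=
  ∃ d₀ : ℝ, 0 ≤ d₀ ∧ (∀ n, d n = d₀) ∧ (∀ n, d₀ < h n) ∧
    Tendsto h atTop (𝓝 d₀) ∧ Tendsto (fun n : ℕ => (n : ℝ) * (h n - d₀)) atTop atTop

/-! ### The donut model -/

/-- A population unit `(Y(1), Y(0), X*, X)`. -/
abbrev Obs : Type := ℝ × ℝ × ℝ × ℝ

/-- Potential outcome with treatment, `Y(1)`. -/
def outcome₁ (o : Obs) : ℝ := o.1

/-- Potential outcome without treatment, `Y(0)`. -/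
def outcome₀ (o : Obs) : ℝ := o.2.1

/-- Natural running variable `X*`. -/
def natRun (o : Obs) : ℝ := o.2.2.1

/-- Observed running variable `X`. -/
def run (o : Obs) : ℝ := o.2.2.2

/-- Observed outcome `Y = Y(T)` with `T = 1{X ≥ 0}`. -/
def outcome (o : Obs) : ℝ := if 0 ≤ run o then outcome₁ o else outcome₀ o

/-- `g(x) = E(Y | X = x)` for almost every `x` (in the law of `X`), the expectation being taken
under the conditional distribution of `Y` given `X = x`. -/
def IsCondMean (P : Measure Obs) [IsFiniteMeasure P] (X Y : Obs → ℝ) (g : ℝ → ℝ) : Prop :=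
  ∀ᵐ x ∂(P.map X), Integrable (fun y : ℝ => y) (condDistrib Y X P x) ∧
    ∫ y, y ∂(condDistrib Y X P x) = g x

/-- The population law `P` follows the donut model with donut size `d`, `μstar(x) = E(Y | X* = x)`,
`μ(x) = E(Y | X = x)` and `σsq(x) = V(Y | X = x)`, and satisfies the regularity conditions:
`X` has density `f`, the conditional `q`-th absolute moments of `Y - E(Y | X)` are bounded by `B`,
and the conditional variance is `L`-Lipschitz on either side of the threshold and at least `v`. -/
structure IsDonutDGP (f : ℝ → ℝ) (q B v : ℝ) (L : NNReal) (d : ℝ)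
    (P : Measure Obs) [IsProbabilityMeasure P] (μstar μ σsq : ℝ → ℝ) : Prop where
  donut : ∀ᵐ o ∂P, (d ≤ |natRun o| → run o = natRun o) ∧ (|natRun o| < d → |run o| < d)
  continuous₁ : ∃ g : ℝ → ℝ, Continuous g ∧ IsCondMean P natRun outcome₁ g
  continuous₀ : ∃ g : ℝ → ℝ, Continuous g ∧ IsCondMean P natRun outcome₀ g
  natMean : IsCondMean P natRun outcome μstar
  mean : IsCondMean P run outcome μ
  variance : ∀ᵐ x ∂(P.map run), ∫ y, (y - μ x) ^ 2 ∂(condDistrib outcome run P x) = σsq x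
  density : P.map run = volume.withDensity (fun x => ENNReal.ofReal (f x))
  moment : ∀ᵐ x ∂(P.map run),
    ∫⁻ y, ENNReal.ofReal (|y - μ x| ^ q) ∂(condDistrib outcome run P x) ≤ ENNReal.ofReal B
  lipschitz_right : LipschitzOnWith L σsq ((P.map run).support ∩ Set.Ioi 0)
  lipschitz_left : LipschitzOnWith L σsq ((P.map run).support ∩ Set.Iio 0)
  variance_pos : ∀ x ∈ (P.map run).support, x ≠ 0 → v ≤ σsq x

/-- The density `f` of the running variable is continuous, bounded and bounded away from zero on
the open interval `(a, b)`, and the (closed) donut hole is eventually contained in it. -/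
structure DensityRegular (f : ℝ → ℝ) (a b : ℝ) (d : ℕ → ℝ) : Prop where
  measurable : Measurable f
  nonneg : ∀ x, 0 ≤ f x
  continuousOn : ContinuousOn f (Set.Ioo a b)
  bounded : ∃ u : ℝ, ∀ x ∈ Set.Ioo a b, f x ≤ u
  bounded_below : ∃ l : ℝ, 0 < l ∧ ∀ x ∈ Set.Ioo a b, l ≤ f x
  contains_hole : ∀ᶠ n in atTop, Set.Icc (-(d n)) (d n) ⊆ Set.Ioo a b

/-- The null hypothesis, together with the maintained equality outside the donut. -/
def NullHypothesis (d : ℝ) (μstar μ : ℝ → ℝ) : Prop :=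
  (∀ x, d < |x| → μstar x = μ x) ∧ ∀ x, |x| < d → μstar x = μ x

/-- Law of an independent sample of size `n`. -/
def sampleLaw (n : ℕ) (P : Measure Obs) : Measure (Fin n → Obs) :=
  Measure.pi fun _ => P

/-- Observed running variables in a sample. -/
def runs {n : ℕ} (ω : Fin n → Obs) : Fin n → ℝ := fun i => run (ω i)

/-- Observed outcomes in a sample. -/
def outcomes {n : ℕ} (ω : Fin n → Obs) : Fin n → ℝ := fun i => outcome (ω i)

end DonutRD

end

open MeasureTheory ProbabilityTheory Filter Topology

noncomputable section

namespace DonutRD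

/-! ### Convex residuals of weighted linear fits -/

/-! Bias bound. Both weight vectors reproduce lines on each side of the threshold, and outside the
hole the residual of the donut fit satisfies the normal equations. So the difference of the
estimates is minus the sum, over the hole only, of conventional weights times donut residuals
(`sum_diffWeight_eq`). To the right of the threshold, the residual of a convex function from a line
fitted on [d, ∞) is nonnegative and nonincreasing on [0, d] (`residual_nonneg`,
`residual_antitone`), while the conventional weights are the kernel times a line that is nonnegative
at 0. If this line changes sign inside the hole, comparison with the residual at its root still
gives a nonnegative sum (`inner_sum_nonneg`). The left side is the mirror image with the sign
reversed. Hence the difference is nonpositive on functions convex on the right and concave on the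
left. Adding (M/2) x² sign(x) to any m in F(M) produces such a function, which gives the bound, and
m = -(M/2) x² sign(x) attains it.

Size. Under the null hypothesis, given the running variables, the difference is a bias within the
bound plus a weighted sum of independent centred errors. The folded normal tail increases with the
absolute bias (`foldedTail_mono_left`), so a uniform normal approximation suffices. Lindeberg
replacement supplies it once each squared weight is a small share of the total
(`normal_tail_bound`). The limit of the weights is never computed: in each of four regions (inside
or outside the hole, left or right) the weight is the kernel times a line, and a line is controlled
by its values at two separated points. A weight therefore cannot dominate when a fixed large number
of observations falls into suitable sets of length proportional to h - d, or when the kernel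
vanishes on the region (`goodDesign_of_spread`), and n(h - d) → ∞ makes this likely
(`Framework.tendsto_not_goodDesign`).

Estimated standard errors. Rescaling moves the folded tail by at most four times the relative error,
uniformly in bias and critical value (`foldedTail_div_le`). With an accurate variance estimate, a
rejection thus implies that the folded tail at the correctly standardized estimate is at most α plus
a small error, an event free of the variance estimates (`measure_reject_le`). -/

lemma convexOn_three_point {S : Set ℝ} {r : ℝ → ℝ} (hr : ConvexOn ℝ S r) {a b c : ℝ}
    (ha : a ∈ S) (hc : c ∈ S) (hab : a ≤ b) (hbc : b ≤ c) :
    (c - a) * r b ≤ (c - b) * r a + (b - a) * r c := by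
  rcases eq_or_lt_of_le (hab.trans hbc) with h | h
  · have h1 : b = a := le_antisymm (hbc.trans h.ge) hab
    subst h1; subst h; simp
  · have hca : 0 < c - a := sub_pos.2 h
    have h1 := hr.2 ha hc (div_nonneg (sub_nonneg.2 hbc) hca.le)
      (div_nonneg (sub_nonneg.2 hab) hca.le) (by field_simp; ring)
    have h2 : ((c - b) / (c - a)) • a + ((b - a) / (c - a)) • c = b := by
      simp only [smul_eq_mul]; field_simp; ring
    rw [h2] at h1
    simp only [smul_eq_mul] at h1
    calc (c - a) * r b ≤ (c - a) * ((c - b) / (c - a) * r a + (b - a) / (c - a) * r c) :=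
          mul_le_mul_of_nonneg_left h1 hca.le
      _ = _ := by field_simp

/-- A positive semidefinite double sum with a positive entry is positive. -/
lemma double_sum_pos {ι : Type*} {o : Finset ι} {k : ι → ℝ} {D : ι → ι → ℝ}
    (hk : ∀ i ∈ o, 0 ≤ k i) (hD : ∀ i ∈ o, ∀ j ∈ o, 0 ≤ D i j) {i j : ι} (hi : i ∈ o)
    (hj : j ∈ o) (hki : 0 < k i) (hkj : 0 < k j) (hij : 0 < D i j) :
    0 < ∑ i ∈ o, ∑ j ∈ o, k i * k j * D i j := by
  refine Finset.sum_pos' (fun a ha => Finset.sum_nonneg fun b hb =>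
    mul_nonneg (mul_nonneg (hk a ha) (hk b hb)) (hD a ha b hb)) ⟨i, hi, ?_⟩
  exact Finset.sum_pos' (fun b hb =>
    mul_nonneg (mul_nonneg hki.le (hk b hb)) (hD i hi b hb)) ⟨j, hj, by positivity⟩

section Residuals

variable {ι : Type*} {o : Finset ι} {k x : ι → ℝ} {r : ℝ → ℝ} {d : ℝ}

/-- If `r z < 0`, convexity makes r(t)/(t - z) strictly increasing in t > z, so (x_a - z) r(x_b) -
(x_b - z) r(x_a) has the sign of x_b - x_a. The weighted double sum of these determinants times x_b
- x_a is then positive, yet it expands into multiples of the moments in `h0` and `h1`, which vanish.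
-/
lemma residual_nonneg (hk : ∀ i ∈ o, 0 ≤ k i) (hx : ∀ i ∈ o, d ≤ x i) (hr : ConvexOn ℝ (Set.Ici 0) r)
    (h0 : ∑ i ∈ o, k i * r (x i) = 0) (h1 : ∑ i ∈ o, k i * (x i * r (x i)) = 0)
    {i j : ι} (hi : i ∈ o) (hj : j ∈ o) (hki : 0 < k i) (hkj : 0 < k j) (hij : x i < x j)
    {z : ℝ} (hz0 : 0 ≤ z) (hz : z ≤ d) : 0 ≤ r z := by
  by_contra! hneg
  have hlt : ∀ a ∈ o, ∀ b ∈ o, x a ≤ x b →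
      (x b - x a) ^ 2 * (-r z) ≤ (x b - x a) * ((x a - z) * r (x b) - (x b - z) * r (x a)) := by
    intro a ha b hb hab
    have := convexOn_three_point hr (Set.mem_Ici.2 hz0)
      (Set.mem_Ici.2 (hz0.trans (hz.trans (hx b hb)))) (hz.trans (hx a ha)) hab
    nlinarith [sub_nonneg.2 hab]
  have hpos := double_sum_pos (o := o) (k := k)
    (D := fun a b => (x b - x a) * ((x a - z) * r (x b) - (x b - z) * r (x a))) hk
    (fun a ha b hb => by
      rcases le_total (x a) (x b) with h | h
      · exact le_trans (mul_nonneg (sq_nonneg _) (neg_nonneg.2 hneg.le)) (hlt a ha b hb h)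
      · have := le_trans (mul_nonneg (sq_nonneg _) (neg_nonneg.2 hneg.le)) (hlt b hb a ha h)
        linarith) hi hj hki hkj
    (lt_of_lt_of_le (mul_pos (pow_pos (sub_pos.2 hij) 2) (neg_pos.2 hneg)) (hlt i hi j hj hij.le))
  refine hpos.ne' ?_
  set S0 := ∑ b ∈ o, k b
  set S1 := ∑ b ∈ o, k b * x b
  set S2 := ∑ b ∈ o, k b * x b ^ 2
  -- Summing over b removes the terms in r(x_b); what remains is linear in k_a r(x_a) and k_a x_a
  -- r(x_a), and vanishes in the sum over a.
  have inner : ∀ a ∈ o, ∑ b ∈ o, k a * k b * ((x b - x a) * ((x a - z) * r (x b) - (x b - z) * r (x a)))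
      = - (k a * r (x a)) * (S2 - z * S1) + k a * (x a * r (x a)) * (S1 - z * S0) := by
    intro a _
    have : ∑ b ∈ o, k a * k b * ((x b - x a) * ((x a - z) * r (x b) - (x b - z) * r (x a))) =
        k a * (x a - z) * ∑ b ∈ o, k b * (x b * r (x b))
        - k a * (x a - z) * x a * ∑ b ∈ o, k b * r (x b)
        + (- (k a * r (x a)) * (S2 - z * S1) + k a * (x a * r (x a)) * (S1 - z * S0)) := by
      simp only [S0, S1, S2, Finset.mul_sum, ← Finset.sum_sub_distrib, ← Finset.sum_add_distrib]
      exact Finset.sum_congr rfl fun b _ => by ring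
    rw [this, h0, h1]; ring
  rw [Finset.sum_congr rfl inner, Finset.sum_add_distrib, ← Finset.sum_mul, ← Finset.sum_mul,
    Finset.sum_neg_distrib, h0, h1]
  ring

/-- An increase of r between y and z would, by convexity, make r strictly increasing beyond z, hence
positively correlated with x over the observations. Orthogonality to lines forces this weighted
covariance, written as a double sum, to be zero. -/
lemma residual_antitone (hk : ∀ i ∈ o, 0 ≤ k i) (hx : ∀ i ∈ o, d ≤ x i)
    (hr : ConvexOn ℝ (Set.Ici 0) r)
    (h0 : ∑ i ∈ o, k i * r (x i) = 0) (h1 : ∑ i ∈ o, k i * (x i * r (x i)) = 0)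
    {i j : ι} (hi : i ∈ o) (hj : j ∈ o) (hki : 0 < k i) (hkj : 0 < k j) (hij : x i < x j)
    {y z : ℝ} (hy0 : 0 ≤ y) (hyz : y ≤ z) (hz : z ≤ d) : r z ≤ r y := by
  by_contra! hneg
  have hyz' : y < z := lt_of_le_of_ne hyz (by rintro rfl; exact lt_irrefl _ hneg)
  have hz0 : 0 ≤ z := hy0.trans hyz
  have hstep : ∀ a b : ℝ, z ≤ a → a < b → r a < r b := by
    intro a b hza hab
    have e1 := convexOn_three_point hr (Set.mem_Ici.2 hy0) (Set.mem_Ici.2 (hz0.trans hza)) hyz hza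
    have e2 := convexOn_three_point hr (Set.mem_Ici.2 hy0)
      (Set.mem_Ici.2 (hz0.trans (hza.trans hab.le))) (hyz.trans hza) hab.le
    have e3 : r y < r a := by
      by_contra! h
      have : (a - y) * r z ≤ (a - y) * r y := by nlinarith
      have := le_of_mul_le_mul_left this (by linarith)
      linarith
    have e4 : 0 < (b - a) * (r a - r y) := mul_pos (by linarith) (by linarith)
    have e5 : (a - y) * r a < (a - y) * r b := by nlinarith
    exact lt_of_mul_lt_mul_left e5 (by linarith)
  have hmono : ∀ a b : ℝ, z ≤ a → a ≤ b → r a ≤ r b := by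
    intro a b h1 h2
    rcases eq_or_lt_of_le h2 with h | h
    · rw [h]
    · exact (hstep a b h1 h).le
  have hpos := double_sum_pos (o := o) (k := k)
    (D := fun a b => (x b - x a) * (r (x b) - r (x a))) hk
    (fun a ha b hb => by
      rcases le_total (x a) (x b) with h | h
      · exact mul_nonneg (sub_nonneg.2 h) (sub_nonneg.2 (hmono _ _ (hz.trans (hx a ha)) h))
      · exact mul_nonneg_of_nonpos_of_nonpos (sub_nonpos.2 h)
          (sub_nonpos.2 (hmono _ _ (hz.trans (hx b hb)) h))) hi hj hki hkj
    (mul_pos (sub_pos.2 hij) (sub_pos.2 (hstep _ _ (hz.trans (hx i hi)) hij)))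
  refine hpos.ne' ?_
  have inner : ∀ a ∈ o, ∑ b ∈ o, k a * k b * ((x b - x a) * (r (x b) - r (x a)))
      = - (k a * r (x a)) * (∑ b ∈ o, k b * x b) + k a * (x a * r (x a)) * ∑ b ∈ o, k b := by
    intro a _
    have : ∑ b ∈ o, k a * k b * ((x b - x a) * (r (x b) - r (x a))) =
        k a * ∑ b ∈ o, k b * (x b * r (x b)) - k a * x a * ∑ b ∈ o, k b * r (x b)
        + (- (k a * r (x a)) * (∑ b ∈ o, k b * x b) + k a * (x a * r (x a)) * ∑ b ∈ o, k b) := by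
      simp only [Finset.mul_sum, ← Finset.sum_sub_distrib, ← Finset.sum_add_distrib]
      exact Finset.sum_congr rfl fun b _ => by ring
    rw [this, h0, h1]; ring
  rw [Finset.sum_congr rfl inner, Finset.sum_add_distrib, ← Finset.sum_mul, ← Finset.sum_mul,
    Finset.sum_neg_distrib, h0, h1]
  ring

/-- On one side of the threshold, the intercept functional of a linear fit to all observations,
applied inside the donut to the residual of a convex function from its fit outside the donut, is
nonnegative. -/
lemma inner_sum_nonneg {s : Finset ι} (hk : ∀ i ∈ s, 0 ≤ k i) (hx : ∀ i ∈ s, 0 ≤ x i)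
    (hr : ConvexOn ℝ (Set.Ici 0) r)
    (h0 : ∑ i ∈ s with d ≤ x i, k i * r (x i) = 0)
    (h1 : ∑ i ∈ s with d ≤ x i, k i * (x i * r (x i)) = 0)
    {i j : ι} (hi : i ∈ s) (hj : j ∈ s) (hki : 0 < k i) (hkj : 0 < k j) (hdi : d ≤ x i)
    (hij : x i < x j) {A B : ℝ}
    (hp0 : ∑ i ∈ s, k i * (A + B * x i) = 1) (hp1 : ∑ i ∈ s, k i * (A + B * x i) * x i = 0) :
    0 ≤ ∑ i ∈ s with x i < d, k i * (A + B * x i) * r (x i) := by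
  have hko : ∀ i ∈ s.filter (fun i => d ≤ x i), 0 ≤ k i := fun i hi => hk i (Finset.mem_filter.1 hi).1
  have hxo : ∀ i ∈ s.filter (fun i => d ≤ x i), d ≤ x i := fun i hi => (Finset.mem_filter.1 hi).2
  have hio : i ∈ s.filter (fun i => d ≤ x i) := Finset.mem_filter.2 ⟨hi, hdi⟩
  have hjo : j ∈ s.filter (fun i => d ≤ x i) := Finset.mem_filter.2 ⟨hj, hdi.trans hij.le⟩
  have hrn : ∀ z, 0 ≤ z → z ≤ d → 0 ≤ r z := fun z hz0 hz =>
    residual_nonneg hko hxo hr h0 h1 hio hjo hki hkj hij hz0 hz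
  have hra : ∀ y z, 0 ≤ y → y ≤ z → z ≤ d → r z ≤ r y := fun y z hy hyz hz =>
    residual_antitone hko hxo hr h0 h1 hio hjo hki hkj hij hy hyz hz
  -- The two moment conditions on the weights give A = ∑ k (A + B x)².
  have hA : 0 ≤ A := by
    have e : A = ∑ i ∈ s, k i * (A + B * x i) ^ 2 := by
      calc A = A * (∑ i ∈ s, k i * (A + B * x i)) + B * ∑ i ∈ s, k i * (A + B * x i) * x i := by
            rw [hp0, hp1]; ring
        _ = _ := by
            rw [Finset.mul_sum, Finset.mul_sum, ← Finset.sum_add_distrib]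
            exact Finset.sum_congr rfl fun i _ => by ring
    rw [e]
    exact Finset.sum_nonneg fun i hi => mul_nonneg (hk i hi) (sq_nonneg _)
  by_cases hall : ∀ i ∈ s, x i < d → 0 ≤ A + B * x i
  · refine Finset.sum_nonneg fun i hi => ?_
    obtain ⟨his, hid⟩ := Finset.mem_filter.1 hi
    exact mul_nonneg (mul_nonneg (hk i his) (hall i his hid)) (hrn _ (hx i his) hid.le)
  push Not at hall
  obtain ⟨l, hl, hld, hlneg⟩ := hall
  have hB : B < 0 := by
    by_contra! h
    have := mul_nonneg h (hx l hl)
    linarith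
  -- The root of the weight line. It lies in the hole, since the line is nonnegative at 0 and
  -- negative at `x l < d`.
  set c := -A / B with hc
  have hBc : A + B * c = 0 := by rw [hc, mul_div_cancel₀ _ hB.ne]; ring
  have hc0 : 0 ≤ c := div_nonneg_of_nonpos (by linarith) hB.le
  have hcl : c < x l := by
    by_contra! h
    nlinarith
  -- The line and r - r(c) both pass from nonnegative to nonpositive at c, so their product is
  -- nonnegative and r(x) may be replaced by the constant r(c).
  have hterm : ∀ i ∈ s.filter (fun i => x i < d),
      k i * (A + B * x i) * r c ≤ k i * (A + B * x i) * r (x i) := by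
    intro i hi
    obtain ⟨his, hid⟩ := Finset.mem_filter.1 hi
    rcases le_total (x i) c with h | h
    · refine mul_le_mul_of_nonneg_left (hra _ _ (hx i his) h (hcl.trans hld).le)
        (mul_nonneg (hk i his) ?_)
      nlinarith
    · refine mul_le_mul_of_nonpos_left (hra _ _ hc0 h hid.le)
        (mul_nonpos_of_nonneg_of_nonpos (hk i his) ?_)
      nlinarith
  refine le_trans ?_ (Finset.sum_le_sum hterm)
  rw [← Finset.sum_mul]
  refine mul_nonneg ?_ (hrn c hc0 (hcl.trans hld).le)
  -- All weights sum to 1 and those beyond d are nonpositive, so the weights in the hole sum to at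
  -- least 1.
  have hsplit := Finset.sum_filter_add_sum_filter_not s (fun i => x i < d)
    (fun i => k i * (A + B * x i))
  have houter : ∑ i ∈ s with ¬ x i < d, k i * (A + B * x i) ≤ 0 := by
    refine Finset.sum_nonpos fun i hi => ?_
    obtain ⟨his, hid⟩ := Finset.mem_filter.1 hi
    refine mul_nonpos_of_nonneg_of_nonpos (hk i his) ?_
    nlinarith
  linarith

end Residuals

/-! ### Algebra of the weighted least squares weights -/

section Weights

variable {K : ℝ → ℝ} {h d : ℝ} {n : ℕ} {x : Fin n → ℝ}

lemma kernelWeight_nonneg (hK : ∀ u, 0 ≤ K u) (h d z : ℝ) : 0 ≤ kernelWeight K h d z := by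
  unfold kernelWeight; split_ifs
  · exact hK _
  · exact le_rfl

lemma regressor_dot_of_nonneg {z : ℝ} (hz : 0 ≤ z) (β : Fin 4 → ℝ) :
    regressor z ⬝ᵥ β = (β 0 + β 3) + (β 1 + β 2) * z := by
  simp [regressor, treat, hz, dotProduct, Fin.sum_univ_four]; ring

lemma regressor_dot_of_neg {z : ℝ} (hz : z < 0) (β : Fin 4 → ℝ) :
    regressor z ⬝ᵥ β = β 3 + β 1 * z := by
  simp [regressor, treat, not_le.2 hz, dotProduct, Fin.sum_univ_four]; ring

lemma gram_mulVec (v : Fin 4 → ℝ) : Matrix.mulVec (gram K h d x) v =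
    ∑ i, (kernelWeight K h d (x i) * (regressor (x i) ⬝ᵥ v)) • regressor (x i) := by
  simp only [gram, Matrix.sum_mulVec, Matrix.smul_mulVec, Matrix.vecMulVec_mulVec]
  refine Finset.sum_congr rfl fun i _ => ?_
  ext j
  simp [mul_comm, mul_left_comm]

lemma dot_gram_mulVec (v : Fin 4 → ℝ) : v ⬝ᵥ Matrix.mulVec (gram K h d x) v =
    ∑ i, kernelWeight K h d (x i) * (regressor (x i) ⬝ᵥ v) ^ 2 := by
  rw [gram_mulVec, dotProduct_sum]
  refine Finset.sum_congr rfl fun i _ => ?_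
  rw [dotProduct_smul, smul_eq_mul, dotProduct_comm v]; ring

/-- Two distinct observations with positive weight on either side of the threshold. -/
def TwoPoints (K : ℝ → ℝ) (h d : ℝ) {n : ℕ} (x : Fin n → ℝ) : Prop :=
  (∃ i j, 0 ≤ x i ∧ x i < x j ∧ 0 < kernelWeight K h d (x i) ∧ 0 < kernelWeight K h d (x j)) ∧
  (∃ i j, x i < 0 ∧ x j < x i ∧ 0 < kernelWeight K h d (x i) ∧ 0 < kernelWeight K h d (x j))

/-- A null vector has zero quadratic form, so each of its two lines vanishes at two distinct points.
-/
lemma isUnit_gram_of_twoPoints (hK : ∀ u, 0 ≤ K u) (hx : TwoPoints K h d x) :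
    IsUnit (gram K h d x).det := by
  rw [isUnit_iff_ne_zero]
  intro hdet
  obtain ⟨v, hv, hGv⟩ := Matrix.exists_mulVec_eq_zero_iff.2 hdet
  have hq := dot_gram_mulVec (K := K) (h := h) (d := d) (x := x) v
  rw [hGv, dotProduct_zero] at hq
  have hz := (Finset.sum_eq_zero_iff_of_nonneg fun i _ =>
    mul_nonneg (kernelWeight_nonneg hK h d (x i)) (sq_nonneg _)).1 hq.symm
  have hzero : ∀ i, 0 < kernelWeight K h d (x i) → regressor (x i) ⬝ᵥ v = 0 := by
    intro i hi
    rcases mul_eq_zero.1 (hz i (Finset.mem_univ i)) with e | e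
    · exact absurd e hi.ne'
    · exact pow_eq_zero_iff two_ne_zero |>.1 e
  obtain ⟨⟨i, j, hi, hij, hki, hkj⟩, ⟨i', j', hi', hij', hki', hkj'⟩⟩ := hx
  have e1 := hzero i hki
  have e2 := hzero j hkj
  have e3 := hzero i' hki'
  have e4 := hzero j' hkj'
  rw [regressor_dot_of_nonneg hi] at e1
  rw [regressor_dot_of_nonneg (hi.trans hij.le)] at e2
  rw [regressor_dot_of_neg hi'] at e3
  rw [regressor_dot_of_neg (hij'.trans hi')] at e4
  have f1 : (v 1 + v 2) * (x j - x i) = 0 := by linarith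
  have f2 : v 1 + v 2 = 0 := (mul_eq_zero.1 f1).resolve_right (sub_pos.2 hij).ne'
  have f3 : v 1 * (x i' - x j') = 0 := by linarith
  have f4 : v 1 = 0 := (mul_eq_zero.1 f3).resolve_right (sub_pos.2 hij').ne'
  rw [f2] at e1
  rw [f4] at e3
  apply hv
  ext l
  fin_cases l <;> simp <;> linarith

lemma twoPoints_of_isUnit_gram (hK : ∀ u, 0 ≤ K u) (hdet : IsUnit (gram K h d x).det) :
    TwoPoints K h d x := by
  have hno : ∀ v : Fin 4 → ℝ, (∀ i, 0 < kernelWeight K h d (x i) → regressor (x i) ⬝ᵥ v = 0) →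
      v = 0 := by
    intro v hv
    by_contra hne
    refine hdet.ne_zero (Matrix.exists_mulVec_eq_zero_iff.1 ⟨v, hne, ?_⟩)
    rw [gram_mulVec]
    refine Finset.sum_eq_zero fun i _ => ?_
    rcases (kernelWeight_nonneg hK h d (x i)).eq_or_lt with e | e
    · simp [← e]
    · simp [hv i e]
  constructor
  · by_contra! hcon
    have hc : ∃ c, ∀ i, 0 ≤ x i → 0 < kernelWeight K h d (x i) → x i = c := by
      by_cases hex : ∃ i, 0 ≤ x i ∧ 0 < kernelWeight K h d (x i)
      · obtain ⟨i, hi, hki⟩ := hex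
        refine ⟨x i, fun j hj hkj => ?_⟩
        rcases lt_trichotomy (x i) (x j) with hl | hl | hl
        · exact absurd (hcon i j hi hl hki) (not_le.2 hkj)
        · exact hl.symm
        · exact absurd (hcon j i hj hl hkj) (not_le.2 hki)
      · exact ⟨0, fun i hi hki => absurd ⟨i, hi, hki⟩ hex⟩
    obtain ⟨c, hc⟩ := hc
    -- This vector represents the function x - c on the right and 0 on the left.
    have := hno ![-c, 0, 1, 0] (fun i hi => by
      rcases le_or_gt 0 (x i) with hx | hx
      · rw [regressor_dot_of_nonneg hx]; simp [hc i hx hi]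
      · rw [regressor_dot_of_neg hx]; simp)
    simpa using congrFun this 2
  · by_contra! hcon
    have hc : ∃ c, ∀ i, x i < 0 → 0 < kernelWeight K h d (x i) → x i = c := by
      by_cases hex : ∃ i, x i < 0 ∧ 0 < kernelWeight K h d (x i)
      · obtain ⟨i, hi, hki⟩ := hex
        refine ⟨x i, fun j hj hkj => ?_⟩
        rcases lt_trichotomy (x i) (x j) with hl | hl | hl
        · exact absurd (hcon j i hj hl hkj) (not_le.2 hki)
        · exact hl.symm
        · exact absurd (hcon i j hi hl hki) (not_le.2 hkj)
      · exact ⟨0, fun i hi hki => absurd ⟨i, hi, hki⟩ hex⟩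
    obtain ⟨c, hc⟩ := hc
    -- This vector represents 0 on the right and x - c on the left.
    have := hno ![c, 1, -1, -c] (fun i hi => by
      rcases le_or_gt 0 (x i) with hx | hx
      · rw [regressor_dot_of_nonneg hx]; simp
      · rw [regressor_dot_of_neg hx]; simp [hc i hx hi])
    simpa using congrFun this 1

lemma kernelWeight_zero (z : ℝ) : kernelWeight K h 0 z = K (z / h) := by
  simp [kernelWeight]

lemma kernelWeight_of_le {z : ℝ} (hz : d ≤ |z|) : kernelWeight K h d z = K (z / h) := by
  simp [kernelWeight, hz]

lemma kernelWeight_of_lt {z : ℝ} (hz : |z| < d) : kernelWeight K h d z = 0 := by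
  simp [kernelWeight, hz]

lemma le_abs_of_kernelWeight_pos {z : ℝ} (hz : 0 < kernelWeight K h d z) : d ≤ |z| := by
  by_contra! hlt
  rw [kernelWeight_of_lt hlt] at hz
  exact lt_irrefl _ hz

lemma TwoPoints.zero (hx : TwoPoints K h d x) : TwoPoints K h 0 x := by
  have key : ∀ z, 0 < kernelWeight K h d z → 0 < kernelWeight K h 0 z := by
    intro z hz
    have := le_abs_of_kernelWeight_pos hz
    rw [kernelWeight_of_le this] at hz
    rwa [kernelWeight_zero]
  obtain ⟨⟨i, j, hi, hij, hki, hkj⟩, ⟨i', j', hi', hij', hki', hkj'⟩⟩ := hx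
  exact ⟨⟨i, j, hi, hij, key _ hki, key _ hkj⟩, ⟨i', j', hi', hij', key _ hki', key _ hkj'⟩⟩

/-- Coefficients of the linear form defining the weights. -/
def weightCoef (K : ℝ → ℝ) (h d : ℝ) {n : ℕ} (x : Fin n → ℝ) : Fin 4 → ℝ := (gram K h d x)⁻¹ 0

lemma rdWeight_eq (i : Fin n) : rdWeight K h d x i =
    kernelWeight K h d (x i) * (regressor (x i) ⬝ᵥ weightCoef K h d x) := by
  rw [rdWeight, dotProduct_comm]; rfl

/-- Row 0 of G⁻¹ G = 1. Every reproduction property of the weights comes from this identity. -/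
lemma sum_rdWeight_mul_regressor (hdet : IsUnit (gram K h d x).det) (j : Fin 4) :
    ∑ i, rdWeight K h d x i * regressor (x i) j = if j = 0 then 1 else 0 := by
  have h1 : ((gram K h d x)⁻¹ * gram K h d x) 0 j = (1 : Matrix (Fin 4) (Fin 4) ℝ) 0 j := by
    rw [Matrix.nonsing_inv_mul _ hdet]
  rw [Matrix.one_apply] at h1
  simp only [eq_comm (a := j)]
  rw [← h1, Matrix.mul_apply]
  simp only [gram, Matrix.sum_apply, Matrix.smul_apply, Matrix.vecMulVec_apply, smul_eq_mul,
    Finset.mul_sum]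
  rw [Finset.sum_comm]
  refine Finset.sum_congr rfl fun i _ => ?_
  rw [rdWeight_eq, weightCoef, dotProduct, Finset.mul_sum, Finset.sum_mul]
  refine Finset.sum_congr rfl fun l _ => ?_
  simp only [gram]
  ring

lemma exists_fit (hdet : IsUnit (gram K h d x).det) (y : Fin n → ℝ) :
    ∃ β : Fin 4 → ℝ, ∀ j, ∑ i, kernelWeight K h d (x i) * (y i - regressor (x i) ⬝ᵥ β) *
      regressor (x i) j = 0 := by
  set b : Fin 4 → ℝ := ∑ i, (kernelWeight K h d (x i) * y i) • regressor (x i) with hb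
  refine ⟨Matrix.mulVec (gram K h d x)⁻¹ b, fun j => ?_⟩
  have hn : Matrix.mulVec (gram K h d x) (Matrix.mulVec (gram K h d x)⁻¹ b) = b := by
    rw [Matrix.mulVec_mulVec, Matrix.mul_nonsing_inv _ hdet, Matrix.one_mulVec]
  have := congrFun hn j
  rw [gram_mulVec, hb, Finset.sum_apply, Finset.sum_apply] at this
  rw [← sub_eq_zero.2 this.symm, ← Finset.sum_sub_distrib]
  refine Finset.sum_congr rfl fun i _ => ?_
  simp only [Pi.smul_apply, smul_eq_mul]
  ring

lemma sum_rdWeight_mul_dot (hdet : IsUnit (gram K h d x).det) (β : Fin 4 → ℝ) :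
    ∑ i, rdWeight K h d x i * (regressor (x i) ⬝ᵥ β) = β 0 := by
  have : ∑ i, rdWeight K h d x i * (regressor (x i) ⬝ᵥ β) =
      ∑ j, (∑ i, rdWeight K h d x i * regressor (x i) j) * β j := by
    simp only [dotProduct, Finset.mul_sum, Finset.sum_mul]
    rw [Finset.sum_comm]
    exact Finset.sum_congr rfl fun j _ => Finset.sum_congr rfl fun i _ => by ring
  rw [this]
  simp only [sum_rdWeight_mul_regressor hdet]
  simp

lemma sum_kernelWeight_residual_dot {y : Fin n → ℝ} {β : Fin 4 → ℝ}
    (hβ : ∀ j, ∑ i, kernelWeight K h d (x i) * (y i - regressor (x i) ⬝ᵥ β) *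
      regressor (x i) j = 0) (γ : Fin 4 → ℝ) :
    ∑ i, kernelWeight K h d (x i) * (y i - regressor (x i) ⬝ᵥ β) * (regressor (x i) ⬝ᵥ γ) = 0 := by
  have : ∑ i, kernelWeight K h d (x i) * (y i - regressor (x i) ⬝ᵥ β) * (regressor (x i) ⬝ᵥ γ) =
      ∑ j, (∑ i, kernelWeight K h d (x i) * (y i - regressor (x i) ⬝ᵥ β) *
      regressor (x i) j) * γ j := by
    simp only [dotProduct, Finset.mul_sum, Finset.sum_mul]
    rw [Finset.sum_comm]
    exact Finset.sum_congr rfl fun j _ => Finset.sum_congr rfl fun i _ => by ring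
  rw [this]
  exact Finset.sum_eq_zero fun j _ => by rw [hβ j, zero_mul]

/-- The difference of the weights integrates a function to minus the sum, over the observations
inside the donut, of the conventional weights times the residuals of the donut fit. -/
lemma sum_diffWeight_eq (hK : ∀ u, 0 ≤ K u) (hdet : IsUnit (gram K h d x).det)
    {y : Fin n → ℝ} {β : Fin 4 → ℝ}
    (hβ : ∀ j, ∑ i, kernelWeight K h d (x i) * (y i - regressor (x i) ⬝ᵥ β) *
      regressor (x i) j = 0) :
    ∑ i, diffWeight K h d x i * y i =
      - ∑ i with |x i| < d, rdWeight K h 0 x i * (y i - regressor (x i) ⬝ᵥ β) := by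
  have hdet0 := isUnit_gram_of_twoPoints hK (twoPoints_of_isUnit_gram hK hdet).zero
  -- The donut weights are donut kernel weights times a fitted form, to which the residual is
  -- orthogonal.
  have e1 : ∑ i, rdWeight K h d x i * (y i - regressor (x i) ⬝ᵥ β) = 0 := by
    rw [← sum_kernelWeight_residual_dot hβ (weightCoef K h d x)]
    exact Finset.sum_congr rfl fun i _ => by rw [rdWeight_eq]; ring
  -- Outside the hole the two kernel weights coincide, so there the conventional weights also test
  -- the residual against a fitted form under donut kernel weights.
  have e2 : ∑ i with ¬ |x i| < d, rdWeight K h 0 x i * (y i - regressor (x i) ⬝ᵥ β) = 0 := by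
    refine Eq.trans ?_ (sum_kernelWeight_residual_dot hβ (weightCoef K h 0 x))
    rw [Finset.sum_filter]
    refine Finset.sum_congr rfl fun i _ => ?_
    by_cases hi : |x i| < d
    · rw [if_neg (not_not.2 hi), kernelWeight_of_lt hi]; ring
    · rw [if_pos hi, rdWeight_eq, kernelWeight_zero, kernelWeight_of_le (not_lt.1 hi)]; ring
  have e3 := Finset.sum_filter_add_sum_filter_not Finset.univ (fun i => |x i| < d)
    (fun i => rdWeight K h 0 x i * (y i - regressor (x i) ⬝ᵥ β))
  -- Both weight vectors map the fitted form to `β 0`, so the difference annihilates it.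
  have e4 := sum_rdWeight_mul_dot hdet β
  have e5 := sum_rdWeight_mul_dot hdet0 β
  simp only [mul_sub, Finset.sum_sub_distrib] at e1 e2 e3 ⊢
  simp only [diffWeight, sub_mul, Finset.sum_sub_distrib]
  linarith

/-! ### Sign of the difference functional and the sharp bias bound -/

lemma convexOn_neg_comp_neg_sub {g : ℝ → ℝ} (hg : ConvexOn ℝ (Set.Ici 0) g) (A B : ℝ) :
    ConvexOn ℝ (Set.Ici 0) (fun z => g z - (A + B * z)) := by
  refine ⟨convex_Ici 0, fun a ha b hb s t hs ht hst => ?_⟩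
  have := hg.2 ha hb hs ht hst
  simp only [smul_eq_mul] at this ⊢
  have e : A = s * A + t * A := by rw [← add_mul, hst, one_mul]
  nlinarith

/-- The difference of the weights is nonpositive on functions that are convex to the right and
concave to the left of the threshold. -/
lemma sum_diffWeight_nonpos (hK : ∀ u, 0 ≤ K u) (hdet : IsUnit (gram K h d x).det)
    {g₁ g₀ : ℝ → ℝ} (h₁ : ConvexOn ℝ (Set.Ici 0) g₁)
    (h₀ : ConvexOn ℝ (Set.Ici 0) (fun z => -g₀ (-z))) :
    ∑ i, diffWeight K h d x i * (if 0 ≤ x i then g₁ (x i) else g₀ (x i)) ≤ 0 := by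
  have h2 := twoPoints_of_isUnit_gram hK hdet
  have hdet0 := isUnit_gram_of_twoPoints hK h2.zero
  obtain ⟨β, hβ⟩ := exists_fit hdet (fun i => if 0 ≤ x i then g₁ (x i) else g₀ (x i))
  rw [sum_diffWeight_eq hK hdet hβ, neg_nonpos]
  set γ := weightCoef K h 0 x with hγ
  have hw : ∀ i, rdWeight K h 0 x i = K (x i / h) * (regressor (x i) ⬝ᵥ γ) := by
    intro i; rw [rdWeight_eq, kernelWeight_zero]
  obtain ⟨⟨i, j, hi, hij, hki, hkj⟩, ⟨i', j', hi', hij', hki', hkj'⟩⟩ := h2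
  have hdi := le_abs_of_kernelWeight_pos hki
  have hdi' := le_abs_of_kernelWeight_pos hki'
  have hdj := le_abs_of_kernelWeight_pos hkj
  have hdj' := le_abs_of_kernelWeight_pos hkj'
  rw [kernelWeight_of_le hdi] at hki
  rw [kernelWeight_of_le hdi'] at hki'
  rw [kernelWeight_of_le hdj] at hkj
  rw [kernelWeight_of_le hdj'] at hkj'
  rw [abs_of_nonneg hi] at hdi
  rw [abs_of_neg hi'] at hdi'
  have m0 := sum_rdWeight_mul_regressor hdet0 0
  have m1 := sum_rdWeight_mul_regressor hdet0 1
  have m2 := sum_rdWeight_mul_regressor hdet0 2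
  have m3 := sum_rdWeight_mul_regressor hdet0 3
  have b0 := hβ 0
  have b1 := hβ 1
  have b2 := hβ 2
  have b3 := hβ 3
  -- the two sides of the threshold
  have right : 0 ≤ ∑ i ∈ Finset.univ.filter (fun i => 0 ≤ x i) with x i < d,
      K (x i / h) * ((γ 0 + γ 3) + (γ 1 + γ 2) * x i) *
        (g₁ (x i) - ((β 0 + β 3) + (β 1 + β 2) * x i)) := by
    refine inner_sum_nonneg (k := fun i => K (x i / h)) (fun i _ => hK _)
      (fun i hi => (Finset.mem_filter.1 hi).2) (convexOn_neg_comp_neg_sub h₁ _ _) ?_ ?_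
      (i := i) (j := j) (by simp [hi]) (by simp [hi.trans hij.le]) hki hkj hdi hij ?_ ?_
    · refine Eq.trans ?_ b0
      rw [Finset.filter_filter, Finset.sum_filter]
      refine Finset.sum_congr rfl fun i _ => ?_
      rcases le_or_gt 0 (x i) with hx | hx
      · rw [regressor_dot_of_nonneg hx]
        simp [regressor, treat, hx, kernelWeight, abs_of_nonneg hx]
      · simp [regressor, treat, not_le.2 hx]
    · refine Eq.trans ?_ b2
      rw [Finset.filter_filter, Finset.sum_filter]
      refine Finset.sum_congr rfl fun i _ => ?_
      rcases le_or_gt 0 (x i) with hx | hx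
      · rw [regressor_dot_of_nonneg hx]
        simp only [regressor, treat, hx, kernelWeight, abs_of_nonneg hx]
        simp; try (split_ifs <;> ring)
      · simp [regressor, treat, not_le.2 hx]
    · simp only [if_true] at m0
      refine Eq.trans ?_ m0
      rw [Finset.sum_filter]
      refine Finset.sum_congr rfl fun i _ => ?_
      rcases le_or_gt 0 (x i) with hx | hx
      · rw [hw, regressor_dot_of_nonneg hx]; simp [regressor, treat, hx]
      · simp [regressor, treat, not_le.2 hx]
    · rw [if_neg (by decide)] at m2
      refine Eq.trans ?_ m2
      rw [Finset.sum_filter]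
      refine Finset.sum_congr rfl fun i _ => ?_
      rcases le_or_gt 0 (x i) with hx | hx
      · rw [hw, regressor_dot_of_nonneg hx]; simp [regressor, treat, hx]
      · simp [regressor, treat, not_le.2 hx]
  -- Left weights sum to -1. Negating both the weight and the residual leaves their product
  -- unchanged and, after x ↦ -x, turns the left side into an instance of the right one.
  have left : 0 ≤ ∑ i ∈ Finset.univ.filter (fun i => x i < 0) with - x i < d,
      K (x i / h) * (-γ 3 + γ 1 * (-x i)) * (-g₀ (- (- x i)) - (-β 3 + β 1 * (-x i))) := by
    refine inner_sum_nonneg (k := fun i => K (x i / h)) (x := fun i => - x i)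
      (r := fun z => -g₀ (-z) - (-β 3 + β 1 * z)) (fun i _ => hK _)
      (fun i hi => by have := (Finset.mem_filter.1 hi).2; linarith)
      (convexOn_neg_comp_neg_sub h₀ _ _) ?_ ?_
      (i := i') (j := j') (by simp [hi']) (by simp [hij'.trans hi']) hki' hkj' hdi'
      (neg_lt_neg hij') ?_ ?_
    -- The left side is isolated by the combinations T - 1 for the constant and x - T x for the
    -- slope.
    · have : ∑ i, kernelWeight K h d (x i) * ((if 0 ≤ x i then g₁ (x i) else g₀ (x i))
          - regressor (x i) ⬝ᵥ β) * (regressor (x i) 0 - regressor (x i) 3) = 0 := by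
        simp only [mul_sub (_ * _), Finset.sum_sub_distrib, b0, b3, sub_zero]
      refine Eq.trans ?_ this
      rw [Finset.filter_filter, Finset.sum_filter]
      refine Finset.sum_congr rfl fun i _ => ?_
      rcases le_or_gt 0 (x i) with hx | hx
      · simp [regressor, treat, hx, not_lt.2 hx]
      · rw [regressor_dot_of_neg hx]
        simp only [regressor, treat, hx, not_le.2 hx, kernelWeight, abs_of_neg hx]
        simp; try (split_ifs <;> ring)
    · have : ∑ i, kernelWeight K h d (x i) * ((if 0 ≤ x i then g₁ (x i) else g₀ (x i))
          - regressor (x i) ⬝ᵥ β) * (regressor (x i) 1 - regressor (x i) 2) = 0 := by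
        simp only [mul_sub (_ * _), Finset.sum_sub_distrib, b1, b2, sub_zero]
      refine Eq.trans ?_ this
      rw [Finset.filter_filter, Finset.sum_filter]
      refine Finset.sum_congr rfl fun i _ => ?_
      rcases le_or_gt 0 (x i) with hx | hx
      · simp [regressor, treat, hx, not_lt.2 hx]
      · rw [regressor_dot_of_neg hx]
        simp only [regressor, treat, hx, not_le.2 hx, kernelWeight, abs_of_neg hx]
        simp; split_ifs <;> ring
    · have : ∑ i, rdWeight K h 0 x i * (regressor (x i) 0 - regressor (x i) 3) = 1 := by
        simp [mul_sub, m0, m3]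
      refine Eq.trans ?_ this
      rw [Finset.sum_filter]
      refine Finset.sum_congr rfl fun i _ => ?_
      rcases le_or_gt 0 (x i) with hx | hx
      · simp [regressor, treat, hx, not_lt.2 hx]
      · rw [hw, regressor_dot_of_neg hx]
        simp [regressor, treat, hx, not_le.2 hx]; ring
    · have : ∑ i, rdWeight K h 0 x i * (regressor (x i) 1 - regressor (x i) 2) = 0 := by
        simp [mul_sub, m1, m2]
      refine Eq.trans ?_ this
      rw [Finset.sum_filter]
      refine Finset.sum_congr rfl fun i _ => ?_
      rcases le_or_gt 0 (x i) with hx | hx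
      · simp [regressor, treat, hx, not_lt.2 hx]
      · rw [hw, regressor_dot_of_neg hx]
        simp [regressor, treat, hx, not_le.2 hx]; ring
  have total : ∑ i with |x i| < d, rdWeight K h 0 x i *
      ((if 0 ≤ x i then g₁ (x i) else g₀ (x i)) - regressor (x i) ⬝ᵥ β) =
      (∑ i ∈ Finset.univ.filter (fun i => 0 ≤ x i) with x i < d,
        K (x i / h) * ((γ 0 + γ 3) + (γ 1 + γ 2) * x i) *
        (g₁ (x i) - ((β 0 + β 3) + (β 1 + β 2) * x i))) +
      ∑ i ∈ Finset.univ.filter (fun i => x i < 0) with - x i < d,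
        K (x i / h) * (-γ 3 + γ 1 * (-x i)) * (-g₀ (- (- x i)) - (-β 3 + β 1 * (-x i))) := by
    rw [Finset.filter_filter, Finset.filter_filter, Finset.sum_filter, Finset.sum_filter,
      Finset.sum_filter, ← Finset.sum_add_distrib]
    refine Finset.sum_congr rfl fun i _ => ?_
    rcases le_or_gt 0 (x i) with hx | hx
    · rw [hw, regressor_dot_of_nonneg hx, regressor_dot_of_nonneg hx]
      simp [hx, not_lt.2 hx, abs_of_nonneg hx]
    · rw [hw, regressor_dot_of_neg hx, regressor_dot_of_neg hx]
      simp only [hx, not_le.2 hx, abs_of_neg hx, true_and, false_and, if_false, zero_add, neg_neg]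
      split_ifs <;> ring
  rw [total]
  exact add_nonneg right left

lemma convexOn_quadratic_add {M : ℝ} {m : ℝ → ℝ} (hm : ContDiff ℝ 2 m)
    (hM : ∀ z, |iteratedDeriv 2 m z| ≤ M) : ConvexOn ℝ Set.univ (fun z => M / 2 * z ^ 2 + m z) := by
  have hd1 : ∀ z, HasDerivAt (fun z => M / 2 * z ^ 2 + m z) (M * z + deriv m z) z := by
    intro z
    have h1 := ((hasDerivAt_pow 2 z).const_mul (M / 2)).add
      (hm.differentiable (by norm_num)).differentiableAt.hasDerivAt
    convert! h1 using 1
    simp; ring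
  have hd1' : deriv (fun z => M / 2 * z ^ 2 + m z) = fun z => M * z + deriv m z :=
    funext fun z => (hd1 z).deriv
  have hdm : Differentiable ℝ (deriv m) := by
    have : ContDiff ℝ 1 (deriv m) := ((contDiff_succ_iff_deriv (n := 1)).1 hm).2.2
    exact this.differentiable (by norm_num)
  have hd2 : ∀ z, HasDerivAt (fun z => M * z + deriv m z) (M + deriv (deriv m) z) z := by
    intro z
    have := ((hasDerivAt_id z).const_mul M).add (hdm z).hasDerivAt
    simp only [mul_one] at this
    exact this
  refine convexOn_univ_of_deriv2_nonneg (fun z => (hd1 z).differentiableAt) ?_ ?_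
  · rw [hd1']; exact fun z => (hd2 z).differentiableAt
  · intro z
    simp only [Function.iterate_succ, Function.iterate_zero, Function.comp, id]
    rw [hd1', (hd2 z).deriv]
    have := hM z
    rw [iteratedDeriv_succ, iteratedDeriv_one] at this
    linarith [(abs_le.1 this).1]

/-- Adding (M/2) x² sign(x) makes the right branch convex and the left branch concave. The
functional is nonpositive on the sum, and its value on the added term is minus the bound. -/
lemma diffBias_le (hK : ∀ u, 0 ≤ K u) (hdet : IsUnit (gram K h d x).det)
    {M : ℝ} {m : ℝ → ℝ} (hm : m ∈ smoothClass M) :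
    diffBias K h d x m ≤ diffBiasBound M K h d x := by
  obtain ⟨m₀, m₁, c₀, c₁, b₀, b₁, rfl⟩ := hm
  have h1 : ConvexOn ℝ (Set.Ici 0) (fun z => M / 2 * z ^ 2 + m₁ z) :=
    (convexOn_quadratic_add c₁ b₁).subset (Set.subset_univ _) (convex_Ici 0)
  have h0 : ConvexOn ℝ (Set.Ici 0) (fun z => - (- (M / 2) * (-z) ^ 2 + m₀ (-z))) := by
    have c : ContDiff ℝ 2 (fun z => - m₀ (-z)) := (c₀.comp contDiff_neg).neg
    have b : ∀ z, |iteratedDeriv 2 (fun z => - m₀ (-z)) z| ≤ M := by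
      intro z
      rw [iteratedDeriv_fun_neg, iteratedDeriv_comp_neg, abs_neg]
      simpa using b₀ (-z)
    have := (convexOn_quadratic_add c b).subset (Set.subset_univ _) (convex_Ici 0)
    convert this using 2
    ring
  have := sum_diffWeight_nonpos hK hdet h1 (g₀ := fun z => - (M / 2) * z ^ 2 + m₀ z) h0
  rw [diffBias, diffBiasBound, Finset.mul_sum, ← sub_nonpos, ← Finset.sum_sub_distrib]
  refine le_trans (le_of_eq ?_) this
  refine Finset.sum_congr rfl fun i _ => ?_
  rcases lt_trichotomy (x i) 0 with hx | hx | hx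
  · simp only [not_le.2 hx, if_false, Real.sign_of_neg hx]; ring
  · simp [hx]
  · simp only [hx.le, if_true, Real.sign_of_pos hx]; ring

lemma neg_mem_smoothClass {M : ℝ} {m : ℝ → ℝ} (hm : m ∈ smoothClass M) :
    (fun z => - m z) ∈ smoothClass M := by
  obtain ⟨m₀, m₁, c₀, c₁, b₀, b₁, rfl⟩ := hm
  refine ⟨fun z => - m₀ z, fun z => - m₁ z, c₀.neg, c₁.neg, fun z => ?_, fun z => ?_, ?_⟩
  · rw [iteratedDeriv_fun_neg, abs_neg]; exact b₀ z
  · rw [iteratedDeriv_fun_neg, abs_neg]; exact b₁ z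
  · ext z; dsimp only; split_ifs <;> rfl

lemma abs_diffBias_le (hK : ∀ u, 0 ≤ K u) (hdet : IsUnit (gram K h d x).det)
    {M : ℝ} {m : ℝ → ℝ} (hm : m ∈ smoothClass M) :
    |diffBias K h d x m| ≤ diffBiasBound M K h d x := by
  refine abs_le'.2 ⟨diffBias_le hK hdet hm, ?_⟩
  have e : diffBias K h d x (fun z => - m z) = - diffBias K h d x m := by
    simp only [diffBias, mul_neg, Finset.sum_neg_distrib]
  exact e ▸ diffBias_le hK hdet (neg_mem_smoothClass hm)

lemma worstCase_mem_smoothClass {M : ℝ} (hM : 0 ≤ M) :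
    (fun z => if 0 ≤ z then -(M / 2) * z ^ 2 else M / 2 * z ^ 2) ∈ smoothClass M := by
  have key : ∀ (c : ℝ) (z : ℝ), iteratedDeriv 2 (fun z => c * z ^ 2) z = 2 * c := by
    intro c z
    rw [iteratedDeriv_succ, iteratedDeriv_one]
    have : deriv (fun z : ℝ => c * z ^ 2) = fun z => 2 * c * z := by
      ext z
      have := ((hasDerivAt_pow 2 z).const_mul c).deriv
      rw [this]; simp; ring
    rw [this]
    simp
  refine ⟨fun z => M / 2 * z ^ 2, fun z => -(M / 2) * z ^ 2, by fun_prop, by fun_prop, ?_, ?_, rfl⟩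
  · intro z; rw [key, abs_of_nonneg] <;> linarith
  · intro z; rw [key, abs_of_nonpos] <;> linarith

/-- The sharp finite-sample bias bound. -/
lemma isLUB_diffBias (hK : ∀ u, 0 ≤ K u) (hdet : IsUnit (gram K h d x).det)
    {M : ℝ} (hM : 0 ≤ M) :
    IsLUB {r | ∃ m ∈ smoothClass M, r = |diffBias K h d x m|} (diffBiasBound M K h d x) := by
  refine ⟨?_, fun u hu => hu ⟨_, worstCase_mem_smoothClass hM, ?_⟩⟩
  · rintro _ ⟨m, hm, rfl⟩
    exact abs_diffBias_le hK hdet hm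
  -- The bound dominates an absolute value, so the outer absolute value can be dropped at the
  -- maximizer -(M/2) x² sign(x).
  · have h0 : 0 ≤ diffBiasBound M K h d x :=
      (abs_nonneg _).trans (abs_diffBias_le hK hdet (worstCase_mem_smoothClass hM))
    rw [← abs_of_nonneg h0, diffBias, diffBiasBound, Finset.mul_sum]
    congr 1
    refine Finset.sum_congr rfl fun i _ => ?_
    rcases lt_trichotomy (x i) 0 with hx | hx | hx
    · simp only [not_le.2 hx, if_false, Real.sign_of_neg hx]; ring
    · simp [hx]
    · simp only [hx.le, if_true, Real.sign_of_pos hx]; ring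

end Weights

/-! ### Tails of the folded normal distribution -/

/-- Standard normal distribution function. -/
def stdCdf (t : ℝ) : ℝ := cdf (gaussianReal 0 1) t

/-- Standard normal density. -/
def stdPdf (t : ℝ) : ℝ := gaussianPDFReal 0 1 t

lemma stdPdf_eq (t : ℝ) : stdPdf t = (√(2 * Real.pi))⁻¹ * Real.exp (-(t ^ 2) / 2) := by
  simp [stdPdf, gaussianPDFReal]

lemma continuous_stdPdf : Continuous stdPdf := by
  rw [funext stdPdf_eq]; fun_prop

lemma inv_sqrt_two_pi_le_one : (√(2 * Real.pi))⁻¹ ≤ 1 := by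
  refine inv_le_one_of_one_le₀ (Real.one_le_sqrt.2 ?_)
  linarith [Real.pi_gt_three]

lemma stdPdf_nonneg (t : ℝ) : 0 ≤ stdPdf t := gaussianPDFReal_nonneg _ _ _

lemma stdPdf_le_exp (t : ℝ) : stdPdf t ≤ Real.exp (-(t ^ 2) / 2) := by
  rw [stdPdf_eq]
  exact mul_le_of_le_one_left (Real.exp_pos _).le inv_sqrt_two_pi_le_one

lemma stdPdf_le_one (t : ℝ) : stdPdf t ≤ 1 :=
  (stdPdf_le_exp t).trans (Real.exp_le_one_iff.2 (by nlinarith [sq_nonneg t]))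

lemma stdPdf_le_stdPdf {s t : ℝ} (h : |s| ≤ |t|) : stdPdf t ≤ stdPdf s := by
  rw [stdPdf_eq, stdPdf_eq]
  have := sq_le_sq.2 h
  gcongr

/-- Holds because |t| ≤ 1 + t²/2 ≤ exp(t²/2). It makes rescaling bounds for the normal distribution
function uniform in t. -/
lemma abs_mul_stdPdf_le (t : ℝ) : |t| * stdPdf t ≤ 1 := by
  have h1 : |t| ≤ Real.exp (t ^ 2 / 2) := by
    have := Real.add_one_le_exp (t ^ 2 / 2)
    nlinarith [sq_nonneg (|t| - 1), sq_abs t]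
  calc |t| * stdPdf t ≤ Real.exp (t ^ 2 / 2) * Real.exp (-(t ^ 2) / 2) :=
        mul_le_mul h1 (stdPdf_le_exp t) (stdPdf_nonneg t) (Real.exp_pos _).le
    _ = 1 := by rw [← Real.exp_add]; simp [neg_div]

lemma stdCdf_sub (a b : ℝ) : stdCdf b - stdCdf a = ∫ t in a..b, stdPdf t := by
  have hi : Integrable stdPdf := integrable_gaussianPDFReal 0 1
  have key : ∀ t, stdCdf t = ∫ s in Set.Iic t, stdPdf s := by
    intro t
    rw [stdCdf, cdf_eq_real, measureReal_def, gaussianReal_apply_eq_integral _ one_ne_zero,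
      ENNReal.toReal_ofReal]
    · rfl
    · exact integral_nonneg fun s => gaussianPDFReal_nonneg _ _ _
  rw [key, key, intervalIntegral.integral_Iic_sub_Iic hi.integrableOn hi.integrableOn]

lemma hasDerivAt_stdCdf (t : ℝ) : HasDerivAt stdCdf (stdPdf t) t := by
  have h1 : stdCdf = fun t => stdCdf 0 + ∫ s in (0 : ℝ)..t, stdPdf s := by
    ext t; rw [← stdCdf_sub]; ring
  rw [h1]
  exact (intervalIntegral.integral_hasDerivAt_right (continuous_stdPdf.intervalIntegrable _ _)
    (continuous_stdPdf.stronglyMeasurableAtFilter _ _) continuous_stdPdf.continuousAt).const_add _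

lemma continuous_stdCdf : Continuous stdCdf :=
  continuous_iff_continuousAt.2 fun t => (hasDerivAt_stdCdf t).continuousAt

lemma monotone_stdCdf : Monotone stdCdf := monotone_cdf _

lemma stdCdf_add_le {t η : ℝ} (hη : 0 ≤ η) : stdCdf (t + η) ≤ stdCdf t + η := by
  have h1 := stdCdf_sub t (t + η)
  have h2 : ∫ s in t..(t + η), stdPdf s ≤ ∫ s in t..(t + η), (1 : ℝ) :=
    intervalIntegral.integral_mono_on (by linarith) (continuous_stdPdf.intervalIntegrable _ _)
      (by simp) fun s _ => stdPdf_le_one s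
  simp at h2
  linarith

lemma gaussianReal_Iic (r t : ℝ) : (gaussianReal r 1).real (Set.Iic t) = stdCdf (t - r) := by
  have h1 := gaussianReal_map_add_const (μ := 0) (v := 1) r
  rw [zero_add] at h1
  rw [← h1, measureReal_def, Measure.map_apply (by fun_prop) measurableSet_Iic, stdCdf, cdf_eq_real,
    measureReal_def]
  congr 2
  ext z; simp [le_sub_iff_add_le]

lemma gaussianReal_Ici (r t : ℝ) : (gaussianReal r 1).real (Set.Ici t) = stdCdf (r - t) := by
  have h1 := gaussianReal_map_neg (μ := -r) (v := 1)
  rw [neg_neg] at h1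
  rw [← h1, measureReal_def, Measure.map_apply (by fun_prop) measurableSet_Ici]
  have : (fun x : ℝ => -x) ⁻¹' Set.Ici t = Set.Iic (-t) := by ext z; simp
  rw [this, ← measureReal_def, gaussianReal_Iic]
  congr 1; ring

lemma stdCdf_neg (t : ℝ) : stdCdf (-t) = 1 - stdCdf t := by
  have : NullSingletonClass (gaussianReal 0 1) := nullSingletonClass_gaussianReal one_ne_zero
  have h1 := gaussianReal_Ici 0 t
  have h2 := measureReal_compl (μ := gaussianReal 0 1) (measurableSet_Iio (a := t))
  rw [Set.compl_Iio, probReal_univ, h1, zero_sub] at h2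
  rw [h2, measureReal_congr (Iio_ae_eq_Iic (μ := gaussianReal 0 1)), gaussianReal_Iic, sub_zero]

/-- `P(|N(r, 1)| ≥ c)`, for `c ≥ 0`. -/
def foldedTail (r c : ℝ) : ℝ := stdCdf (r - c) + stdCdf (-r - c)

lemma continuous_foldedTail : Continuous fun p : ℝ × ℝ => foldedTail p.1 p.2 := by
  unfold foldedTail
  have := continuous_stdCdf
  fun_prop

lemma foldedTail_antitone (r : ℝ) : Antitone (foldedTail r) := fun a b hab =>
  add_le_add (monotone_stdCdf (by linarith)) (monotone_stdCdf (by linarith))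

lemma foldedTail_zero (r : ℝ) : foldedTail r 0 = 1 := by
  simp [foldedTail, stdCdf_neg]

lemma foldedTail_neg (r c : ℝ) : foldedTail (-r) c = foldedTail r c := by
  simp [foldedTail, add_comm]

/-- The tail is even in r, and its derivative in r > 0 is the density at r - c minus the density at
r + c, nonnegative because |r - c| ≤ r + c. The bias bound is therefore the least favourable bias.
-/
lemma foldedTail_mono_left {b r c : ℝ} (hb : |b| ≤ r) (hc : 0 ≤ c) :
    foldedTail b c ≤ foldedTail r c := by
  have key : MonotoneOn (fun r => foldedTail r c) (Set.Ici 0) := by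
    have hder : ∀ r, HasDerivAt (fun r => foldedTail r c) (stdPdf (r - c) - stdPdf (-r - c)) r := by
      intro r
      have h1 := (hasDerivAt_stdCdf (r - c)).comp r ((hasDerivAt_id r).sub_const c)
      have h2 := (hasDerivAt_stdCdf (-r - c)).comp r ((hasDerivAt_id r).neg.sub_const c)
      have := h1.add h2
      simp only [mul_one, mul_neg] at this
      exact this
    refine monotoneOn_of_deriv_nonneg (convex_Ici 0)
      (fun r _ => (hder r).continuousAt.continuousWithinAt)
      (fun r _ => (hder r).differentiableAt.differentiableWithinAt) fun r hr => ?_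
    rw [(hder r).deriv, sub_nonneg]
    rw [interior_Ici] at hr
    have hr' : 0 < r := hr
    refine stdPdf_le_stdPdf ?_
    rw [show -r - c = -(r + c) by ring, abs_neg, abs_of_nonneg (by linarith : 0 ≤ r + c)]
    exact abs_le.2 ⟨by linarith, by linarith⟩
  have h1 : foldedTail b c = foldedTail |b| c := by
    rcases abs_choice b with h | h <;> rw [h]
    rw [foldedTail_neg]
  rw [h1]
  exact key (Set.mem_Ici.2 (abs_nonneg b)) (Set.mem_Ici.2 ((abs_nonneg b).trans hb)) hb

/-- The derivative in ρ is t times the density at ρ t, at most 1/ρ ≤ 2 in absolute value. No bound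
on t enters, so neither the bias ratio nor the critical value has to stay bounded. -/
lemma abs_stdCdf_mul_sub_le {ρ : ℝ} (hρ : 1 / 2 ≤ ρ) (t : ℝ) :
    |stdCdf (ρ * t) - stdCdf t| ≤ 2 * |ρ - 1| := by
  have hder : ∀ ρ ∈ Set.Ici (1 / 2 : ℝ),
      HasDerivWithinAt (fun ρ => stdCdf (ρ * t)) (stdPdf (ρ * t) * t) (Set.Ici (1 / 2 : ℝ)) ρ := by
    intro ρ _
    have := (hasDerivAt_stdCdf (ρ * t)).comp ρ ((hasDerivAt_id ρ).mul_const t)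
    simp only [one_mul] at this
    exact this.hasDerivWithinAt
  have hb : ∀ ρ ∈ Set.Ici (1 / 2 : ℝ), ‖stdPdf (ρ * t) * t‖ ≤ 2 := by
    intro ρ hρ
    have hρ' : 1 / 2 ≤ ρ := hρ
    have h1 := abs_mul_stdPdf_le (ρ * t)
    rw [abs_mul, abs_of_pos (by linarith : 0 < ρ)] at h1
    rw [Real.norm_eq_abs, abs_mul, abs_of_nonneg (stdPdf_nonneg _)]
    have h2 := mul_nonneg (abs_nonneg t) (stdPdf_nonneg (ρ * t))
    nlinarith
  have := (convex_Ici (1 / 2 : ℝ)).norm_image_sub_le_of_norm_hasDerivWithin_le hder hb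
    (Set.mem_Ici.2 (by norm_num : (1 / 2 : ℝ) ≤ 1)) (Set.mem_Ici.2 hρ)
  simpa using this

lemma foldedTail_div_le {ρ : ℝ} (hρ : 1 / 2 ≤ ρ) (r c : ℝ) :
    foldedTail r (c / ρ) ≤ foldedTail (ρ * r) c + 4 * |ρ - 1| := by
  have hρ0 : ρ ≠ 0 := by linarith
  have h1 := abs_le.1 (abs_stdCdf_mul_sub_le hρ (r - c / ρ))
  have h2 := abs_le.1 (abs_stdCdf_mul_sub_le hρ (-r - c / ρ))
  rw [mul_sub, mul_div_cancel₀ _ hρ0] at h1 h2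
  rw [mul_neg] at h2
  unfold foldedTail
  linarith

lemma tendsto_foldedTail_atTop (r : ℝ) : Tendsto (foldedTail r) atTop (𝓝 0) := by
  have h : ∀ s : ℝ, Tendsto (fun c : ℝ => stdCdf (s - c)) atTop (𝓝 0) := fun s =>
    (tendsto_cdf_atBot (gaussianReal 0 1)).comp
      (tendsto_atBot_add_const_left _ s tendsto_neg_atTop_atBot)
  have := (h r).add (h (-r))
  rw [add_zero] at this
  exact this

lemma gaussianReal_abs_le {r c : ℝ} (hc : 0 ≤ c) :
    (gaussianReal r 1).real {z | |z| ≤ c} = 1 - foldedTail r c := by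
  have : NullSingletonClass (gaussianReal r 1) := nullSingletonClass_gaussianReal one_ne_zero
  have h1 : {z : ℝ | |z| ≤ c} = Set.Iic c \ Set.Iio (-c) := by
    ext z
    simp only [Set.mem_ofPred_eq, abs_le, Set.mem_sdiff, Set.mem_Iic, Set.mem_Iio, not_lt]
    exact and_comm
  rw [h1, measureReal_sdiff (fun z hz => by
      simp only [Set.mem_Iio, Set.mem_Iic] at *; linarith) measurableSet_Iio,
    measureReal_congr (Iio_ae_eq_Iic (μ := gaussianReal r 1)), gaussianReal_Iic, gaussianReal_Iic,
    foldedTail, show c - r = -(r - c) by ring, stdCdf_neg, show -c - r = -r - c by ring]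
  ring

/-- The infimum of a closed nonempty set is attained, and the tail at 0 equals 1 > α. Strict
positivity is what prevents a zero t-statistic from rejecting. -/
lemma criticalValue_spec {α : ℝ} (hα₀ : 0 < α) (hα₁ : α < 1) (r : ℝ) :
    0 < criticalValue α r ∧ foldedTail r (criticalValue α r) ≤ α := by
  have hS : {c : ℝ | 1 - α ≤ (gaussianReal r 1).real {z | |z| ≤ c}} =
      {c : ℝ | 0 ≤ c ∧ foldedTail r c ≤ α} := by
    ext c
    rcases le_or_gt 0 c with hc | hc
    · simp only [Set.mem_ofPred_eq, gaussianReal_abs_le hc, hc, true_and]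
      constructor <;> intro <;> linarith
    -- Negative c have probability 0 < 1 - α and do not enter the infimum.
    · have : {z : ℝ | |z| ≤ c} = ∅ :=
        Set.eq_empty_of_forall_notMem fun z hz => absurd (le_trans (abs_nonneg z) hz) (not_le.2 hc)
      simp [this, hc.not_ge, hα₁]
  have hcl : IsClosed {c : ℝ | 0 ≤ c ∧ foldedTail r c ≤ α} := by
    have : Continuous (foldedTail r) :=
      continuous_foldedTail.comp (Continuous.prodMk continuous_const continuous_id)
    exact (isClosed_le continuous_const continuous_id).inter (isClosed_le this continuous_const)
  have hne : {c : ℝ | 0 ≤ c ∧ foldedTail r c ≤ α}.Nonempty := by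
    have h1 := (tendsto_foldedTail_atTop r).eventually (ge_mem_nhds hα₀)
    obtain ⟨c, h2, h3⟩ := (h1.and (eventually_ge_atTop 0)).exists
    exact ⟨c, h3, h2⟩
  have hmem := hcl.csInf_mem hne ⟨0, fun c hc => hc.1⟩
  rw [criticalValue, hS]
  refine ⟨lt_of_le_of_ne hmem.1 fun h0 => ?_, hmem.2⟩
  have := hmem.2
  rw [← h0, foldedTail_zero] at this
  linarith

/-! ### A uniform central limit theorem by Lindeberg replacement -/

/-- The remainder `min(y², |y|³)` of a second order expansion. -/
def remFun (y : ℝ) : ℝ := min (y ^ 2) (|y| ^ 3)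

lemma remFun_nonneg (y : ℝ) : 0 ≤ remFun y := le_min (sq_nonneg _) (pow_nonneg (abs_nonneg _) _)

lemma continuous_remFun : Continuous remFun := by unfold remFun; fun_prop

/-- Second order expansions of `f` with remainder at most `C min(y², |y|³)`. -/
def TaylorBound (f : ℝ → ℝ) (C : ℝ) : Prop :=
  ∀ u, ∃ D₁ D₂ : ℝ, ∀ y, |f (u + y) - f u - D₁ * y - D₂ * y ^ 2| ≤ C * remFun y

/-- On the segment from u to u + y the second derivative varies by at most A min(2, |y|); two
applications of the mean value inequality each add a factor |y|. The minimum allows finite moments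
of order below three. -/
lemma TaylorBound.of_deriv {f : ℝ → ℝ} {A : ℝ} (hf : ContDiff ℝ 3 f)
    (h2 : ∀ z, |deriv (deriv f) z| ≤ A) (h3 : ∀ z, |deriv (deriv (deriv f)) z| ≤ A) :
    TaylorBound f (2 * A) := by
  have c1 : ContDiff ℝ 2 (deriv f) := ((contDiff_succ_iff_deriv (n := 2)).1 hf).2.2
  have c2 : ContDiff ℝ 1 (deriv (deriv f)) := ((contDiff_succ_iff_deriv (n := 1)).1 c1).2.2
  have d0 : ∀ z, HasDerivAt f (deriv f z) z :=
    fun z => (hf.differentiable (by norm_num) z).hasDerivAt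
  have d1 : ∀ z, HasDerivAt (deriv f) (deriv (deriv f) z) z :=
    fun z => (c1.differentiable (by norm_num) z).hasDerivAt
  have d2 : ∀ z, HasDerivAt (deriv (deriv f)) (deriv (deriv (deriv f)) z) z :=
    fun z => (c2.differentiable (by norm_num) z).hasDerivAt
  have hA : 0 ≤ A := (abs_nonneg _).trans (h2 0)
  intro u
  refine ⟨deriv f u, deriv (deriv f) u / 2, fun y => ?_⟩
  have hseg : ∀ z ∈ segment ℝ u (u + y), |z - u| ≤ |y| := by
    intro z hz
    rw [segment_eq_image'] at hz
    obtain ⟨s, hs, rfl⟩ := hz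
    simp only [add_sub_cancel_left, smul_eq_mul, abs_mul, abs_of_nonneg hs.1]
    exact mul_le_of_le_one_left (abs_nonneg _) hs.2
  have hu : u ∈ segment ℝ u (u + y) := left_mem_segment _ _ _
  have huy : u + y ∈ segment ℝ u (u + y) := right_mem_segment _ _ _
  have hcv := convex_segment (𝕜 := ℝ) u (u + y)
  have s1 : ∀ z ∈ segment ℝ u (u + y),
      ‖deriv (deriv f) z - deriv (deriv f) u‖ ≤ A * min 2 |y| := by
    intro z hz
    rw [mul_min_of_nonneg _ _ hA]
    refine le_min ?_ ?_
    · calc ‖deriv (deriv f) z - deriv (deriv f) u‖ ≤ |deriv (deriv f) z| + |deriv (deriv f) u| :=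
          norm_sub_le _ _
        _ ≤ A * 2 := by linarith [h2 z, h2 u]
    · have := hcv.norm_image_sub_le_of_norm_hasDerivWithin_le (f := deriv (deriv f))
        (fun z _ => (d2 z).hasDerivWithinAt) (fun z _ => h3 z) hu hz
      exact this.trans (mul_le_mul_of_nonneg_left (hseg z hz) hA)
  have s2 : ∀ z ∈ segment ℝ u (u + y),
      ‖deriv f z - deriv f u - deriv (deriv f) u * (z - u)‖ ≤ A * min 2 |y| * |y| := by
    intro z hz
    have := hcv.norm_image_sub_le_of_norm_hasDerivWithin_le
      (f := fun z => deriv f z - deriv (deriv f) u * z)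
      (f' := fun z => deriv (deriv f) z - deriv (deriv f) u)
      (fun z _ => by
        have := (d1 z).sub ((hasDerivAt_id z).const_mul (deriv (deriv f) u))
        simp only [mul_one] at this
        exact this.hasDerivWithinAt) s1 hu hz
    refine le_trans (le_of_eq ?_) (this.trans (mul_le_mul_of_nonneg_left (hseg z hz)
      (mul_nonneg hA (le_min (by norm_num) (abs_nonneg _)))))
    congr 1; ring
  have s3 : ‖f (u + y) - f u - deriv f u * y - deriv (deriv f) u / 2 * y ^ 2‖ ≤
      A * min 2 |y| * |y| * |y| := by
    have := hcv.norm_image_sub_le_of_norm_hasDerivWithin_le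
      (f := fun z => f z - deriv f u * z - deriv (deriv f) u / 2 * (z - u) ^ 2)
      (f' := fun z => deriv f z - deriv f u - deriv (deriv f) u * (z - u))
      (fun z _ => by
        have := ((d0 z).sub ((hasDerivAt_id z).const_mul (deriv f u))).sub
          ((((hasDerivAt_id z).sub_const u).pow 2).const_mul (deriv (deriv f) u / 2))
        refine HasDerivAt.hasDerivWithinAt ?_
        convert! this using 1
        simp; ring) s2 hu huy
    refine le_trans (le_of_eq ?_) (this.trans (le_of_eq ?_))
    · congr 1; ring
    · simp
  refine s3.trans ?_
  have hy := abs_nonneg y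
  rw [remFun, mul_min_of_nonneg _ _ (by positivity : 0 ≤ 2 * A)]
  refine le_min ?_ ?_
  · calc A * min 2 |y| * |y| * |y| ≤ A * 2 * |y| * |y| := by
          gcongr; exact min_le_left _ _
      _ = 2 * A * y ^ 2 := by rw [← sq_abs y]; ring
  · calc A * min 2 |y| * |y| * |y| ≤ A * |y| * |y| * |y| := by
          gcongr; exact min_le_right _ _
      _ ≤ 2 * A * |y| ^ 3 := by nlinarith [mul_nonneg hA (pow_nonneg hy 3)]

/-- The function is constant outside [0, 1], so its second and third derivatives are continuous with
compact support, hence bounded. -/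
lemma exists_taylorBound_smoothTransition : ∃ C, 0 ≤ C ∧ TaylorBound Real.smoothTransition C := by
  have hc : ContDiff ℝ 3 Real.smoothTransition := Real.smoothTransition.contDiff
  have c1 : ContDiff ℝ 2 (deriv Real.smoothTransition) :=
    ((contDiff_succ_iff_deriv (n := 2)).1 hc).2.2
  have c2 : ContDiff ℝ 1 (deriv (deriv Real.smoothTransition)) :=
    ((contDiff_succ_iff_deriv (n := 1)).1 c1).2.2
  have c3 : Continuous (deriv (deriv (deriv Real.smoothTransition))) :=
    c2.continuous_deriv (by norm_num)
  have hs : HasCompactSupport (deriv Real.smoothTransition) := by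
    refine HasCompactSupport.intro (isCompact_Icc (a := (0 : ℝ)) (b := 1)) fun z hz => ?_
    rw [Set.mem_Icc, not_and_or, not_le, not_le] at hz
    rcases hz with hz | hz
    · have : Real.smoothTransition =ᶠ[𝓝 z] fun _ => 0 := by
        filter_upwards [Iio_mem_nhds hz] with w hw
        exact Real.smoothTransition.zero_of_nonpos (le_of_lt hw)
      rw [this.deriv_eq]; simp
    · have : Real.smoothTransition =ᶠ[𝓝 z] fun _ => 1 := by
        filter_upwards [Ioi_mem_nhds hz] with w hw
        exact Real.smoothTransition.one_of_one_le (le_of_lt hw)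
      rw [this.deriv_eq]; simp
  obtain ⟨A, hA⟩ := c2.continuous.bounded_above_of_compact_support hs.deriv
  obtain ⟨A', hA'⟩ := c3.bounded_above_of_compact_support hs.deriv.deriv
  have h0 : 0 ≤ max A A' := (norm_nonneg _).trans ((hA 0).trans (le_max_left _ _))
  exact ⟨2 * max A A', by positivity, TaylorBound.of_deriv hc
    (fun z => (hA z).trans (le_max_left _ _)) (fun z => (hA' z).trans (le_max_right _ _))⟩

/-- The cubic part of the remainder scales by exactly η⁻³; for η ≤ 1 the quadratic part scales by
the smaller factor η⁻². -/
lemma TaylorBound.comp_affine {f : ℝ → ℝ} {C : ℝ} (hC : 0 ≤ C) (hf : TaylorBound f C) {η : ℝ}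
    (hη : 0 < η) (hη1 : η ≤ 1) (b : ℝ) :
    TaylorBound (fun w => f (w / η + b)) (C / η ^ 3) := by
  intro u
  obtain ⟨D₁, D₂, hD⟩ := hf (u / η + b)
  refine ⟨D₁ / η, D₂ / η ^ 2, fun y => ?_⟩
  have := hD (y / η)
  refine le_trans (le_of_eq ?_) (this.trans ?_)
  · congr 1
    dsimp only
    rw [show (u + y) / η + b = u / η + b + y / η by ring]
    ring
  · rw [div_mul_eq_mul_div, mul_div_assoc]
    refine mul_le_mul_of_nonneg_left ?_ hC
    rw [le_div_iff₀ (by positivity), remFun, remFun, min_mul_of_nonneg _ _ (by positivity),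
      abs_div, abs_of_pos hη]
    refine min_le_min ?_ (le_of_eq ?_)
    · calc (y / η) ^ 2 * η ^ 3 = y ^ 2 * η := by field_simp
        _ ≤ y ^ 2 := mul_le_of_le_one_right (sq_nonneg _) hη1
    · field_simp

section Lindeberg

variable {f : ℝ → ℝ} {C : ℝ}

lemma integrable_of_bounded {A : Measure ℝ} [IsFiniteMeasure A] (hf : Measurable f)
    (hb : ∀ z, |f z| ≤ 1) (t : ℝ) : Integrable (fun z => f (t + z)) A :=
  Integrable.of_bound (hf.comp (measurable_const_add t)).aestronglyMeasurable 1
    (Eventually.of_forall fun _ => hb _)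

/-- The first two moments match, so the polynomial parts of the two expansions cancel and only
remainders survive. -/
lemma abs_integral_sub_le_of_taylorBound {A A' : Measure ℝ} [IsProbabilityMeasure A]
    [IsProbabilityMeasure A'] (hf : Measurable f) (hb : ∀ z, |f z| ≤ 1) (hC : TaylorBound f C)
    (i2 : Integrable (fun z => z ^ 2) A) (i2' : Integrable (fun z => z ^ 2) A')
    (i1 : Integrable (fun z => z) A) (i1' : Integrable (fun z => z) A')
    (m : ∫ z, z ∂A = ∫ z, z ∂A') (m2 : ∫ z, z ^ 2 ∂A = ∫ z, z ^ 2 ∂A') (u : ℝ) :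
    |∫ z, f (u + z) ∂A - ∫ z, f (u + z) ∂A'| ≤ C * (∫ z, remFun z ∂A + ∫ z, remFun z ∂A') := by
  obtain ⟨D₁, D₂, hD⟩ := hC u
  have key : ∀ (B : Measure ℝ) [IsProbabilityMeasure B], Integrable (fun z => z ^ 2) B →
      Integrable (fun z => z) B →
      |∫ z, f (u + z) ∂B - (f u + D₁ * ∫ z, z ∂B + D₂ * ∫ z, z ^ 2 ∂B)| ≤ C * ∫ z, remFun z ∂B := by
    intro B _ j2 j1
    have hr : Integrable remFun B := j2.mono' continuous_remFun.aestronglyMeasurable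
      (Eventually.of_forall fun z => by
        rw [Real.norm_eq_abs, abs_of_nonneg (remFun_nonneg z)]; exact min_le_left _ _)
    have e : ∫ z, f (u + z) ∂B - (f u + D₁ * ∫ z, z ∂B + D₂ * ∫ z, z ^ 2 ∂B) =
        ∫ z, (f (u + z) - f u - D₁ * z - D₂ * z ^ 2) ∂B := by
      have k0 := integrable_of_bounded (A := B) hf hb u
      have k1 : Integrable (fun z => f (u + z) - f u) B := k0.sub (integrable_const _)
      have k2 : Integrable (fun z => f (u + z) - f u - D₁ * z) B := k1.sub (j1.const_mul _)
      rw [integral_sub k2 (j2.const_mul _), integral_sub k1 (j1.const_mul _),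
        integral_sub k0 (integrable_const _), integral_const_mul, integral_const_mul]
      simp; ring
    rw [e, ← integral_const_mul]
    exact norm_integral_le_of_norm_le (f := fun y => f (u + y) - f u - D₁ * y - D₂ * y ^ 2)
      (hr.const_mul C) (Eventually.of_forall hD)
  have h1 := key A i2 i1
  have h2 := key A' i2' i1'
  rw [m, m2] at h1
  rw [abs_le] at *
  constructor <;> linarith [h1.1, h1.2, h2.1, h2.2]

/-- Convolution averages over shifts, so a discrepancy bound valid at every shift is preserved. -/
lemma abs_integral_conv_sub_le {A A' B : Measure ℝ} [IsProbabilityMeasure A]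
    [IsProbabilityMeasure A'] [IsProbabilityMeasure B] (hf : Measurable f) (hb : ∀ z, |f z| ≤ 1)
    {e : ℝ} (h : ∀ u, |∫ z, f (u + z) ∂A - ∫ z, f (u + z) ∂A'| ≤ e) (t : ℝ) :
    |∫ z, f (t + z) ∂(A ∗ B) - ∫ z, f (t + z) ∂(A' ∗ B)| ≤ e := by
  have key : ∀ (D : Measure ℝ) [IsProbabilityMeasure D],
      ∫ z, f (t + z) ∂(D ∗ B) = ∫ y, ∫ z, f ((t + y) + z) ∂D ∂B := by
    intro D _
    rw [Measure.conv_comm, integral_conv (integrable_of_bounded hf hb t)]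
    simp only [add_assoc]
  have ki : ∀ (D : Measure ℝ) [IsProbabilityMeasure D],
      Integrable (fun y => ∫ z, f ((t + y) + z) ∂D) B := by
    intro D _
    have : StronglyMeasurable (fun y => ∫ z, f ((t + y) + z) ∂D) := by
      refine StronglyMeasurable.integral_prod_right'
        (f := fun p : ℝ × ℝ => f ((t + p.1) + p.2)) ?_
      exact (hf.comp (by fun_prop)).stronglyMeasurable
    refine Integrable.of_bound this.aestronglyMeasurable 1 (Eventually.of_forall fun y => ?_)
    have := norm_integral_le_of_norm_le_const (μ := D) (C := 1)
      (f := fun z => f (t + y + z)) (Eventually.of_forall fun z => hb (t + y + z))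
    simpa using this
  rw [key A, key A', ← integral_sub (ki A) (ki A')]
  have := norm_integral_le_of_norm_le_const (μ := B) (C := e)
    (f := fun y => ∫ z, f (t + y + z) ∂A - ∫ z, f (t + y + z) ∂A')
    (Eventually.of_forall fun y => h (t + y))
  simpa using this

lemma integrable_pow_gaussianReal (v : NNReal) (k : ℕ) :
    Integrable (fun z => z ^ k) (gaussianReal 0 v) := by
  rcases Nat.eq_zero_or_pos k with rfl | hk
  · simp
  · have := (memLp_id_gaussianReal (μ := 0) (v := v) (k : NNReal)).integrable_norm_pow
      (by exact_mod_cast hk.ne')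
    refine this.mono (by fun_prop) (Eventually.of_forall fun z => ?_)
    simp

lemma integral_sq_gaussianReal (v : NNReal) : ∫ z, z ^ 2 ∂(gaussianReal 0 v) = v := by
  have := variance_fun_id_gaussianReal (μ := 0) (v := v)
  rw [variance_of_integral_eq_zero (by fun_prop) (by simp)] at this
  exact this

/-- The variables are exchanged for Gaussians one at a time, each exchange costing two remainder
integrals. The bound is proved at every shift t so that it passes through the convolution with the
next variable. -/
lemma lindeberg_replacement {Ω ι : Type*} [MeasurableSpace Ω] {μ : Measure Ω}
    [IsProbabilityMeasure μ] {X : ι → Ω → ℝ} (hX : ∀ i, Measurable (X i)) (hind : iIndepFun X μ)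
    (h1 : ∀ i, Integrable (X i) μ) (h2 : ∀ i, Integrable (fun ω => X i ω ^ 2) μ)
    (hm : ∀ i, ∫ ω, X i ω ∂μ = 0) (σ : ι → NNReal) (hσ : ∀ i, ∫ ω, X i ω ^ 2 ∂μ = σ i)
    (hf : Measurable f) (hb : ∀ z, |f z| ≤ 1) (hC : TaylorBound f C) (s : Finset ι) (t : ℝ) :
    |∫ z, f (t + z) ∂(μ.map (∑ i ∈ s, X i)) - ∫ z, f (t + z) ∂(gaussianReal 0 (∑ i ∈ s, σ i))| ≤
      ∑ i ∈ s, C * (∫ ω, remFun (X i ω) ∂μ + ∫ z, remFun z ∂(gaussianReal 0 (σ i))) := by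
  classical
  induction s using Finset.induction_on generalizing t with
  | empty =>
    have : μ.map (0 : Ω → ℝ) = Measure.dirac 0 := by
      change μ.map (fun _ => (0 : ℝ)) = _
      rw [Measure.map_const]; simp
    simp [this]
  | insert j s hj ih =>
    rw [Finset.sum_insert hj, Finset.sum_insert hj, Finset.sum_insert hj]
    have hS : Measurable (∑ i ∈ s, X i) := by
      have := Finset.measurable_sum s fun i _ => hX i
      convert! this using 1
      ext ω; simp
    have hi : IndepFun (X j) (∑ i ∈ s, X i) μ := (hind.indepFun_finsetSum_of_notMem hX hj).symm
    rw [hi.map_add_eq_map_conv_map (hX j) hS]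
    have hg := gaussianReal_conv_gaussianReal (m₁ := 0) (m₂ := 0) (v₁ := σ j) (v₂ := ∑ i ∈ s, σ i)
    rw [add_zero] at hg
    rw [← hg]
    have : IsProbabilityMeasure (μ.map (X j)) := Measure.isProbabilityMeasure_map (hX j).aemeasurable
    have : IsProbabilityMeasure (μ.map (∑ i ∈ s, X i)) :=
      Measure.isProbabilityMeasure_map hS.aemeasurable
    have a1 := abs_integral_conv_sub_le (A := μ.map (∑ i ∈ s, X i))
      (A' := gaussianReal 0 (∑ i ∈ s, σ i)) (B := μ.map (X j)) hf hb ih t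
    have a2 := abs_integral_conv_sub_le (A := μ.map (X j)) (A' := gaussianReal 0 (σ j))
      (B := gaussianReal 0 (∑ i ∈ s, σ i)) hf hb
      (fun u => abs_integral_sub_le_of_taylorBound hf hb hC
        ((integrable_map_measure (by fun_prop) (hX j).aemeasurable).2 (h2 j))
        (integrable_pow_gaussianReal _ 2)
        ((integrable_map_measure (by fun_prop) (hX j).aemeasurable).2 (h1 j))
        (by simpa using integrable_pow_gaussianReal (σ j) 1)
        (by rw [integral_map (hX j).aemeasurable (by fun_prop), hm j]; simp)
        (by rw [integral_map (hX j).aemeasurable (by fun_prop), hσ j, integral_sq_gaussianReal]) u) t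
    rw [Measure.conv_comm (μ.map (∑ i ∈ s, X i)), Measure.conv_comm (gaussianReal 0 (∑ i ∈ s, σ i))]
      at a1
    rw [integral_map (hX j).aemeasurable continuous_remFun.aestronglyMeasurable] at a2
    rw [abs_le] at *
    constructor <;> linarith [a1.1, a1.2, a2.1, a2.2]

end Lindeberg

/-! ### Truncation and moment bounds -/

lemma exists_truncation {q ω : ℝ} (hq : 2 < q) (hω : 0 < ω) :
    ∃ θ₀ > 0, ∀ θ ≤ θ₀, ∀ e : ℝ, 0 ≤ e → min (e ^ 2) (θ * e ^ 3) ≤ ω * (1 + e ^ q) := by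
  -- R is the truncation level: beyond it, e² = e^(-(q-2)) e^q ≤ ω e^q; below it, the cubic term is
  -- at most (ω/R³) R³ = ω.
  have h1 := (tendsto_rpow_neg_atTop (sub_pos.2 hq)).eventually (ge_mem_nhds hω)
  obtain ⟨R, hR, hR1⟩ := (h1.and (eventually_ge_atTop 1)).exists
  have hR0 : 0 < R := by linarith
  refine ⟨ω / R ^ 3, by positivity, fun θ hθ e he => ?_⟩
  have hq0 : 0 ≤ e ^ q := Real.rpow_nonneg he q
  rcases le_total e R with h | h
  · calc min (e ^ 2) (θ * e ^ 3) ≤ θ * e ^ 3 := min_le_right _ _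
      _ ≤ ω / R ^ 3 * R ^ 3 := by gcongr
      _ = ω := by field_simp
      _ ≤ ω * (1 + e ^ q) := by nlinarith
  · have he0 : 0 < e := hR0.trans_le h
    have h2 : e ^ (-(q - 2)) ≤ ω :=
      (Real.rpow_le_rpow_of_nonpos hR0 h (by linarith)).trans hR
    calc min (e ^ 2) (θ * e ^ 3) ≤ e ^ 2 := min_le_left _ _
      _ = e ^ (-(q - 2)) * e ^ q := by
          rw [← Real.rpow_add he0, ← Real.rpow_natCast]; congr 1; push_cast; ring
      _ ≤ ω * e ^ q := by gcongr
      _ ≤ ω * (1 + e ^ q) := by nlinarith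

lemma pow_le_one_add_rpow {q e : ℝ} (he : 0 ≤ e) {k : ℕ} (hk : (k : ℝ) ≤ q) :
    e ^ k ≤ 1 + e ^ q := by
  have hq0 : 0 ≤ e ^ q := Real.rpow_nonneg he q
  rcases le_total e 1 with h | h
  · linarith [pow_le_one₀ (n := k) he h]
  · have := Real.rpow_le_rpow_of_exponent_le h hk
    rw [Real.rpow_natCast] at this
    linarith

/-- Third absolute moment of the standard normal distribution. -/
def stdThird : ℝ := ∫ z, |z| ^ 3 ∂(gaussianReal 0 1)

lemma stdThird_nonneg : 0 ≤ stdThird := integral_nonneg fun z => pow_nonneg (abs_nonneg z) 3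

lemma integral_remFun_gaussianReal_le {c : ℝ} (hc : 0 ≤ c) (v : NNReal) (hv : (v : ℝ) = c ^ 2) :
    ∫ z, remFun z ∂(gaussianReal 0 v) ≤ c ^ 3 * stdThird := by
  have hmap := gaussianReal_map_const_mul (μ := 0) (v := 1) c
  have hv' : v = NNReal.mk (c ^ 2) (sq_nonneg c) * 1 := by
    ext; simp [hv]
  rw [mul_zero, ← hv'] at hmap
  rw [← hmap, integral_map (by fun_prop) continuous_remFun.aestronglyMeasurable, stdThird,
    ← integral_const_mul]
  refine integral_mono_of_nonneg (Eventually.of_forall fun z => remFun_nonneg _) ?_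
    (Eventually.of_forall fun z => ?_)
  · have := (integrable_pow_gaussianReal 1 3).abs
    simp only [abs_pow] at this
    exact this.const_mul _
  · refine (min_le_right _ _).trans (le_of_eq ?_)
    rw [abs_mul, mul_pow, abs_of_nonneg hc]

section MomentBounds

variable {Ω : Type*} [MeasurableSpace Ω] {μ : Measure Ω} {ε : Ω → ℝ}
  {q B : ℝ}

lemma integrable_rpow_of_lintegral_le (hε : Measurable ε)
    (hq : ∫⁻ ω, ENNReal.ofReal (|ε ω| ^ q) ∂μ ≤ ENNReal.ofReal B) :
    Integrable (fun ω => |ε ω| ^ q) μ := by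
  have hm : Measurable fun ω => |ε ω| ^ q := by fun_prop
  refine ⟨hm.aestronglyMeasurable, ?_⟩
  rw [hasFiniteIntegral_iff_ofReal (Eventually.of_forall fun ω => Real.rpow_nonneg (abs_nonneg _) _)]
  exact hq.trans_lt ENNReal.ofReal_lt_top

lemma integral_rpow_le (hB : 0 ≤ B) (hε : Measurable ε)
    (hq : ∫⁻ ω, ENNReal.ofReal (|ε ω| ^ q) ∂μ ≤ ENNReal.ofReal B) :
    ∫ ω, |ε ω| ^ q ∂μ ≤ B := by
  have hm : Measurable fun ω => |ε ω| ^ q := by fun_prop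
  rw [integral_eq_lintegral_of_nonneg_ae
    (Eventually.of_forall fun ω => Real.rpow_nonneg (abs_nonneg _) _) hm.aestronglyMeasurable]
  exact ENNReal.toReal_le_of_le_ofReal hB hq

lemma integrable_pow_of_lintegral_le [IsProbabilityMeasure μ] (hε : Measurable ε)
    (hq : ∫⁻ ω, ENNReal.ofReal (|ε ω| ^ q) ∂μ ≤ ENNReal.ofReal B) {k : ℕ} (hk : (k : ℝ) ≤ q) :
    Integrable (fun ω => ε ω ^ k) μ := by
  refine ((integrable_const 1).add (integrable_rpow_of_lintegral_le hε hq)).mono'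
    (hε.pow_const k).aestronglyMeasurable (Eventually.of_forall fun ω => ?_)
  rw [norm_pow]
  exact pow_le_one_add_rpow (abs_nonneg _) hk

lemma integral_sq_le [IsProbabilityMeasure μ] (hB : 0 ≤ B) (hε : Measurable ε) (h2 : 2 < q)
    (hq : ∫⁻ ω, ENNReal.ofReal (|ε ω| ^ q) ∂μ ≤ ENNReal.ofReal B) :
    ∫ ω, ε ω ^ 2 ∂μ ≤ 1 + B := by
  have hi := integrable_rpow_of_lintegral_le hε hq
  calc ∫ ω, ε ω ^ 2 ∂μ ≤ ∫ ω, (1 + |ε ω| ^ q) ∂μ := by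
        refine integral_mono (integrable_pow_of_lintegral_le hε hq (by exact_mod_cast h2.le))
          ((integrable_const 1).add hi) fun ω => ?_
        rw [← sq_abs]
        exact pow_le_one_add_rpow (abs_nonneg _) (by exact_mod_cast h2.le)
    _ = 1 + ∫ ω, |ε ω| ^ q ∂μ := by rw [integral_add (integrable_const 1) hi]; simp
    _ ≤ 1 + B := by linarith [integral_rpow_le hB hε hq]

/-- Factoring out a² leaves min(ε², |a| |ε|³), to which the truncation inequality applies pointwise.
-/
lemma integral_remFun_le [IsProbabilityMeasure μ] (hB : 0 ≤ B) (hε : Measurable ε)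
    (hq : ∫⁻ ω, ENNReal.ofReal (|ε ω| ^ q) ∂μ ≤ ENNReal.ofReal B) {ω₀ : ℝ} (hω : 0 ≤ ω₀) {a : ℝ}
    (ha : ∀ e : ℝ, 0 ≤ e → min (e ^ 2) (|a| * e ^ 3) ≤ ω₀ * (1 + e ^ q)) :
    ∫ ω, remFun (a * ε ω) ∂μ ≤ a ^ 2 * (ω₀ * (1 + B)) := by
  have hi := integrable_rpow_of_lintegral_le hε hq
  calc ∫ ω, remFun (a * ε ω) ∂μ ≤ ∫ ω, a ^ 2 * (ω₀ * (1 + |ε ω| ^ q)) ∂μ := by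
        refine integral_mono_of_nonneg (Eventually.of_forall fun _ => remFun_nonneg _)
          ((((integrable_const 1).add hi).const_mul _).const_mul _) (Eventually.of_forall fun ω => ?_)
        refine le_trans (le_of_eq ?_) (mul_le_mul_of_nonneg_left (ha _ (abs_nonneg (ε ω)))
          (sq_nonneg a))
        dsimp only [remFun]
        rw [mul_min_of_nonneg _ _ (sq_nonneg a), abs_mul, mul_pow, mul_pow, sq_abs,
          pow_succ |a| 2, sq_abs]
        ring_nf
    _ = a ^ 2 * (ω₀ * (1 + ∫ ω, |ε ω| ^ q ∂μ)) := by
        rw [integral_const_mul, integral_const_mul, integral_add (integrable_const 1) hi]; simp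
    _ ≤ a ^ 2 * (ω₀ * (1 + B)) := by
        gcongr; exact integral_rpow_le hB hε hq

end MomentBounds

/-- Uniform normal approximation of the tails of weighted sums of independent variables with
bounded `q`-th moments, variances bounded away from zero, and uniformly small weights. -/
theorem normal_tail_bound {q B v η : ℝ} (hq : 2 < q) (hB : 0 ≤ B) (hv : 0 < v) (hη : 0 < η) :
    ∃ θ > 0, ∀ (Ω : Type) [MeasurableSpace Ω] (μ : Measure Ω) [IsProbabilityMeasure μ] (n : ℕ)
      (ε : Fin n → Ω → ℝ) (a : Fin n → ℝ), (∀ i, Measurable (ε i)) → iIndepFun ε μ →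
      (∀ i, ∫ ω, ε i ω ∂μ = 0) →
      (∀ i, ∫⁻ ω, ENNReal.ofReal (|ε i ω| ^ q) ∂μ ≤ ENNReal.ofReal B) →
      (∀ i, v ≤ ∫ ω, ε i ω ^ 2 ∂μ) → ∑ i, a i ^ 2 * ∫ ω, ε i ω ^ 2 ∂μ = 1 → (∀ i, |a i| ≤ θ) →
      ∀ t, μ.real {ω | t ≤ ∑ i, a i * ε i ω} ≤ stdCdf (-t) + η := by
  obtain ⟨C, hC0, hC⟩ := exists_taylorBound_smoothTransition
  -- Half of η pays for smoothing over a strip of width δ, as the normal density is at most 1; the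
  -- other half pays for the replacement error.
  set δ := min (η / 2) 1 with hδ
  have hδ0 : 0 < δ := lt_min (by positivity) one_pos
  have hδ1 : δ ≤ 1 := min_le_right _ _
  set D := C / δ ^ 3 with hD
  have hD0 : 0 ≤ D := by positivity
  set A := D * ((1 + B) + (1 + B) ^ 3 * stdThird) / v with hA
  have hS := stdThird_nonneg
  have hA0 : 0 ≤ A := by positivity
  set κ := η / 2 / (A + 1) with hκ
  have hκ0 : 0 < κ := by positivity
  obtain ⟨θ₀, hθ₀, hθ⟩ := exists_truncation hq hκ0
  -- The bound `θ₀` controls the remainder of the errors, `κ` the third moment of the Gaussians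
  -- replacing them. The total is at most A κ ≤ η/2.
  refine ⟨min θ₀ κ, lt_min hθ₀ hκ0, ?_⟩
  intro Ω _ μ _ n ε a hεm hind h1 hmom hvar hsum ha t
  -- A smooth step, equal to 0 below t - δ and to 1 above t.
  set f : ℝ → ℝ := fun w => Real.smoothTransition (w / δ + (1 - t / δ)) with hf
  have hfT : TaylorBound f D := hC.comp_affine hC0 hδ0 hδ1 _
  have hfm : Measurable f := (Real.smoothTransition.continuous.comp (by fun_prop)).measurable
  have hfb : ∀ z, |f z| ≤ 1 := fun z => by
    rw [abs_of_nonneg (Real.smoothTransition.nonneg _)]; exact Real.smoothTransition.le_one _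
  set σ : Fin n → NNReal := fun i => ⟨a i ^ 2 * ∫ ω, ε i ω ^ 2 ∂μ,
    mul_nonneg (sq_nonneg _) (hv.le.trans (hvar i))⟩ with hσ
  have hX2 : ∀ i, Integrable (fun ω => ε i ω ^ 2) μ := fun i =>
    integrable_pow_of_lintegral_le (hεm i) (hmom i) (by exact_mod_cast hq.le)
  have hX1 : ∀ i, Integrable (ε i) μ := fun i => by
    simpa using integrable_pow_of_lintegral_le (k := 1) (hεm i) (hmom i) (by push_cast; linarith)
  have hrep := lindeberg_replacement (μ := μ) (X := fun i ω => a i * ε i ω)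
    (fun i => (hεm i).const_mul _)
    (hind.comp (fun i z => a i * z) (fun i => measurable_const_mul _))
    (fun i => (hX1 i).const_mul _)
    (fun i => by simp only [mul_pow]; exact (hX2 i).const_mul _)
    (fun i => by rw [integral_const_mul, h1, mul_zero]) σ
    (fun i => by simp only [mul_pow, integral_const_mul, hσ]; rfl) hfm hfb hfT Finset.univ 0
  have hσ1 : ∑ i, σ i = 1 := by
    ext; push_cast; exact hsum
  rw [hσ1] at hrep
  have hWm : Measurable (∑ i, fun ω => a i * ε i ω) := by
    have := Finset.measurable_sum Finset.univ fun i _ => (hεm i).const_mul (a i)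
    convert! this using 1
    ext ω; simp
  have herr : ∑ i, D * (∫ ω, remFun (a i * ε i ω) ∂μ + ∫ z, remFun z ∂(gaussianReal 0 (σ i))) ≤
      η / 2 := by
    have hterm : ∀ i, D * (∫ ω, remFun (a i * ε i ω) ∂μ + ∫ z, remFun z ∂(gaussianReal 0 (σ i))) ≤
        D * ((1 + B) + (1 + B) ^ 3 * stdThird) * κ * a i ^ 2 := by
      intro i
      have e1 := integral_remFun_le hB (hεm i) (hmom i) hκ0.le
        (hθ |a i| ((ha i).trans (min_le_left _ _)))
      set s := ∫ ω, ε i ω ^ 2 ∂μ with hs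
      have hs0 : 0 ≤ s := hv.le.trans (hvar i)
      have hs1 : √s ≤ 1 + B := by
        rw [Real.sqrt_le_left (by linarith)]
        nlinarith [integral_sq_le hB (hεm i) hq (hmom i)]
      have e2 := integral_remFun_gaussianReal_le (c := |a i| * √s) (by positivity) (σ i) (by
        rw [mul_pow, sq_abs, Real.sq_sqrt hs0]; rfl)
      have e3 : (|a i| * √s) ^ 3 * stdThird ≤ a i ^ 2 * κ * (1 + B) ^ 3 * stdThird := by
        refine mul_le_mul_of_nonneg_right ?_ hS
        calc (|a i| * √s) ^ 3 = a i ^ 2 * |a i| * √s ^ 3 := by rw [← sq_abs (a i)]; ring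
          _ ≤ a i ^ 2 * κ * (1 + B) ^ 3 := by
            gcongr
            exact (ha i).trans (min_le_right _ _)
      calc _ ≤ D * (a i ^ 2 * (κ * (1 + B)) + a i ^ 2 * κ * (1 + B) ^ 3 * stdThird) := by
            gcongr; exact e2.trans e3
        _ = _ := by ring
    refine (Finset.sum_le_sum fun i _ => hterm i).trans ?_
    rw [← Finset.mul_sum]
    -- The normalization of the variance and its lower bound v control the sum of the squared
    -- weights.
    have ha2 : ∑ i, a i ^ 2 ≤ 1 / v := by
      rw [le_div_iff₀ hv, ← hsum, Finset.sum_mul]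
      exact Finset.sum_le_sum fun i _ => mul_le_mul_of_nonneg_left (hvar i) (sq_nonneg _)
    calc _ ≤ D * ((1 + B) + (1 + B) ^ 3 * stdThird) * κ * (1 / v) := by gcongr
      _ = A * κ := by rw [hA]; ring
      _ ≤ (A + 1) * κ := by nlinarith
      _ = η / 2 := by rw [hκ]; field_simp
  have hrep' := (abs_le.1 (hrep.trans herr)).2
  simp only [zero_add] at hrep'
  have hlow : μ.real {ω | t ≤ ∑ i, a i * ε i ω} ≤
      ∫ z, f z ∂(μ.map (∑ i, fun ω => a i * ε i ω)) := by
    rw [integral_map hWm.aemeasurable hfm.aestronglyMeasurable]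
    have hset : MeasurableSet {ω | t ≤ ∑ i, a i * ε i ω} :=
      measurableSet_le measurable_const
        (Finset.measurable_sum Finset.univ fun i _ => (hεm i).const_mul (a i))
    rw [← integral_indicator_one hset]
    refine integral_mono_of_nonneg
      (Eventually.of_forall fun ω => Set.indicator_nonneg (fun _ _ => zero_le_one) ω)
      (Integrable.of_bound (hfm.comp hWm).aestronglyMeasurable 1 (Eventually.of_forall fun ω => hfb _))
      (Eventually.of_forall fun ω => ?_)
    refine Set.indicator_apply_le' (fun hω => ?_) (fun _ => Real.smoothTransition.nonneg _)
    have hω' : t ≤ ∑ i, a i * ε i ω := hω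
    rw [hf]
    dsimp only
    rw [Real.smoothTransition.one_of_one_le]
    · rfl
    · rw [Finset.sum_apply]
      have : t / δ ≤ (∑ i, a i * ε i ω) / δ := by gcongr
      linarith
  have hup : ∫ z, f z ∂(gaussianReal 0 1) ≤ stdCdf (-t) + η / 2 := by
    calc ∫ z, f z ∂(gaussianReal 0 1)
        ≤ ∫ z, (Set.Ici (t - δ)).indicator 1 z ∂(gaussianReal 0 1) := by
          refine integral_mono_of_nonneg
            (Eventually.of_forall fun ω => Real.smoothTransition.nonneg _)
            ((integrable_const (1 : ℝ)).indicator measurableSet_Ici)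
            (Eventually.of_forall fun z => ?_)
          by_cases hz : t - δ ≤ z
          · rw [Set.indicator_of_mem (Set.mem_Ici.2 hz)]
            exact Real.smoothTransition.le_one _
          · rw [Set.indicator_of_notMem (by simpa using hz)]
            refine (Real.smoothTransition.zero_of_nonpos ?_).le
            have : (z - t) / δ ≤ -1 := by
              rw [div_le_iff₀ hδ0]; push Not at hz; linarith
            have e : z / δ + (1 - t / δ) = (z - t) / δ + 1 := by ring
            linarith
      _ = stdCdf (-t + δ) := by
          rw [integral_indicator_one measurableSet_Ici, gaussianReal_Ici]; congr 1; ring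
      _ ≤ stdCdf (-t) + δ := stdCdf_add_le hδ0.le
      _ ≤ stdCdf (-t) + η / 2 := by gcongr; exact min_le_left _ _
  linarith

/-! ### Random samples -/

open Classical in
/-- Number of observations in a set. -/
def countIn {n : ℕ} (A : Set ℝ) (x : Fin n → ℝ) : ℕ := (Finset.univ.filter fun i => x i ∈ A).card

/-- Exponential lower tail bound for the number of observations in a set. -/
lemma measure_countIn_lt_le (ν : Measure ℝ) [IsProbabilityMeasure ν] {A : Set ℝ}
    (hA : MeasurableSet A) (n k : ℕ) :
    (Measure.pi fun _ : Fin n => ν).real {x | countIn A x < k} ≤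
      2 ^ k * Real.exp (-(n * ν.real A / 2)) := by
  classical
  -- Chernoff argument: the product over the sample is 2 to the minus count, with mean (1 -
  -- ν(A)/2)^n ≤ exp(-n ν(A)/2); Markov's inequality concludes.
  set f : ℝ → ℝ := fun z => if z ∈ A then 1 / 2 else 1 with hf
  have hfm : Measurable f := Measurable.ite hA measurable_const measurable_const
  have hf0 : ∀ z, 0 ≤ f z := fun z => by simp only [hf]; split_ifs <;> norm_num
  have hf1 : ∀ z, f z ≤ 1 := fun z => by simp only [hf]; split_ifs <;> norm_num
  have hint : ∫ z, f z ∂ν = 1 - ν.real A / 2 := by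
    have : f = fun z => 1 - A.indicator (fun _ => (1 / 2 : ℝ)) z := by
      ext z
      by_cases hz : z ∈ A
      · simp [hf, hz]; norm_num
      · simp [hf, hz]
    rw [this, integral_sub (integrable_const _) ((integrable_const _).indicator hA),
      integral_indicator_const _ hA]
    simp; ring
  have hprod : ∀ x : Fin n → ℝ, ∏ i, f (x i) = (1 / 2) ^ countIn A x := by
    intro x
    simp only [hf, countIn, Finset.prod_ite, Finset.prod_const, one_pow, mul_one]
  have hI := integral_fintype_prod_eq_prod (𝕜 := ℝ) (fun (_ : Fin n) z => f z)
    (μ := fun _ => ν)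
  rw [hint, Finset.prod_const, Finset.card_univ, Fintype.card_fin] at hI
  have hPm : Measurable fun x : Fin n → ℝ => ∏ i, f (x i) :=
    Finset.measurable_prod _ fun i _ => hfm.comp (measurable_pi_apply i)
  have hM := mul_meas_ge_le_integral_of_nonneg (μ := Measure.pi fun _ : Fin n => ν)
    (f := fun x => ∏ i, f (x i))
    (Eventually.of_forall fun x => Finset.prod_nonneg fun i _ => hf0 _)
    (Integrable.of_bound hPm.aestronglyMeasurable 1 (Eventually.of_forall fun x => by
      rw [Real.norm_eq_abs, abs_of_nonneg (Finset.prod_nonneg fun i _ => hf0 _)]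
      exact Finset.prod_le_one (fun i _ => hf0 _) fun i _ => hf1 _)) ((1 / 2) ^ k)
  rw [hI] at hM
  have hsub : (Measure.pi fun _ : Fin n => ν).real {x | countIn A x < k} ≤
      (Measure.pi fun _ : Fin n => ν).real {x | (1 / 2) ^ k ≤ ∏ i, f (x i)} := by
    refine measureReal_mono (fun x hx => ?_)
    have hx' : countIn A x < k := hx
    change (1 / 2 : ℝ) ^ k ≤ ∏ i, f (x i)
    rw [hprod]
    exact pow_le_pow_of_le_one (by norm_num) (by norm_num) hx'.le
  have hexp : (1 - ν.real A / 2) ^ n ≤ Real.exp (-(n * ν.real A / 2)) := by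
    have h0 : 0 ≤ 1 - ν.real A / 2 := by linarith [measureReal_le_one (μ := ν) (s := A)]
    calc (1 - ν.real A / 2) ^ n ≤ (Real.exp (-(ν.real A / 2))) ^ n := by
          refine pow_le_pow_left₀ h0 ?_ n
          linarith [Real.add_one_le_exp (-(ν.real A / 2))]
      _ = _ := by rw [← Real.exp_nat_mul]; congr 1; ring
  calc _ ≤ _ := hsub
    _ = 2 ^ k * ((1 / 2) ^ k * (Measure.pi fun _ : Fin n => ν).real
          {x | (1 / 2) ^ k ≤ ∏ i, f (x i)}) := by
        rw [← mul_assoc, ← mul_pow]; norm_num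
    _ ≤ _ := by gcongr; exact hM.trans hexp

open unitInterval in
/-- A random sample can be generated by drawing the running variables first, and then the outcomes
given the running variables, independently of each other, from independent uniform variables. -/
lemma sampleLaw_le_of_forall {P : Measure Obs} [IsProbabilityMeasure P] {F : ℝ → I → ℝ}
    (hF : Measurable (Function.uncurry F))
    (hFκ : ∀ x, volume.map (F x) = condDistrib outcome run P x) (n : ℕ)
    {S : Set ((Fin n → ℝ) × (Fin n → ℝ))} (hS : MeasurableSet S) {c : ENNReal}
    (h : ∀ᵐ x ∂(Measure.pi fun _ : Fin n => P.map run),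
      (Measure.pi fun _ : Fin n => (volume : Measure I)) {u | (x, fun i => F (x i) (u i)) ∈ S} ≤ c) :
    sampleLaw n P {ω | (runs ω, outcomes ω) ∈ S} ≤ c := by
  have hrun : Measurable run := by unfold run; fun_prop
  have hout : Measurable outcome := by
    unfold outcome outcome₁ outcome₀
    exact Measurable.ite (measurableSet_le measurable_const hrun) (by fun_prop) (by fun_prop)
  have : IsProbabilityMeasure (P.map run) := Measure.isProbabilityMeasure_map hrun.aemeasurable
  set G : ℝ × I → ℝ × ℝ := fun p => (p.1, F p.1 p.2) with hG
  have hGm : Measurable G := measurable_fst.prodMk hF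
  -- Disintegration of the joint law along the running variable, with the conditional law written as
  -- the image of a uniform variable.
  have hlaw : P.map (fun o => (run o, outcome o)) = ((P.map run).prod volume).map G := by
    rw [← compProd_map_condDistrib hout.aemeasurable]
    ext s hs
    rw [Measure.compProd_apply hs, Measure.map_apply hGm hs, Measure.prod_apply (hGm hs)]
    refine lintegral_congr fun x => ?_
    have hFx : Measurable (F x) := hF.comp measurable_prodMk_left
    rw [← hFκ, Measure.map_apply hFx (measurable_prodMk_left hs)]
    rfl
  have hpm : Measurable fun o => (run o, outcome o) := hrun.prodMk hout
  set T : Set (Fin n → ℝ × ℝ) := {z | ((fun i => (z i).1), fun i => (z i).2) ∈ S} with hT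
  have hTm : MeasurableSet T := by
    have hm : Measurable fun z : Fin n → ℝ × ℝ => ((fun i => (z i).1), fun i => (z i).2) := by
      fun_prop
    exact hm hS
  have e1 : sampleLaw n P {ω | (runs ω, outcomes ω) ∈ S} =
      (Measure.pi fun _ : Fin n => P.map (fun o => (run o, outcome o))) T := by
    have : ∀ _ : Fin n, IsProbabilityMeasure (P.map (fun o => (run o, outcome o))) :=
      fun _ => Measure.isProbabilityMeasure_map hpm.aemeasurable
    rw [← Measure.pi_map_pi (μ := fun _ : Fin n => P) (f := fun _ o => (run o, outcome o))
      (fun _ => hpm.aemeasurable), Measure.map_apply (by fun_prop) hTm]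
    rfl
  have : IsProbabilityMeasure (((P.map run).prod (volume : Measure I)).map G) :=
    Measure.isProbabilityMeasure_map hGm.aemeasurable
  rw [e1, hlaw, ← Measure.pi_map_pi (μ := fun _ : Fin n => (P.map run).prod (volume : Measure I))
    (f := fun _ => G) (fun _ => hGm.aemeasurable), Measure.map_apply (by fun_prop) hTm]
  set T' : Set ((Fin n → ℝ) × (Fin n → I)) := {p | (p.1, fun i => F (p.1 i) (p.2 i)) ∈ S} with hT'
  have hTm' : MeasurableSet T' := by
    have hm : Measurable fun p : (Fin n → ℝ) × (Fin n → I) => (p.1, fun i => F (p.1 i) (p.2 i)) := by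
      refine measurable_fst.prodMk (measurable_pi_lambda _ fun i => ?_)
      have hi : Measurable fun p : (Fin n → ℝ) × (Fin n → I) => (p.1 i, p.2 i) := by fun_prop
      exact hF.comp hi
    exact hm hS
  have hmp := measurePreserving_arrowProdEquivProdArrow ℝ I (Fin n)
    (fun _ => P.map run) (fun _ => (volume : Measure I))
  -- Regrouping an array of pairs as a pair of arrays lets Fubini condition on all running variables
  -- at once.
  have e2 : ((fun (x : Fin n → ℝ × I) i => G (x i)) ⁻¹' T) =
      (MeasurableEquiv.arrowProdEquivProdArrow ℝ I (Fin n)) ⁻¹' T' := rfl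
  rw [e2, hmp.measure_preimage hTm'.nullMeasurableSet, Measure.prod_apply hTm']
  calc _ ≤ ∫⁻ _, c ∂(Measure.pi fun _ : Fin n => P.map run) := lintegral_mono_ae h
    _ = c := by simp

/-! ### No observation dominates the weights of the difference -/

/-- Two separated subsets of a region on which `k` is comparable to its maximum on the region. -/
structure Spread (k : ℝ → ℝ) (R A₁ A₂ : Set ℝ) (C g : ℝ) : Prop where
  sub₁ : A₁ ⊆ R
  sub₂ : A₂ ⊆ R
  gap : ∀ z₁ ∈ A₁, ∀ z₂ ∈ A₂, ∀ t ∈ R, ∀ z ∈ R, g * |t - z| ≤ |z₁ - z₂|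
  pos : ∀ z₁ ∈ A₁, ∀ z₂ ∈ A₂, z₁ ≠ z₂
  comp : ∀ t ∈ R, ∀ z ∈ A₁ ∪ A₂, k t ≤ C * k z

lemma Spread.subset {k : ℝ → ℝ} {R R' A₁ A₂ : Set ℝ} {C g : ℝ} (hs : Spread k R A₁ A₂ C g)
    (hR : R' ⊆ R) (h₁ : A₁ ⊆ R') (h₂ : A₂ ⊆ R') : Spread k R' A₁ A₂ C g :=
  ⟨h₁, h₂, fun z₁ k₁ z₂ k₂ t ht z hz => hs.gap z₁ k₁ z₂ k₂ t (hR ht) z (hR hz), hs.pos,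
    fun t ht z hz => hs.comp t (hR ht) z hz⟩

lemma Spread.neg {k : ℝ → ℝ} (hk : ∀ t, k (-t) = k t) {R A₁ A₂ : Set ℝ} {C g : ℝ}
    (hs : Spread k R A₁ A₂ C g) :
    Spread k (Neg.neg ⁻¹' R) (Neg.neg ⁻¹' A₁) (Neg.neg ⁻¹' A₂) C g where
  sub₁ := Set.preimage_mono hs.sub₁
  sub₂ := Set.preimage_mono hs.sub₂
  gap := fun z₁ k₁ z₂ k₂ t ht z hz => by
    have := hs.gap (-z₁) k₁ (-z₂) k₂ (-t) ht (-z) hz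
    rwa [neg_sub_neg, neg_sub_neg, abs_sub_comm z t, abs_sub_comm z₂ z₁] at this
  pos := fun z₁ k₁ z₂ k₂ h => hs.pos (-z₁) k₁ (-z₂) k₂ (by rw [h])
  comp := fun t ht z hz => by
    have := hs.comp (-t) ht (-z) hz
    rwa [hk, hk] at this

/-- The value of a line at t is the interpolation of its values at z₁ and z₂. The coefficients are
at most 1/g by `gap`, and `comp` exchanges k(t) for k at the nodes. -/
lemma sq_linear_le {k : ℝ → ℝ} (hk : ∀ t, 0 ≤ k t) {R A₁ A₂ : Set ℝ} {C g : ℝ}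
    (hg : 0 < g) (hs : Spread k R A₁ A₂ C g) {A B t z₁ z₂ : ℝ} (ht : t ∈ R)
    (h₁ : z₁ ∈ A₁) (h₂ : z₂ ∈ A₂) :
    (k t * (A + B * t)) ^ 2 ≤
      2 * C ^ 2 / g ^ 2 * ((k z₁ * (A + B * z₁)) ^ 2 + (k z₂ * (A + B * z₂)) ^ 2) := by
  have hD : 0 < |z₁ - z₂| := abs_pos.2 (sub_ne_zero.2 (hs.pos z₁ h₁ z₂ h₂))
  have g1 := hs.gap z₁ h₁ z₂ h₂ t ht z₁ (hs.sub₁ h₁)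
  have g2 := hs.gap z₁ h₁ z₂ h₂ t ht z₂ (hs.sub₂ h₂)
  have c1 := hs.comp t ht z₁ (Or.inl h₁)
  have c2 := hs.comp t ht z₂ (Or.inr h₂)
  set D := |z₁ - z₂|
  set P := k t * (A + B * t) with hP
  set P₁ := k z₁ * (A + B * z₁) with hP₁
  set P₂ := k z₂ * (A + B * z₂) with hP₂
  have e : (z₁ - z₂) * P = (t - z₂) * (k t * (A + B * z₁)) - (t - z₁) * (k t * (A + B * z₂)) := by
    rw [hP]; ring
  have q1 : |k t * (A + B * z₁)| ≤ C * |P₁| := by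
    rw [abs_mul, hP₁, abs_mul, abs_of_nonneg (hk t), abs_of_nonneg (hk z₁), ← mul_assoc]
    exact mul_le_mul_of_nonneg_right c1 (abs_nonneg _)
  have q2 : |k t * (A + B * z₂)| ≤ C * |P₂| := by
    rw [abs_mul, hP₂, abs_mul, abs_of_nonneg (hk t), abs_of_nonneg (hk z₂), ← mul_assoc]
    exact mul_le_mul_of_nonneg_right c2 (abs_nonneg _)
  have q1' := (abs_nonneg _).trans q1
  have q2' := (abs_nonneg _).trans q2
  have b : D * (g * |P|) ≤ D * (C * |P₁| + C * |P₂|) := by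
    calc D * (g * |P|) = g * |(z₁ - z₂) * P| := by rw [abs_mul (z₁ - z₂) P]; ring
      _ ≤ g * (|t - z₂| * |k t * (A + B * z₁)| + |t - z₁| * |k t * (A + B * z₂)|) := by
          rw [e, ← abs_mul, ← abs_mul]
          exact mul_le_mul_of_nonneg_left (abs_sub _ _) hg.le
      _ = (g * |t - z₂|) * |k t * (A + B * z₁)| + (g * |t - z₁|) * |k t * (A + B * z₂)| := by ring
      _ ≤ D * (C * |P₁|) + D * (C * |P₂|) := by gcongr
      _ = _ := by ring
  have b' : g * |P| ≤ C * |P₁| + C * |P₂| := le_of_mul_le_mul_left b hD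
  have b2 : (g * |P|) ^ 2 ≤ (C * |P₁| + C * |P₂|) ^ 2 :=
    pow_le_pow_left₀ (by positivity) b' 2
  rw [div_mul_eq_mul_div, le_div_iff₀ (by positivity)]
  have s0 := sq_abs P
  have s1 := sq_abs P₁
  have s2 := sq_abs P₂
  nlinarith [sq_nonneg (C * |P₁| - C * |P₂|)]

/-- Averaging the two-point bound over all pairs of observations from A₁ and A₂ spreads the
right-hand side over at least N observations in each set. -/
lemma sq_le_sum_of_spread {k : ℝ → ℝ} (hk : ∀ t, 0 ≤ k t) {R A₁ A₂ : Set ℝ} {C g : ℝ}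
    (hg : 0 < g) (hs : Spread k R A₁ A₂ C g) {n : ℕ} {x w : Fin n → ℝ} {A B : ℝ}
    (hw : ∀ i, x i ∈ R → w i = k (x i) * (A + B * x i)) {N : ℕ} (hN : 0 < N)
    (h₁ : N ≤ countIn A₁ x) (h₂ : N ≤ countIn A₂ x) {i : Fin n} (hi : x i ∈ R) :
    w i ^ 2 ≤ 4 * C ^ 2 / g ^ 2 / N * ∑ j, w j ^ 2 := by
  classical
  obtain ⟨a₁, ha₁⟩ : ∃ a₁ : Finset (Fin n), a₁ = Finset.univ.filter (fun i => x i ∈ A₁) := ⟨_, rfl⟩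
  obtain ⟨a₂, ha₂⟩ : ∃ a₂ : Finset (Fin n), a₂ = Finset.univ.filter (fun i => x i ∈ A₂) := ⟨_, rfl⟩
  have m₁ : ∀ j ∈ a₁, x j ∈ A₁ := fun j hj => by rw [ha₁] at hj; exact (Finset.mem_filter.1 hj).2
  have m₂ : ∀ j ∈ a₂, x j ∈ A₂ := fun j hj => by rw [ha₂] at hj; exact (Finset.mem_filter.1 hj).2
  have n₁ : (N : ℝ) ≤ a₁.card := by rw [ha₁]; unfold countIn at h₁; exact_mod_cast h₁
  have n₂ : (N : ℝ) ≤ a₂.card := by rw [ha₂]; unfold countIn at h₂; exact_mod_cast h₂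
  have hN0 : (0 : ℝ) < N := by exact_mod_cast hN
  set D := 2 * C ^ 2 / g ^ 2 with hD
  have hD0 : 0 ≤ D := by positivity
  set S := ∑ j, w j ^ 2 with hS
  have hsub : ∀ a : Finset (Fin n), ∑ j ∈ a, w j ^ 2 ≤ S := fun a =>
    Finset.sum_le_sum_of_subset_of_nonneg (Finset.subset_univ _) fun _ _ _ => sq_nonneg _
  have hS0 : 0 ≤ S := Finset.sum_nonneg fun _ _ => sq_nonneg _
  have pair : ∀ j ∈ a₁, ∀ l ∈ a₂, w i ^ 2 ≤ D * (w j ^ 2 + w l ^ 2) := by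
    intro j hj l hl
    rw [hw i hi, hw j (hs.sub₁ (m₁ j hj)), hw l (hs.sub₂ (m₂ l hl))]
    exact sq_linear_le hk hg hs hi (m₁ j hj) (m₂ l hl)
  have dbl : ∑ j ∈ a₁, ∑ _l ∈ a₂, w i ^ 2 ≤ ∑ j ∈ a₁, ∑ l ∈ a₂, D * (w j ^ 2 + w l ^ 2) :=
    Finset.sum_le_sum fun j hj => Finset.sum_le_sum fun l hl => pair j hj l hl
  have e : ∑ j ∈ a₁, ∑ l ∈ a₂, D * (w j ^ 2 + w l ^ 2) =
      D * (a₂.card * ∑ j ∈ a₁, w j ^ 2 + a₁.card * ∑ l ∈ a₂, w l ^ 2) := by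
    simp only [← Finset.mul_sum, Finset.sum_add_distrib, Finset.sum_const, nsmul_eq_mul]
  rw [e] at dbl
  simp only [Finset.sum_const, nsmul_eq_mul] at dbl
  have c1 : (0 : ℝ) < a₁.card := hN0.trans_le n₁
  have c2 : (0 : ℝ) < a₂.card := hN0.trans_le n₂
  have f1 : (a₁.card : ℝ) * (a₂.card * w i ^ 2) ≤ D * (a₂.card * S + a₁.card * S) :=
    dbl.trans (mul_le_mul_of_nonneg_left (add_le_add
      (mul_le_mul_of_nonneg_left (hsub _) c2.le) (mul_le_mul_of_nonneg_left (hsub _) c1.le)) hD0)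
  have f2 : w i ^ 2 ≤ D * S * (1 / a₁.card + 1 / a₂.card) := by
    refine le_of_mul_le_mul_left (le_trans (le_of_eq ?_) (f1.trans (le_of_eq ?_))) (mul_pos c1 c2)
    · ring
    · field_simp
  refine f2.trans ?_
  have k1 : 1 / (a₁.card : ℝ) ≤ 1 / N := one_div_le_one_div_of_le hN0 n₁
  have k2 : 1 / (a₂.card : ℝ) ≤ 1 / N := one_div_le_one_div_of_le hN0 n₂
  calc D * S * (1 / a₁.card + 1 / a₂.card) ≤ D * S * (1 / N + 1 / N) := by gcongr
    _ = _ := by rw [hD]; ring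

/-- Samples for which the donut design is nonsingular and no observation dominates the weights of
the difference. -/
def GoodDesign (ε : ℝ) (K : ℝ → ℝ) (h d : ℝ) {n : ℕ} (x : Fin n → ℝ) : Prop :=
  TwoPoints K h d x ∧ ∀ i, diffWeight K h d x i ^ 2 ≤ ε * ∑ j, diffWeight K h d x j ^ 2

section Regions

variable {K : ℝ → ℝ} {h d : ℝ} {n : ℕ} {x : Fin n → ℝ}

/-- Outside the hole both weights share the kernel factor, so their difference is again the kernel
times one line per side; inside, only the conventional weight remains. -/
lemma diffWeight_outer {i : Fin n} (hi : d ≤ |x i|) : diffWeight K h d x i =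
    K (x i / h) * (regressor (x i) ⬝ᵥ (weightCoef K h d x - weightCoef K h 0 x)) := by
  rw [diffWeight, rdWeight_eq, rdWeight_eq, kernelWeight_of_le hi, kernelWeight_zero,
    dotProduct_sub]
  ring

lemma diffWeight_inner {i : Fin n} (hi : |x i| < d) : diffWeight K h d x i =
    K (x i / h) * (regressor (x i) ⬝ᵥ (- weightCoef K h 0 x)) := by
  rw [diffWeight, rdWeight_eq, rdWeight_eq, kernelWeight_of_lt hi, kernelWeight_zero,
    dotProduct_neg]
  ring

lemma exists_mem_of_countIn_pos {A : Set ℝ} (hA : 0 < countIn A x) : ∃ i, x i ∈ A := by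
  classical
  obtain ⟨i, hi⟩ := Finset.card_pos.1 hA
  exact ⟨i, (Finset.mem_filter.1 hi).2⟩

lemma goodDesign_of_spread (hK : IsKernel K) (hh : 0 < h) {ε C g : ℝ}
    (hg : 0 < g) {N : ℕ} (hN : 0 < N) (hε : 4 * C ^ 2 / g ^ 2 / N ≤ ε) {A₁ A₂ B₁ B₂ : Set ℝ}
    (hA : Spread (fun t => K (t / h)) (Set.Icc d h) A₁ A₂ C g)
    (hA₁0 : A₁ ⊆ Set.Ioi 0) (hA₂0 : A₂ ⊆ Set.Ioi 0)
    (hA₁ : ∀ z ∈ A₁, 0 < K (z / h)) (hA₂ : ∀ z ∈ A₂, 0 < K (z / h))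
    (hlt : ∀ z₁ ∈ A₁, ∀ z₂ ∈ A₂, z₁ < z₂)
    (hB : (∀ t, |t| < d → K (t / h) = 0) ∨
      (Spread (fun t => K (t / h)) (Set.Ico 0 d) B₁ B₂ C g ∧ B₁ ⊆ Set.Ioi 0 ∧ B₂ ⊆ Set.Ioi 0))
    (cA₁ : N ≤ countIn A₁ x) (cA₂ : N ≤ countIn A₂ x)
    (cA₁' : N ≤ countIn (Neg.neg ⁻¹' A₁) x) (cA₂' : N ≤ countIn (Neg.neg ⁻¹' A₂) x)
    (cB₁ : N ≤ countIn B₁ x) (cB₂ : N ≤ countIn B₂ x)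
    (cB₁' : N ≤ countIn (Neg.neg ⁻¹' B₁) x) (cB₂' : N ≤ countIn (Neg.neg ⁻¹' B₂) x) :
    GoodDesign ε K h d x := by
  have hkn : ∀ t, 0 ≤ K (t / h) := fun t => hK.nonneg _
  have hks : ∀ t, K (-t / h) = K (t / h) := fun t => by rw [neg_div, hK.symm]
  constructor
  · obtain ⟨i, hi⟩ := exists_mem_of_countIn_pos (hN.trans_le cA₁)
    obtain ⟨j, hj⟩ := exists_mem_of_countIn_pos (hN.trans_le cA₂)
    obtain ⟨i', hi'⟩ := exists_mem_of_countIn_pos (hN.trans_le cA₁')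
    obtain ⟨j', hj'⟩ := exists_mem_of_countIn_pos (hN.trans_le cA₂')
    have key : ∀ z, z ∈ Set.Icc d h → 0 < z → 0 < K (z / h) → 0 < kernelWeight K h d z := by
      intro z hz hz0 hkz
      rwa [kernelWeight_of_le (by rw [abs_of_pos hz0]; exact hz.1)]
    have keyn : ∀ z, -z ∈ Set.Icc d h → 0 < -z → 0 < K (-z / h) → 0 < kernelWeight K h d z := by
      intro z hz hz0 hkz
      rw [hks] at hkz
      rwa [kernelWeight_of_le (by rw [abs_of_neg (neg_pos.1 hz0)]; exact hz.1)]
    refine ⟨⟨i, j, le_of_lt (hA₁0 hi), hlt _ hi _ hj, key _ (hA.sub₁ hi) (hA₁0 hi) (hA₁ _ hi),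
      key _ (hA.sub₂ hj) (hA₂0 hj) (hA₂ _ hj)⟩, ⟨i', j', neg_pos.1 (hA₁0 hi'),
      neg_lt_neg_iff.1 (hlt _ hi' _ hj'), keyn _ (hA.sub₁ hi') (hA₁0 hi') (hA₁ _ hi'),
      keyn _ (hA.sub₂ hj') (hA₂0 hj') (hA₂ _ hj')⟩⟩
  · intro i
    have hS0 : 0 ≤ ∑ j, diffWeight K h d x j ^ 2 := Finset.sum_nonneg fun _ _ => sq_nonneg _
    have hε0 : 0 ≤ ε := le_trans (by positivity) hε
    refine le_trans ?_ (mul_le_mul_of_nonneg_right hε hS0)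
    have hzero : K (x i / h) = 0 → diffWeight K h d x i ^ 2 ≤
        4 * C ^ 2 / g ^ 2 / N * ∑ j, diffWeight K h d x j ^ 2 := by
      intro h0
      have : diffWeight K h d x i = 0 := by
        rcases le_or_gt d |x i| with hd | hd
        · rw [diffWeight_outer hd, h0, zero_mul]
        · rw [diffWeight_inner hd, h0, zero_mul]
      rw [this, zero_pow two_ne_zero]
      positivity
    rcases lt_or_ge h |x i| with hbig | hsmall
    · refine hzero (hK.eq_zero _ ?_)
      rwa [abs_div, abs_of_pos hh, lt_div_iff₀ hh, one_mul]
    set γ := weightCoef K h d x - weightCoef K h 0 x with hγ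
    set δ := - weightCoef K h 0 x with hδ
    rcases le_or_gt d |x i| with hd | hd <;> rcases le_or_gt 0 (x i) with hx | hx
    · rw [abs_of_nonneg hx] at hd hsmall
      refine sq_le_sum_of_spread (A := γ 0 + γ 3) (B := γ 1 + γ 2) hkn hg (hA.subset (R' := Set.Icc d h ∩ Set.Ici 0)
        Set.inter_subset_left
        (Set.subset_inter hA.sub₁ (hA₁0.trans Set.Ioi_subset_Ici_self))
        (Set.subset_inter hA.sub₂ (hA₂0.trans Set.Ioi_subset_Ici_self)))
        (fun j hj => ?_) hN cA₁ cA₂ ⟨⟨hd, hsmall⟩, hx⟩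
      rw [diffWeight_outer (by rw [abs_of_nonneg hj.2]; exact hj.1.1),
        regressor_dot_of_nonneg hj.2]
    · rw [abs_of_neg hx] at hd hsmall
      -- A running variable equal to 0 counts as treated, so the reflected region is cut down to
      -- strictly positive points.
      refine sq_le_sum_of_spread (A := γ 3) (B := γ 1) hkn hg ((hA.subset (R' := Set.Icc d h ∩ Set.Ioi 0)
        Set.inter_subset_left (Set.subset_inter hA.sub₁ hA₁0)
        (Set.subset_inter hA.sub₂ hA₂0)).neg hks)
        (fun j hj => ?_) hN cA₁' cA₂' ⟨⟨hd, hsmall⟩, neg_pos.2 hx⟩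
      have hj2 : x j < 0 := neg_pos.1 hj.2
      rw [diffWeight_outer (by rw [abs_of_neg hj2]; exact hj.1.1), regressor_dot_of_neg hj2]
    · rcases hB with hB | ⟨hB, -, -⟩
      · exact hzero (hB _ hd)
      · rw [abs_of_nonneg hx] at hd
        refine sq_le_sum_of_spread (A := δ 0 + δ 3) (B := δ 1 + δ 2) hkn hg hB (fun j hj => ?_) hN cB₁ cB₂ ⟨hx, hd⟩
        rw [diffWeight_inner (by rw [abs_of_nonneg hj.1]; exact hj.2),
          regressor_dot_of_nonneg hj.1]
    · rcases hB with hB | ⟨hB, hB₁0, hB₂0⟩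
      · exact hzero (hB _ hd)
      · rw [abs_of_neg hx] at hd
        refine sq_le_sum_of_spread (A := δ 3) (B := δ 1) hkn hg ((hB.subset (R' := Set.Ico 0 d ∩ Set.Ioi 0)
          Set.inter_subset_left (Set.subset_inter hB.sub₁ hB₁0)
          (Set.subset_inter hB.sub₂ hB₂0)).neg hks)
          (fun j hj => ?_) hN cB₁' cB₂' ⟨⟨neg_nonneg.2 hx.le, hd⟩, neg_pos.2 hx⟩
        have hj2 : x j < 0 := neg_pos.1 hj.2
        rw [diffWeight_inner (by rw [abs_of_neg hj2]; exact hj.1.2), regressor_dot_of_neg hj2]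

end Regions

/-! ### Asymptotic frameworks -/

lemma IsKernel.measurable {K : ℝ → ℝ} (hK : IsKernel K) : Measurable K := by
  classical
  have h := hK.continuousOn.measurable_piecewise (g := fun _ => (0 : ℝ)) continuousOn_const
    measurableSet_Icc
  convert! h using 1
  ext u
  by_cases hu : u ∈ Set.Icc (-1 : ℝ) 1
  · rw [Set.piecewise_eq_of_mem _ _ _ hu]
  · rw [Set.piecewise_eq_of_notMem _ _ _ hu]
    refine hK.eq_zero u ?_
    by_contra! hle
    exact hu (abs_le.1 hle)

lemma IsKernel.exists_bound {K : ℝ → ℝ} (hK : IsKernel K) : ∃ C, 0 < C ∧ ∀ u, K u ≤ C := by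
  obtain ⟨C, hC⟩ := isCompact_Icc.exists_bound_of_continuousOn hK.continuousOn
  refine ⟨max C 1, by positivity, fun u => ?_⟩
  by_cases hu : |u| ≤ 1
  · exact (le_abs_self _).trans ((hC u (abs_le.1 hu)).trans (le_max_left _ _))
  · rw [hK.eq_zero u (not_le.1 hu)]; positivity

/-- Two separated sets of proportional size on which a kernel is comparable to its maximum over
`[c, 1]`. -/
lemma exists_outer_sets {K : ℝ → ℝ} (hK : IsKernel K) {c C : ℝ} (hc0 : 0 ≤ c) (hc1 : c < 1)
    (hC : ∀ u ∈ Set.Icc c 1, (1 - c) * K u ≤ C * ∫ t in c..1, K t) :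
    0 < C ∧ ∃ A₁ A₂ : Set ℝ, MeasurableSet A₁ ∧ MeasurableSet A₂ ∧ A₁ ⊆ Set.Ioc c 1 ∧
      A₂ ⊆ Set.Ioc c 1 ∧ (1 - c) / (6 * C) ≤ volume.real A₁ ∧
      (1 - c) / (6 * C) ≤ volume.real A₂ ∧
      (∀ z₁ ∈ A₁, ∀ z₂ ∈ A₂, (1 - c) / (6 * C) ≤ z₂ - z₁) ∧
      (∀ z ∈ A₁ ∪ A₂, 0 < K z ∧ ∀ u ∈ Set.Icc c 1, K u ≤ 2 * C * K z) := by
  have hI : 0 < ∫ t in c..1, K t := hK.mass_pos c hc0 hc1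
  have hsub : Set.Icc c 1 ⊆ Set.Icc (-1 : ℝ) 1 := Set.Icc_subset_Icc (by linarith) le_rfl
  have hc : 0 < 1 - c := sub_pos.2 hc1
  have hKi : IntervalIntegrable K volume c 1 := by
    refine ContinuousOn.intervalIntegrable ?_
    rw [Set.uIcc_of_le hc1.le]
    exact hK.continuousOn.mono hsub
  -- m is the mean of K over [c, 1]; by hypothesis K ≤ C m there.
  obtain ⟨m, hm⟩ : ∃ m, m = (∫ t in c..1, K t) / (1 - c) := ⟨_, rfl⟩
  have hm0 : 0 < m := by rw [hm]; positivity
  have hmI : ∫ t in c..1, K t = m * (1 - c) := by rw [hm]; field_simp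
  have hCm : ∀ u ∈ Set.Icc c 1, K u ≤ C * m := by
    intro u hu
    have := hC u hu
    rw [hmI] at this
    nlinarith
  have hC0 : 0 < C := by
    by_contra! hneg
    have hle : ∫ t in c..1, K t ≤ ∫ t in c..1, (0 : ℝ) :=
      intervalIntegral.integral_mono_on hc1.le hKi (by simp) fun u hu =>
        (hCm u hu).trans (mul_nonpos_of_nonpos_of_nonneg hneg hm0.le)
    simp at hle
    linarith
  refine ⟨hC0, ?_⟩
  set A : Set ℝ := Set.Ioc c 1 ∩ {u | m / 2 ≤ K u} with hA
  have hAm : MeasurableSet A :=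
    measurableSet_Ioc.inter (measurableSet_le measurable_const hK.measurable)
  have hAfin : volume A ≠ ⊤ := measure_ne_top_of_subset Set.inter_subset_left (by simp)
  have hfin : ∀ S : Set ℝ, volume (A ∩ S) ≠ ⊤ :=
    fun S => measure_ne_top_of_subset Set.inter_subset_left hAfin
  -- K is at most C m on A and at most m/2 off A, so a mean of m forces A to be large.
  have hV : (1 - c) / (2 * C) ≤ volume.real A := by
    have hint : Integrable (A.indicator fun _ => C * m) volume :=
      (integrableOn_const hAfin).integrable_indicator hAm
    have hind : IntervalIntegrable (A.indicator fun _ => C * m) volume c 1 := hint.intervalIntegrable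
    have h1 : ∫ t in c..1, K t ≤ ∫ t in c..1, (A.indicator (fun _ => C * m) t + m / 2) := by
      refine intervalIntegral.integral_mono_on_of_le_Ioo hc1.le hKi
        (hind.add (by simp)) fun u hu => ?_
      by_cases hu' : u ∈ A
      · rw [Set.indicator_of_mem hu']
        linarith [hCm u (Set.Ioo_subset_Icc_self hu)]
      · rw [Set.indicator_of_notMem hu', zero_add]
        by_contra! hlt
        exact hu' ⟨Set.Ioo_subset_Ioc_self hu, hlt.le⟩
    have h2 : ∫ t in c..1, (A.indicator (fun _ => C * m) t + m / 2) =
        C * m * volume.real A + m / 2 * (1 - c) := by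
      rw [intervalIntegral.integral_add hind (by simp), intervalIntegral.integral_of_le hc1.le,
        integral_indicator_const _ hAm, measureReal_restrict_apply hAm,
        Set.inter_eq_left.2 (Set.inter_subset_left : A ⊆ Set.Ioc c 1)]
      simp
      ring
    rw [h2, hmI] at h1
    rw [div_le_iff₀ (by positivity)]
    have : m * (1 - c) ≤ m * (volume.real A * (2 * C)) := by nlinarith
    exact le_of_mul_le_mul_left this hm0
  -- The distribution function of A is 1-Lipschitz, so A can be cut into thirds by volume. The outer
  -- thirds are kept, and the middle one forces a gap of at least V/3 between them.
  set φ : ℝ → ℝ := fun θ => volume.real (A ∩ Set.Iic θ) with hφ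
  have hφmono : Monotone φ := fun s t hst =>
    measureReal_mono (Set.inter_subset_inter_right _ (Set.Iic_subset_Iic.2 hst)) (hfin _)
  have hφadd : ∀ s t, s ≤ t → φ t ≤ φ s + (t - s) := by
    intro s t hst
    calc φ t ≤ volume.real ((A ∩ Set.Iic s) ∪ Set.Ioc s t) := by
          refine measureReal_mono (fun u hu => ?_) ?_
          · by_cases hus : u ≤ s
            · exact Or.inl ⟨hu.1, hus⟩
            · exact Or.inr ⟨not_le.1 hus, hu.2⟩
          · exact (measure_union_lt_top (lt_top_iff_ne_top.2 (hfin _)) (by simp)).ne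
      _ ≤ φ s + volume.real (Set.Ioc s t) := measureReal_union_le _ _
      _ = φ s + (t - s) := by rw [Real.volume_real_Ioc_of_le hst]
  have hφc : Continuous φ := by
    have : LipschitzWith 1 φ := LipschitzWith.of_le_add fun s t => by
      rcases le_total s t with hst | hst
      · exact (hφmono hst).trans (le_add_of_nonneg_right dist_nonneg)
      · rw [Real.dist_eq, abs_of_nonneg (sub_nonneg.2 hst)]
        exact hφadd t s hst
    exact this.continuous
  set V := volume.real A with hVdef
  have hV0 : 0 < V := lt_of_lt_of_le (by positivity) hV
  have hφ0 : φ c = 0 := by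
    have : A ∩ Set.Iic c = ∅ :=
      Set.eq_empty_of_forall_notMem fun u hu => absurd hu.1.1.1 (not_lt.2 hu.2)
    simp [hφ, this]
  have hφ1 : φ 1 = V := by
    have : A ∩ Set.Iic 1 = A := Set.inter_eq_left.2 fun u hu => hu.1.2
    simp [hφ, this, hVdef]
  have hivt := intermediate_value_Icc hc1.le hφc.continuousOn
  rw [hφ0, hφ1] at hivt
  obtain ⟨θ₁, -, hθ₁⟩ := hivt (⟨by positivity, by linarith⟩ : V / 3 ∈ Set.Icc 0 V)
  obtain ⟨θ₂, -, hθ₂⟩ := hivt (⟨by positivity, by linarith⟩ : 2 * V / 3 ∈ Set.Icc 0 V)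
  have hθ : θ₁ ≤ θ₂ := by
    by_contra! hlt
    have := hφmono hlt.le
    linarith
  have hgap : V / 3 ≤ θ₂ - θ₁ := by linarith [hφadd θ₁ θ₂ hθ]
  have hV3 : (1 - c) / (6 * C) ≤ V / 3 := by
    calc (1 - c) / (6 * C) = (1 - c) / (2 * C) / 3 := by field_simp; norm_num
      _ ≤ V / 3 := by gcongr
  refine ⟨A ∩ Set.Iic θ₁, A ∩ Set.Ioi θ₂, hAm.inter measurableSet_Iic, hAm.inter measurableSet_Ioi,
    fun u hu => hu.1.1, fun u hu => hu.1.1, ?_, ?_, ?_, ?_⟩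
  · exact hV3.trans hθ₁.ge
  · have : V ≤ φ θ₂ + volume.real (A ∩ Set.Ioi θ₂) := by
      refine le_trans (measureReal_mono (fun u hu => ?_) ?_) (measureReal_union_le _ _)
      · rcases le_or_gt u θ₂ with h | h
        · exact Or.inl ⟨hu, h⟩
        · exact Or.inr ⟨hu, h⟩
      · exact (measure_union_lt_top (lt_top_iff_ne_top.2 (hfin _))
          (lt_top_iff_ne_top.2 (hfin _))).ne
    linarith
  · intro z₁ hz₁ z₂ hz₂
    have h1 : z₁ ≤ θ₁ := hz₁.2
    have h2 : θ₂ < z₂ := hz₂.2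
    linarith
  · intro z hz
    have hzA : m / 2 ≤ K z := by
      rcases hz with hz | hz
      · exact hz.1.2
      · exact hz.1.2
    refine ⟨by linarith, fun u hu => (hCm u hu).trans ?_⟩
    nlinarith

/-- By continuity K stays above half of K(u₀) near u₀. The four points delimit two separated
intervals at fixed positions relative to the bandwidth. -/
lemma exists_inner_interval {K : ℝ → ℝ} (hK : IsKernel K) {c u₀ : ℝ} (hc1 : c ≤ 1) (hu0 : 0 ≤ u₀)
    (huc : u₀ < c) (hKu : 0 < K u₀) :
    ∃ p₁ p₂ p₃ p₄ κ : ℝ, 0 < κ ∧ 0 < p₁ ∧ p₁ < p₂ ∧ p₂ < p₃ ∧ p₃ < p₄ ∧ p₄ < c ∧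
      ∀ u ∈ Set.Icc p₁ p₄, κ ≤ K u := by
  have hcont := hK.continuousOn u₀ ⟨by linarith, by linarith⟩
  have hev := hcont.eventually (lt_mem_nhds (half_lt_self hKu))
  rw [eventually_nhdsWithin_iff, Metric.eventually_nhds_iff] at hev
  obtain ⟨δ, hδ, hδK⟩ := hev
  set r := min δ (c - u₀) with hr
  have hr0 : 0 < r := lt_min hδ (by linarith)
  have hrδ : r ≤ δ := min_le_left _ _
  have hrc : r ≤ c - u₀ := min_le_right _ _
  refine ⟨u₀ + r / 5, u₀ + 2 * r / 5, u₀ + 3 * r / 5, u₀ + 4 * r / 5, K u₀ / 2, by positivity,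
    by positivity, by linarith, by linarith, by linarith, by linarith, fun u hu => ?_⟩
  refine (hδK ?_ ⟨by linarith [hu.1], by linarith [hu.2]⟩).le
  rw [Real.dist_eq, abs_lt]
  constructor <;> linarith [hu.1, hu.2]

/-- Common features of the small and the large donut asymptotics. -/
structure Framework (K : ℝ → ℝ) (h d : ℕ → ℝ) : Prop where
  nonneg : ∀ n, 0 ≤ d n
  lt : ∀ n, d n < h n
  tendsto : Tendsto (fun n : ℕ => (n : ℝ) * (h n - d n)) atTop atTop
  outer : ∃ C, ∀ n, ∀ u ∈ Set.Icc (d n / h n) 1,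
    (1 - d n / h n) * K u ≤ C * ∫ t in (d n / h n)..1, K t
  inner : (∀ n t, |t| < d n → K (t / h n) = 0) ∨ ∃ p₁ p₂ p₃ p₄ κ : ℝ, 0 < κ ∧ 0 < p₁ ∧ p₁ < p₂ ∧
    p₂ < p₃ ∧ p₃ < p₄ ∧ (∀ u ∈ Set.Icc p₁ p₄, κ ≤ K u) ∧ ∀ᶠ n in atTop, p₄ * h n < d n

/-! ### Small and large donuts as instances of the framework -/

lemma abs_div_lt {t h c : ℝ} (hh : 0 < h) (ht : |t| < c * h) : |t / h| < c := by
  rwa [abs_div, abs_of_pos hh, div_lt_iff₀ hh]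

lemma SmallDonut.framework {K : ℝ → ℝ} (hK : IsKernel K) {h d : ℕ → ℝ} (hs : SmallDonut h d) :
    Framework K h d := by
  obtain ⟨hh, ⟨c, hc0, hc1, hd⟩, -, hlim⟩ := hs
  have hdiv : ∀ n, d n / h n = c := fun n => by rw [hd, mul_div_cancel_right₀ _ (hh n).ne']
  have hsub : ∀ n, h n - d n = (1 - c) * h n := fun n => by rw [hd]; ring
  refine ⟨fun n => ?_, fun n => ?_, ?_, ?_, ?_⟩
  · rw [hd]; exact mul_nonneg hc0 (hh n).le
  · rw [hd]; exact mul_lt_of_lt_one_left (hh n) hc1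
  · have := hlim.const_mul_atTop (sub_pos.2 hc1)
    refine this.congr fun n => ?_
    rw [hsub]; ring
  · obtain ⟨C, hC0, hC⟩ := hK.exists_bound
    have hI := hK.mass_pos c hc0 hc1
    refine ⟨C / ∫ t in c..1, K t, fun n u hu => ?_⟩
    rw [hdiv, div_mul_cancel₀ _ hI.ne']
    have := hK.nonneg u
    nlinarith [hC u]
  -- A kernel may vanish on all of [0, c); then observations in the hole have weight zero in both
  -- fits.
  · by_cases hz : ∃ u, 0 ≤ u ∧ u < c ∧ 0 < K u
    · obtain ⟨u, hu0, huc, hKu⟩ := hz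
      obtain ⟨p₁, p₂, p₃, p₄, κ, hκ, h1, h2, h3, h4, h5, h6⟩ :=
        exists_inner_interval hK hc1.le hu0 huc hKu
      refine Or.inr ⟨p₁, p₂, p₃, p₄, κ, hκ, h1, h2, h3, h4, h6, Eventually.of_forall fun n => ?_⟩
      rw [hd]
      exact mul_lt_mul_of_pos_right h5 (hh n)
    · push Not at hz
      refine Or.inl fun n t ht => ?_
      have hz' := hz |t / h n| (abs_nonneg _) (abs_div_lt (hh n) (by rwa [← hd]))
      have habs : K |t / h n| = K (t / h n) := by
        rcases abs_choice (t / h n) with e | e <;> rw [e]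
        exact hK.symm _
      rw [habs] at hz'
      exact le_antisymm hz' (hK.nonneg _)

lemma LargeDonut.framework {K : ℝ → ℝ} (hK : IsKernel K) {h d : ℕ → ℝ} (hl : LargeDonut h d)
    (hE : EndpointRegular K) : Framework K h d := by
  obtain ⟨d₀, hd0, hd, hdh, hlim, hn⟩ := hl
  obtain ⟨C, hC⟩ := hE
  have hh : ∀ n, 0 < h n := fun n => hd0.trans_lt (hdh n)
  refine ⟨fun n => by rw [hd]; exact hd0, fun n => by rw [hd]; exact hdh n, ?_, ?_, ?_⟩
  · simpa only [hd] using hn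
  · refine ⟨C, fun n u hu => hC _ ?_ ?_ u hu⟩
    · rw [hd]; exact div_nonneg hd0 (hh n).le
    · rw [hd, div_lt_one (hh n)]; exact hdh n
  -- For d₀ = 0 the hole is empty.
  · rcases hd0.eq_or_lt with e | e
    · refine Or.inl fun n t ht => ?_
      rw [hd, ← e] at ht
      exact absurd ht (not_lt.2 (abs_nonneg t))
    · have hpos : ∃ u, 0 ≤ u ∧ u < 1 ∧ 0 < K u := by
        by_contra! hcon
        have h0 := hK.mass_pos 0 le_rfl one_pos
        have hKi : IntervalIntegrable K volume 0 1 := by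
          refine ContinuousOn.intervalIntegrable ?_
          rw [Set.uIcc_of_le zero_le_one]
          exact hK.continuousOn.mono (Set.Icc_subset_Icc (by norm_num) le_rfl)
        have hle := intervalIntegral.integral_mono_on_of_le_Ioo zero_le_one hKi
          (by simp : IntervalIntegrable (fun _ => (0 : ℝ)) volume 0 1)
          fun u hu => hcon u hu.1.le hu.2
        simp at hle
        linarith
      obtain ⟨u, hu0, hu1, hKu⟩ := hpos
      obtain ⟨p₁, p₂, p₃, p₄, κ, hκ, h1, h2, h3, h4, h5, h6⟩ :=
        exists_inner_interval hK le_rfl hu0 hu1 hKu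
      refine Or.inr ⟨p₁, p₂, p₃, p₄, κ, hκ, h1, h2, h3, h4, h6, ?_⟩
      -- Since d/h → 1, any fixed p₄ < 1 is eventually inside the hole.
      have : Tendsto (fun n => p₄ * h n) atTop (𝓝 (p₄ * d₀)) := hlim.const_mul _
      have hlt : p₄ * d₀ < d₀ := mul_lt_of_lt_one_left e h5
      filter_upwards [this.eventually (gt_mem_nhds hlt)] with n hn
      rwa [hd]

/-- The limit of the bandwidth, 0 or d₀, is at most some donut size whose closed hole lies in (a,
b); as (a, b) is open, nearby bandwidths fit too. -/
lemma eventually_Icc_subset {h d : ℕ → ℝ} {f : ℝ → ℝ} {a b : ℝ} (hf : DensityRegular f a b d)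
    (hasymp : SmallDonut h d ∨ LargeDonut h d) :
    ∀ᶠ n in atTop, Set.Icc (-(h n)) (h n) ⊆ Set.Ioo a b := by
  have key : ∃ d₀, 0 ≤ d₀ ∧ Tendsto h atTop (𝓝 d₀) ∧ ∃ n, d₀ ≤ d n ∧
      Set.Icc (-(d n)) (d n) ⊆ Set.Ioo a b := by
    rcases hasymp with ⟨hh, ⟨c, hc0, hc1, hd⟩, hlim, -⟩ | ⟨d₀, hd0, hd, hdh, hlim, -⟩
    · obtain ⟨n, hn⟩ := hf.contains_hole.exists
      exact ⟨0, le_rfl, hlim, n, by rw [hd]; exact mul_nonneg hc0 (hh n).le, hn⟩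
    · obtain ⟨n, hn⟩ := hf.contains_hole.exists
      exact ⟨d₀, hd0, hlim, n, (hd n).ge, hn⟩
  obtain ⟨d₀, hd0, hlim, n, hdn, hsub⟩ := key
  have h1 := hsub ⟨neg_le_neg hdn, by linarith⟩
  have h2 := hsub ⟨by linarith, hdn⟩
  filter_upwards [hlim.eventually (gt_mem_nhds h2.2),
    hlim.eventually (gt_mem_nhds (show d₀ < -a by linarith [h1.1]))] with k hk1 hk2 t ht
  exact ⟨by linarith [ht.1], by linarith [ht.2]⟩

lemma Spread.weaken {k : ℝ → ℝ} (hk : ∀ t, 0 ≤ k t) {R A₁ A₂ : Set ℝ} {C C' g g' : ℝ}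
    (hs : Spread k R A₁ A₂ C g) (hC : C ≤ C') (hg : g' ≤ g) : Spread k R A₁ A₂ C' g' :=
  ⟨hs.sub₁, hs.sub₂, fun z₁ h₁ z₂ h₂ t ht z hz =>
    (mul_le_mul_of_nonneg_right hg (abs_nonneg _)).trans (hs.gap z₁ h₁ z₂ h₂ t ht z hz), hs.pos,
    fun t ht z hz => (hs.comp t ht z hz).trans (mul_le_mul_of_nonneg_right hC (hk z))⟩

lemma volume_real_preimage_div {h : ℝ} (hh : 0 < h) (A : Set ℝ) :
    volume.real ((fun t => t / h) ⁻¹' A) = h * volume.real A := by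
  have := Real.volume_preimage_mul_right (inv_ne_zero hh.ne') A
  simp only [div_eq_mul_inv, measureReal_def]
  rw [this, inv_inv, ENNReal.toReal_mul, abs_of_pos hh, ENNReal.toReal_ofReal hh.le]

/-- A measurable set inside the bandwidth with volume at least `v`. -/
def LargeSet (h v : ℝ) (S : Set ℝ) : Prop :=
  MeasurableSet S ∧ S ⊆ Set.Icc (-h) h ∧ v ≤ volume.real S

lemma LargeSet.neg {h v : ℝ} {S : Set ℝ} (hS : LargeSet h v S) :
    LargeSet h v (Neg.neg ⁻¹' S) := by
  refine ⟨measurable_neg hS.1, fun t ht => ?_, ?_⟩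
  · have := hS.2.1 ht
    exact ⟨by linarith [this.2], by linarith [this.1]⟩
  · have : volume.real (Neg.neg ⁻¹' S) = volume.real S := by
      rw [measureReal_def, measureReal_def, Measure.measure_preimage_neg]
    rw [this]; exact hS.2.2

/-- Outside the hole the sets of `exists_outer_sets` are scaled by h, turning the length 1 - d/h
into h - d. Inside, fixed fractions of h are more than enough, as h ≥ h - d. -/
lemma Framework.exists_sets {K : ℝ → ℝ} (hK : IsKernel K) {h d : ℕ → ℝ} (fw : Framework K h d) :
    ∃ C g b₀ : ℝ, 0 < g ∧ 0 < b₀ ∧ ∀ᶠ n in atTop, ∃ A₁ A₂ B₁ B₂ : Set ℝ,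
      LargeSet (h n) (b₀ * (h n - d n)) A₁ ∧ LargeSet (h n) (b₀ * (h n - d n)) A₂ ∧
      LargeSet (h n) (b₀ * (h n - d n)) B₁ ∧ LargeSet (h n) (b₀ * (h n - d n)) B₂ ∧
      Spread (fun t => K (t / h n)) (Set.Icc (d n) (h n)) A₁ A₂ C g ∧
      A₁ ⊆ Set.Ioi 0 ∧ A₂ ⊆ Set.Ioi 0 ∧ (∀ z ∈ A₁, 0 < K (z / h n)) ∧
      (∀ z ∈ A₂, 0 < K (z / h n)) ∧ (∀ z₁ ∈ A₁, ∀ z₂ ∈ A₂, z₁ < z₂) ∧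
      ((∀ t, |t| < d n → K (t / h n) = 0) ∨
        (Spread (fun t => K (t / h n)) (Set.Ico 0 (d n)) B₁ B₂ C g ∧
          B₁ ⊆ Set.Ioi 0 ∧ B₂ ⊆ Set.Ioi 0)) := by
  obtain ⟨C, hC⟩ := fw.outer
  have hh : ∀ n, 0 < h n := fun n => (fw.nonneg n).trans_lt (fw.lt n)
  have hc0 : ∀ n, 0 ≤ d n / h n := fun n => div_nonneg (fw.nonneg n) (hh n).le
  have hc1 : ∀ n, d n / h n < 1 := fun n => (div_lt_one (hh n)).2 (fw.lt n)
  have hC0 : 0 < C := (exists_outer_sets hK (hc0 0) (hc1 0) (hC 0)).1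
  have outer : ∀ n, ∃ A₁ A₂ : Set ℝ,
      LargeSet (h n) (1 / (6 * C) * (h n - d n)) A₁ ∧ LargeSet (h n) (1 / (6 * C) * (h n - d n)) A₂ ∧
      Spread (fun t => K (t / h n)) (Set.Icc (d n) (h n)) A₁ A₂ (2 * C) (1 / (6 * C)) ∧
      A₁ ⊆ Set.Ioi 0 ∧ A₂ ⊆ Set.Ioi 0 ∧ (∀ z ∈ A₁, 0 < K (z / h n)) ∧
      (∀ z ∈ A₂, 0 < K (z / h n)) ∧ (∀ z₁ ∈ A₁, ∀ z₂ ∈ A₂, z₁ < z₂) := by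
    intro n
    obtain ⟨-, A₁, A₂, m₁, m₂, s₁, s₂, v₁, v₂, hgap, hcomp⟩ :=
      exists_outer_sets hK (hc0 n) (hc1 n) (hC n)
    have hhn := hh n
    have hcc : 0 < 1 - d n / h n := sub_pos.2 (hc1 n)
    have hscale : h n * (1 - d n / h n) = h n - d n := by field_simp
    have key : ∀ A : Set ℝ, A ⊆ Set.Ioc (d n / h n) 1 → ∀ t, t / h n ∈ A →
        d n < t ∧ t ≤ h n := by
      intro A hA t ht
      have := hA ht
      exact ⟨(div_lt_div_iff_of_pos_right hhn).1 this.1, (div_le_one hhn).1 this.2⟩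
    have large : ∀ A : Set ℝ, MeasurableSet A → A ⊆ Set.Ioc (d n / h n) 1 →
        (1 - d n / h n) / (6 * C) ≤ volume.real A →
        LargeSet (h n) (1 / (6 * C) * (h n - d n)) ((fun t => t / h n) ⁻¹' A) := by
      intro A hm hs hv
      refine ⟨(measurable_id.div_const _) hm, fun t ht => ?_, ?_⟩
      · have := key A hs t ht
        exact ⟨by linarith [fw.nonneg n], this.2⟩
      · rw [volume_real_preimage_div hhn, ← hscale]
        calc _ = h n * ((1 - d n / h n) / (6 * C)) := by ring
          _ ≤ _ := by gcongr
    have hgap' : ∀ z₁ z₂, z₁ / h n ∈ A₁ → z₂ / h n ∈ A₂ →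
        1 / (6 * C) * (h n - d n) ≤ z₂ - z₁ := by
      intro z₁ z₂ h₁ h₂
      have := mul_le_mul_of_nonneg_left (hgap _ h₁ _ h₂) hhn.le
      rw [mul_sub, mul_div_cancel₀ _ hhn.ne', mul_div_cancel₀ _ hhn.ne', ← mul_div_assoc,
        hscale] at this
      linarith [div_eq_mul_one_div (h n - d n) (6 * C)]
    have hpos : 0 < 1 / (6 * C) * (h n - d n) :=
      mul_pos (by positivity) (sub_pos.2 (fw.lt n))
    have hlt : ∀ z₁ ∈ (fun t => t / h n) ⁻¹' A₁, ∀ z₂ ∈ (fun t => t / h n) ⁻¹' A₂, z₁ < z₂ :=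
      fun z₁ h₁ z₂ h₂ => by linarith [hgap' z₁ z₂ h₁ h₂]
    refine ⟨(fun t => t / h n) ⁻¹' A₁, (fun t => t / h n) ⁻¹' A₂, large A₁ m₁ s₁ v₁,
      large A₂ m₂ s₂ v₂, ⟨?_, ?_, ?_, ?_, ?_⟩, ?_, ?_, ?_, ?_, hlt⟩
    · exact fun t ht => ⟨(key A₁ s₁ t ht).1.le, (key A₁ s₁ t ht).2⟩
    · exact fun t ht => ⟨(key A₂ s₂ t ht).1.le, (key A₂ s₂ t ht).2⟩
    · intro z₁ h₁ z₂ h₂ t ht z hz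
      have h3 : |t - z| ≤ h n - d n := abs_le.2 ⟨by linarith [ht.1, hz.2], by linarith [ht.2, hz.1]⟩
      calc 1 / (6 * C) * |t - z| ≤ 1 / (6 * C) * (h n - d n) := by gcongr
        _ ≤ z₂ - z₁ := hgap' z₁ z₂ h₁ h₂
        _ ≤ |z₁ - z₂| := by rw [abs_sub_comm]; exact le_abs_self _
    · exact fun z₁ h₁ z₂ h₂ => (hlt z₁ h₁ z₂ h₂).ne
    · intro t ht z hz
      exact (hcomp (z / h n) hz).2 _ ⟨by have := ht.1; gcongr, (div_le_one hhn).2 ht.2⟩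
    · exact fun t ht => (fw.nonneg n).trans_lt (key A₁ s₁ t ht).1
    · exact fun t ht => (fw.nonneg n).trans_lt (key A₂ s₂ t ht).1
    · exact fun z hz => (hcomp _ (Or.inl hz)).1
    · exact fun z hz => (hcomp _ (Or.inr hz)).1
  rcases fw.inner with hin | ⟨p₁, p₂, p₃, p₄, κ, hκ, h1, h2, h3, h4, hKκ, hev⟩
  · refine ⟨2 * C, 1 / (6 * C), 1 / (6 * C), by positivity, by positivity,
      Eventually.of_forall fun n => ?_⟩
    obtain ⟨A₁, A₂, l₁, l₂, hrest⟩ := outer n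
    obtain ⟨q1, q2, q3, q4, q5, q6⟩ := hrest
    -- The kernel vanishes in the hole, so the inner sets are irrelevant and the outer ones serve as
    -- placeholders.
    exact ⟨A₁, A₂, A₁, A₂, l₁, l₂, l₁, l₂, q1, q2, q3, q4, q5, q6, Or.inl (hin n)⟩
  · obtain ⟨D, hD0, hD⟩ := hK.exists_bound
    set b₀ := min (1 / (6 * C)) (min (p₂ - p₁) (p₄ - p₃)) with hb₀
    have hb0 : 0 < b₀ := lt_min (by positivity) (lt_min (by linarith) (by linarith))
    refine ⟨max (2 * C) (D / κ), min (1 / (6 * C)) (p₃ - p₂), b₀,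
      lt_min (by positivity) (by linarith), hb0, ?_⟩
    filter_upwards [hev] with n hn
    have hhn := hh n
    have hnn : ∀ t, 0 ≤ K (t / h n) := fun t => hK.nonneg _
    obtain ⟨A₁, A₂, l₁, l₂, q1, q2, q3, q4, q5, q6⟩ := outer n
    have wk : ∀ S, LargeSet (h n) (1 / (6 * C) * (h n - d n)) S →
        LargeSet (h n) (b₀ * (h n - d n)) S := fun S hS => ⟨hS.1, hS.2.1, le_trans
      (mul_le_mul_of_nonneg_right (min_le_left _ _) (sub_pos.2 (fw.lt n)).le) hS.2.2⟩
    have hmem : ∀ {s e t : ℝ}, t ∈ (fun t => t / h n) ⁻¹' Set.Icc s e → s * h n ≤ t ∧ t ≤ e * h n :=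
      fun {s e t} ht => ⟨(le_div_iff₀ hhn).1 ht.1, (div_le_iff₀ hhn).1 ht.2⟩
    have large : ∀ s e : ℝ, p₁ ≤ s → s < e → e ≤ p₄ → b₀ ≤ e - s →
        LargeSet (h n) (b₀ * (h n - d n)) ((fun t => t / h n) ⁻¹' Set.Icc s e) := by
      intro s e hs hse he hb
      refine ⟨(measurable_id.div_const _) measurableSet_Icc, fun t ht => ?_, ?_⟩
      · have := hmem ht
        have hs0 : 0 ≤ s * h n := mul_nonneg (by linarith) hhn.le
        have : e * h n ≤ p₄ * h n := by gcongr
        exact ⟨by linarith, by linarith [fw.lt n]⟩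
      · rw [volume_real_preimage_div hhn, Real.volume_real_Icc_of_le hse.le, mul_comm]
        have := fw.nonneg n
        have : 0 < h n - d n := sub_pos.2 (fw.lt n)
        gcongr
        linarith
    have hpos : ∀ {s e t : ℝ}, p₁ ≤ s → e ≤ p₄ → t ∈ (fun t => t / h n) ⁻¹' Set.Icc s e →
        0 < t ∧ t < d n := by
      intro s e t hs he ht
      have h5 := hmem ht
      have h6 : 0 < s * h n := mul_pos (by linarith) hhn
      have h7 : e * h n ≤ p₄ * h n := by gcongr
      exact ⟨by linarith, by linarith⟩
    have hgap : ∀ z₁ ∈ (fun t => t / h n) ⁻¹' Set.Icc p₁ p₂,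
        ∀ z₂ ∈ (fun t => t / h n) ⁻¹' Set.Icc p₃ p₄, (p₃ - p₂) * h n ≤ z₂ - z₁ := by
      intro z₁ h₁ z₂ h₂
      have := hmem h₁
      have := hmem h₂
      nlinarith
    have hgpos : 0 < (p₃ - p₂) * h n := mul_pos (by linarith) hhn
    refine ⟨A₁, A₂, (fun t => t / h n) ⁻¹' Set.Icc p₁ p₂, (fun t => t / h n) ⁻¹' Set.Icc p₃ p₄,
      wk _ l₁, wk _ l₂,
      large p₁ p₂ le_rfl h2 (by linarith) ((min_le_right _ _).trans (min_le_left _ _)),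
      large p₃ p₄ (by linarith) h4 le_rfl ((min_le_right _ _).trans (min_le_right _ _)),
      q1.weaken hnn (le_max_left _ _) (min_le_left _ _), q2, q3, q4, q5, q6,
      Or.inr ⟨Spread.weaken hnn (C := D / κ) (g := p₃ - p₂) ⟨?_, ?_, ?_, ?_, ?_⟩
        (le_max_right _ _) (min_le_right _ _), ?_, ?_⟩⟩
    · exact fun t ht => ⟨(hpos le_rfl (by linarith) ht).1.le, (hpos le_rfl (by linarith) ht).2⟩
    · exact fun t ht => ⟨(hpos (by linarith) le_rfl ht).1.le, (hpos (by linarith) le_rfl ht).2⟩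
    · intro z₁ h₁ z₂ h₂ t ht z hz
      have h5 : |t - z| ≤ h n := abs_le.2
        ⟨by linarith [ht.1, hz.2, fw.lt n], by linarith [ht.2, hz.1, fw.lt n]⟩
      calc (p₃ - p₂) * |t - z| ≤ (p₃ - p₂) * h n :=
            mul_le_mul_of_nonneg_left h5 (by linarith)
        _ ≤ z₂ - z₁ := hgap z₁ h₁ z₂ h₂
        _ ≤ |z₁ - z₂| := by rw [abs_sub_comm]; exact le_abs_self _
    · intro z₁ h₁ z₂ h₂ heq
      have := hgap z₁ h₁ z₂ h₂
      rw [heq] at this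
      linarith
    · intro t _ z hz
      have hz' : κ ≤ K (z / h n) := by
        rcases hz with hz | hz
        · exact hKκ _ ⟨hz.1, hz.2.trans (by linarith)⟩
        · exact hKκ _ ⟨le_trans (by linarith) hz.1, hz.2⟩
      calc K (t / h n) ≤ D := hD _
        _ = D / κ * κ := by field_simp
        _ ≤ D / κ * K (z / h n) := by gcongr
    · exact fun t ht => (hpos le_rfl (by linarith) ht).1
    · exact fun t ht => (hpos (by linarith) le_rfl ht).1

/-- With probability tending to one, the donut design is nonsingular and no observation dominates
the weights of the difference. -/
lemma Framework.tendsto_not_goodDesign {K : ℝ → ℝ} (hK : IsKernel K) {h d : ℕ → ℝ}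
    (fw : Framework K h d) {ν : Measure ℝ} [IsProbabilityMeasure ν] {l a b : ℝ} (hl : 0 < l)
    (hν : ∀ A, MeasurableSet A → A ⊆ Set.Ioo a b → l * volume.real A ≤ ν.real A)
    (hab : ∀ᶠ n in atTop, Set.Icc (-(h n)) (h n) ⊆ Set.Ioo a b) {ε : ℝ} (hε : 0 < ε) :
    Tendsto (fun n => (Measure.pi fun _ : Fin n => ν).real
      {x | ¬ GoodDesign ε K (h n) (d n) x}) atTop (𝓝 0) := by
  obtain ⟨C, g, b₀, hg, hb0, hev⟩ := fw.exists_sets hK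
  have hh : ∀ n, 0 < h n := fun n => (fw.nonneg n).trans_lt (fw.lt n)
  -- N depends on ε but not on n, so the factor 2^N in the count bound is harmless.
  obtain ⟨N, hN⟩ := exists_nat_gt (4 * C ^ 2 / g ^ 2 / ε)
  have hN0 : 0 < N := by
    have : (0 : ℝ) < N := lt_of_le_of_lt (by positivity) hN
    exact_mod_cast this
  have hNε : 4 * C ^ 2 / g ^ 2 / N ≤ ε := by
    have h0 : (0 : ℝ) < N := by exact_mod_cast hN0
    rw [div_lt_iff₀ hε] at hN
    rw [div_le_iff₀ h0]
    linarith
  have hlim : Tendsto (fun n : ℕ => 8 * (2 ^ N * Real.exp (-(n * (l * (b₀ * (h n - d n))) / 2))))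
      atTop (𝓝 0) := by
    have h1 : Tendsto (fun n : ℕ => (n : ℝ) * (l * (b₀ * (h n - d n))) / 2) atTop atTop := by
      have := fw.tendsto.const_mul_atTop (show 0 < l * b₀ / 2 by positivity)
      exact this.congr fun n => by ring
    have h2 := Real.tendsto_exp_neg_atTop_nhds_zero.comp h1
    have h3 := (h2.const_mul (2 ^ N : ℝ)).const_mul 8
    simpa using h3
  refine tendsto_of_tendsto_of_tendsto_of_le_of_le' tendsto_const_nhds hlim
    (Eventually.of_forall fun n => measureReal_nonneg) ?_
  filter_upwards [hev, hab] with n hn habn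
  obtain ⟨A₁, A₂, B₁, B₂, lA₁, lA₂, lB₁, lB₂, q1, q2, q3, q4, q5, q6, q7⟩ := hn
  set Q := Measure.pi fun _ : Fin n => ν with hQ
  set c : ℝ := 2 ^ N * Real.exp (-(n * (l * (b₀ * (h n - d n))) / 2)) with hc
  have bound : ∀ S, LargeSet (h n) (b₀ * (h n - d n)) S → Q.real {x | countIn S x < N} ≤ c := by
    intro S hS
    refine (measure_countIn_lt_le ν hS.1 n N).trans ?_
    have h1 := hν S hS.1 (hS.2.1.trans habn)
    have h2 := hS.2.2
    have h3 : l * (b₀ * (h n - d n)) ≤ ν.real S :=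
      (mul_le_mul_of_nonneg_left h2 hl.le).trans h1
    rw [hc]
    gcongr
  -- Two sets for each of the four regions; if all eight hold at least N observations, the design is
  -- good.
  set U : Fin 8 → Set ℝ := ![A₁, A₂, Neg.neg ⁻¹' A₁, Neg.neg ⁻¹' A₂, B₁, B₂, Neg.neg ⁻¹' B₁,
    Neg.neg ⁻¹' B₂] with hU
  have hUl : ∀ j, LargeSet (h n) (b₀ * (h n - d n)) (U j) := by
    intro j
    fin_cases j
    exacts [lA₁, lA₂, lA₁.neg, lA₂.neg, lB₁, lB₂, lB₁.neg, lB₂.neg]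
  have hsub : {x | ¬ GoodDesign ε K (h n) (d n) x} ⊆ ⋃ j, {x : Fin n → ℝ | countIn (U j) x < N} := by
    intro x hx
    by_contra hcon
    simp only [Set.mem_iUnion, not_exists] at hcon
    have hcon' : ∀ j, N ≤ countIn (U j) x := fun j => not_lt.1 (hcon j)
    exact hx (goodDesign_of_spread hK (hh n) hg hN0 hNε q1 q2 q3 q4 q5 q6 q7 (hcon' 0) (hcon' 1)
      (hcon' 2) (hcon' 3) (hcon' 4) (hcon' 5) (hcon' 6) (hcon' 7))
  calc Q.real {x | ¬ GoodDesign ε K (h n) (d n) x}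
      ≤ Q.real (⋃ j, {x : Fin n → ℝ | countIn (U j) x < N}) := measureReal_mono hsub
    _ ≤ ∑ j, Q.real {x : Fin n → ℝ | countIn (U j) x < N} := measureReal_iUnion_fintype_le _
    _ ≤ ∑ _j : Fin 8, c := Finset.sum_le_sum fun j _ => bound _ (hUl j)
    _ = 8 * c := by simp

/-! ### Rejection of the null hypothesis -/

section Reject

variable {n : ℕ} {K : ℝ → ℝ} {h d : ℝ}

lemma diffVar_eq (x w : Fin n → ℝ) :
    diffVar K h d x w = ∑ i, diffWeight K h d x i ^ 2 * w i := by
  unfold diffVar diffWeight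
  exact Finset.sum_congr rfl fun i _ => by ring

lemma diffEstimate_eq (x y : Fin n → ℝ) :
    diffEstimate K h d x y = ∑ i, diffWeight K h d x i * y i := by
  simp only [diffEstimate, rdEstimate, diffWeight, ← Finset.sum_sub_distrib, sub_mul]

/-- A consistent variance estimate hardly changes the scale of a `t`-statistic. -/
lemma exists_variance_tolerance {δ : ℝ} (hδ : 0 < δ) :
    ∃ ε > 0, ∀ S T : ℝ, 0 < S → |T - S| ≤ ε * S →
      0 < T ∧ 1 / 2 ≤ √S / √T ∧ 4 * |√S / √T - 1| ≤ δ := by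
  -- √S/√T is the inverse square root of T/S, which lies near 1.
  have hc : ContinuousAt (fun u : ℝ => (√u)⁻¹) 1 :=
    Real.continuous_sqrt.continuousAt.inv₀ (by simp)
  obtain ⟨e, he, hball⟩ := Metric.continuousAt_iff.mp hc (min (1 / 2) (δ / 4)) (by positivity)
  refine ⟨min (e / 2) (1 / 2), by positivity, fun S T hS hT => ?_⟩
  have hlt : |T / S - 1| ≤ min (e / 2) (1 / 2) := by
    rw [div_sub_one hS.ne', abs_div, abs_of_pos hS, div_le_iff₀ hS]
    exact hT
  have h1 : |T / S - 1| ≤ 1 / 2 := hlt.trans (min_le_right _ _)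
  have hpos : 0 < T := by
    have := (abs_le.mp h1).1
    have h2 : 0 < T / S := by linarith
    exact (div_pos_iff_of_pos_right hS).mp h2
  have hb := hball (x := T / S) (by
    rw [Real.dist_eq]; exact (hlt.trans (min_le_left _ _)).trans_lt (by linarith))
  simp only [Real.dist_eq, Real.sqrt_one, inv_one] at hb
  have e1 : (√(T / S))⁻¹ = √S / √T := by
    rw [Real.sqrt_div' _ hS.le, inv_div]
  rw [e1] at hb
  have hb1 := hb.le.trans (min_le_left _ _)
  have hb2 := hb.le.trans (min_le_right _ _)
  refine ⟨hpos, ?_, by linarith⟩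
  linarith [(abs_le.mp hb1).1]

/-- Up to the relative error of the standard error, a rejection means that the tail probability of
the standardized estimate is at most the nominal level. -/
lemma foldedTail_le_of_reject {α b Δ s t : ℝ} (hα₀ : 0 < α) (hα₁ : α < 1) (hs : 0 < s) (ht : 0 < t)
    (hρ : 1 / 2 ≤ s / t) (hrej : criticalValue α (b / t) ≤ |Δ / t|) :
    foldedTail (b / s) (|Δ| / s) ≤ α + 4 * |s / t - 1| := by
  have e1 : b / t = s / t * (b / s) := by field_simp
  have hρ0 : 0 < s / t := div_pos hs ht
  have hle : criticalValue α (b / t) / (s / t) ≤ |Δ| / s := by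
    rw [div_le_iff₀ hρ0]
    refine hrej.trans_eq ?_
    rw [abs_div, abs_of_pos ht]
    field_simp
  calc foldedTail (b / s) (|Δ| / s)
      ≤ foldedTail (b / s) (criticalValue α (b / t) / (s / t)) := foldedTail_antitone _ hle
    _ ≤ foldedTail (s / t * (b / s)) (criticalValue α (b / t)) + 4 * |s / t - 1| :=
        foldedTail_div_le hρ _ _
    _ ≤ α + 4 * |s / t - 1| := by
        rw [← e1]
        linarith [(criticalValue_spec hα₀ hα₁ (b / t)).2]

/-- A rejection is impossible if the difference of the two estimates is degenerate. -/
lemma not_reject_of_degenerate {α M : ℝ} (hα₀ : 0 < α) (hα₁ : α < 1) (x y w : Fin n → ℝ)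
    (h0 : ∀ i, diffWeight K h d x i = 0) :
    ¬ testCriticalValue α M K h d x w ≤ |tStat K h d x y w| := by
  have : tStat K h d x y w = 0 := by
    simp [tStat, diffEstimate_eq, h0]
  rw [this, abs_zero, not_le]
  exact (criticalValue_spec hα₀ hα₁ _).1

end Reject

/-- Tail bound for the folded version of a standardized sum with a bounded bias. -/
lemma measure_foldedTail_le {Ω : Type*} [MeasurableSpace Ω] {μ : Measure Ω} [IsProbabilityMeasure μ]
    {W : Ω → ℝ} {η β r τ : ℝ} (hβ : |β| ≤ r) (hτ : 0 < τ)
    (h1 : ∀ t, μ.real {ω | t ≤ W ω} ≤ stdCdf (-t) + η)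
    (h2 : ∀ t, μ.real {ω | t ≤ -W ω} ≤ stdCdf (-t) + η) :
    μ {ω | foldedTail r |β + W ω| ≤ τ} ≤ ENNReal.ofReal (τ + 2 * η) := by
  set C : Set ℝ := {c | 0 ≤ c ∧ foldedTail r c ≤ τ} with hC
  have hcont : Continuous (foldedTail r) :=
    continuous_foldedTail.comp (Continuous.prodMk continuous_const continuous_id)
  have hclosed : IsClosed C :=
    (isClosed_le continuous_const continuous_id).inter (isClosed_le hcont continuous_const)
  have hne : C.Nonempty := by
    obtain ⟨c, hc⟩ := (((tendsto_foldedTail_atTop r).eventually (gt_mem_nhds hτ)).and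
      (eventually_ge_atTop 0)).exists
    exact ⟨c, hc.2, hc.1.le⟩
  have hbdd : BddBelow C := ⟨0, fun c hc => hc.1⟩
  obtain ⟨hc0, hcτ⟩ := hclosed.csInf_mem hne hbdd
  set c := sInf C
  -- The event says that |β + W| reaches the smallest c ≥ 0 with tail at most τ, and splits into two
  -- one-sided tails.
  have hsub : {ω | foldedTail r |β + W ω| ≤ τ} ⊆ {ω | c - β ≤ W ω} ∪ {ω | c + β ≤ -W ω} := by
    intro ω hω
    have hle : c ≤ |β + W ω| := csInf_le hbdd ⟨abs_nonneg _, hω⟩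
    rcases le_abs.mp hle with h | h
    · left; change c - β ≤ W ω; linarith
    · right; change c + β ≤ -W ω; linarith
  have hreal : μ.real {ω | foldedTail r |β + W ω| ≤ τ} ≤ τ + 2 * η := by
    calc _ ≤ μ.real ({ω | c - β ≤ W ω} ∪ {ω | c + β ≤ -W ω}) := measureReal_mono hsub
      _ ≤ _ := measureReal_union_le _ _
      _ ≤ (stdCdf (-(c - β)) + η) + (stdCdf (-(c + β)) + η) := add_le_add (h1 _) (h2 _)
      _ = foldedTail β c + 2 * η := by
          rw [foldedTail]
          have e1 : -(c - β) = β - c := by ring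
          have e2 : -(c + β) = -β - c := by ring
          rw [e1, e2]; ring
      _ ≤ τ + 2 * η := by linarith [foldedTail_mono_left hβ hc0]
  rw [← ofReal_measureReal]
  exact ENNReal.ofReal_le_ofReal hreal

/-! ### Measurability of the estimators -/

section Measurability

variable {n : ℕ} {K : ℝ → ℝ} {h d : ℝ}

lemma measurable_kernelWeight (hK : Measurable K) : Measurable (kernelWeight K h d) :=
  Measurable.ite (measurableSet_le measurable_const continuous_abs.measurable)
    (hK.comp (measurable_id.div_const h)) measurable_const

lemma measurable_regressor (j : Fin 4) : Measurable fun z => regressor z j := by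
  have ht : Measurable treat :=
    Measurable.ite (measurableSet_le measurable_const measurable_id) measurable_const
      measurable_const
  fin_cases j
  · exact ht
  · exact measurable_id
  · exact ht.mul measurable_id
  · exact measurable_const

/-- By Cramer's formula; with 0⁻¹ = 0 it also covers singular matrices, where the inverse is 0. -/
lemma measurable_inv_entry (i j : Fin 4) :
    Measurable fun A : Fin 4 → Fin 4 → ℝ => (Matrix.of A)⁻¹ i j := by
  have hc : Continuous fun A : Fin 4 → Fin 4 → ℝ => (Matrix.of A : Matrix (Fin 4) (Fin 4) ℝ) :=
    continuous_id
  have h1 : Continuous fun A : Fin 4 → Fin 4 → ℝ => (Matrix.of A).det := hc.matrix_det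
  have h2 : Continuous fun A : Fin 4 → Fin 4 → ℝ => (Matrix.of A).adjugate i j :=
    hc.matrix_adjugate.matrix_elem i j
  have e : (fun A : Fin 4 → Fin 4 → ℝ => (Matrix.of A)⁻¹ i j) =
      fun A => ((Matrix.of A).det)⁻¹ * (Matrix.of A).adjugate i j := by
    ext A
    rw [Matrix.inv_def, Matrix.smul_apply, Ring.inverse_eq_inv', smul_eq_mul]
  rw [e]
  exact h1.measurable.inv.mul h2.measurable

lemma measurable_rdWeight (hK : Measurable K) (i : Fin n) :
    Measurable fun x : Fin n → ℝ => rdWeight K h d x i := by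
  have hg : Measurable fun x : Fin n → ℝ => fun j k => gram K h d x j k := by
    refine measurable_pi_lambda _ fun j => measurable_pi_lambda _ fun k => ?_
    simp only [gram, Matrix.sum_apply, Matrix.smul_apply, Matrix.vecMulVec_apply, smul_eq_mul]
    exact Finset.measurable_sum _ fun l _ =>
      ((measurable_kernelWeight hK).comp (measurable_pi_apply l)).mul
        (((measurable_regressor j).comp (measurable_pi_apply l)).mul
          ((measurable_regressor k).comp (measurable_pi_apply l)))
  simp only [rdWeight, Matrix.mulVec, dotProduct]
  refine ((measurable_kernelWeight hK).comp (measurable_pi_apply i)).mul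
    (Finset.measurable_sum _ fun k _ => ?_)
  exact ((measurable_inv_entry 0 k).comp hg).mul
    ((measurable_regressor k).comp (measurable_pi_apply i))

lemma measurable_diffWeight (hK : Measurable K) (i : Fin n) :
    Measurable fun x : Fin n → ℝ => diffWeight K h d x i :=
  (measurable_rdWeight hK i).sub (measurable_rdWeight hK i)

lemma measurable_sign : Measurable Real.sign := by
  have : Real.sign = fun r : ℝ => if r < 0 then (-1 : ℝ) else if 0 < r then 1 else 0 := by
    ext r; rfl
  rw [this]
  exact Measurable.ite measurableSet_Iio measurable_const
    (Measurable.ite measurableSet_Ioi measurable_const measurable_const)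

lemma measurable_diffBiasBound (hK : Measurable K) (M : ℝ) :
    Measurable fun x : Fin n → ℝ => diffBiasBound M K h d x := by
  unfold diffBiasBound
  exact (Finset.measurable_sum _ fun i _ => ((measurable_diffWeight hK i).mul
    ((measurable_pi_apply i).pow_const 2)).mul
      (measurable_sign.comp (measurable_pi_apply i))).const_mul _

lemma measurable_diffVar (hK : Measurable K) {w : ℝ → ℝ} (hw : Measurable w) :
    Measurable fun x : Fin n → ℝ => diffVar K h d x fun i => w (x i) := by
  simp only [diffVar_eq]
  exact Finset.measurable_sum _ fun i _ => ((measurable_diffWeight hK i).pow_const 2).mul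
    (hw.comp (measurable_pi_apply i))

lemma measurable_diffEstimate (hK : Measurable K) :
    Measurable fun p : (Fin n → ℝ) × (Fin n → ℝ) => diffEstimate K h d p.1 p.2 := by
  simp only [diffEstimate_eq]
  exact Finset.measurable_sum _ fun i _ => ((measurable_diffWeight hK i).comp measurable_fst).mul
    ((measurable_pi_apply i).comp measurable_snd)

lemma measurable_of_mem_smoothClass {M : ℝ} {m : ℝ → ℝ} (hm : m ∈ smoothClass M) :
    Measurable m := by
  obtain ⟨m₀, m₁, h₀, h₁, -, -, rfl⟩ := hm
  exact Measurable.ite (measurableSet_le measurable_const measurable_id)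
    h₁.continuous.measurable h₀.continuous.measurable

end Measurability

/-- Uniform normal approximation, up to `η`, for the upper tails of standardized weighted sums
of independent errors whose weights are at most `θ`. -/
def TailBound (q B v η θ : ℝ) : Prop :=
  ∀ (Ω : Type) [MeasurableSpace Ω] (μ : Measure Ω) [IsProbabilityMeasure μ] (n : ℕ)
    (ε : Fin n → Ω → ℝ) (a : Fin n → ℝ), (∀ i, Measurable (ε i)) → iIndepFun ε μ →
    (∀ i, ∫ ω, ε i ω ∂μ = 0) →
    (∀ i, ∫⁻ ω, ENNReal.ofReal (|ε i ω| ^ q) ∂μ ≤ ENNReal.ofReal B) →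
    (∀ i, v ≤ ∫ ω, ε i ω ^ 2 ∂μ) → ∑ i, a i ^ 2 * ∫ ω, ε i ω ^ 2 ∂μ = 1 →
    (∀ i, |a i| ≤ θ) → ∀ t, μ.real {ω | t ≤ ∑ i, a i * ε i ω} ≤ stdCdf (-t) + η

/-! ### Conditional size and its uniform limit -/

open unitInterval

/-- Given the running variables, the standardized difference of the estimates has a folded normal
tail. -/
lemma measure_conditional_le {M q B v η θ τ ε : ℝ} {K : ℝ → ℝ} (hK : ∀ u, 0 ≤ K u) {h d : ℝ}
    (hθ : 0 < θ) (hτ : 0 < τ) (hε : ε ≤ v * θ ^ 2)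
    (htail : TailBound q B v η θ)
    {F : ℝ → I → ℝ} (hF : Measurable (Function.uncurry F)) {m : ℝ → ℝ} (hm : m ∈ smoothClass M)
    {n : ℕ} {x : Fin n → ℝ} (hgood : GoodDesign ε K h d x) {w : Fin n → ℝ}
    (hmean : ∀ i, ∫ u, (F (x i) u - m (x i)) = 0)
    (hmom : ∀ i, ∫⁻ u, ENNReal.ofReal (|F (x i) u - m (x i)| ^ q) ≤ ENNReal.ofReal B)
    (hw : ∀ i, ∫ u, (F (x i) u - m (x i)) ^ 2 = w i) (hvw : ∀ i, v ≤ w i)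
    (hpos : 0 < diffVar K h d x w) :
    (Measure.pi fun _ : Fin n => (volume : Measure I)) {u |
      foldedTail (diffBiasBound M K h d x / √(diffVar K h d x w))
        (|diffEstimate K h d x fun i => F (x i) (u i)| / √(diffVar K h d x w)) ≤ τ} ≤
      ENNReal.ofReal (τ + 2 * η) := by
  set s := √(diffVar K h d x w) with hs
  have hs0 : 0 < s := Real.sqrt_pos.mpr hpos
  have hs2 : s ^ 2 = diffVar K h d x w := Real.sq_sqrt hpos.le
  have hFx : ∀ i, Measurable (F (x i)) := fun i => hF.comp measurable_prodMk_left
  set e : Fin n → (Fin n → I) → ℝ := fun i u => F (x i) (u i) - m (x i) with he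
  have hem : ∀ i, Measurable (e i) := fun i =>
    ((hFx i).comp (measurable_pi_apply i)).sub_const _
  have hind : iIndepFun e (Measure.pi fun _ : Fin n => (volume : Measure I)) :=
    iIndepFun_pi (X := fun i u => F (x i) u - m (x i))
      fun i => ((hFx i).sub_const _).aemeasurable
  have hmp : ∀ i, (Measure.pi fun _ : Fin n => (volume : Measure I)).map (Function.eval i) =
      volume := fun i => (measurePreserving_eval (fun _ : Fin n => (volume : Measure I)) i).map_eq
  have hint : ∀ (g : I → ℝ), Measurable g → ∀ i,
      ∫ u, g (u i) ∂(Measure.pi fun _ : Fin n => (volume : Measure I)) = ∫ u, g u := by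
    intro g hg i
    have h1 := integral_map (μ := Measure.pi fun _ : Fin n => (volume : Measure I))
      (measurable_pi_apply i).aemeasurable (f := g) hg.aestronglyMeasurable
    exact h1.symm.trans (congrArg (fun ρ : Measure I => ∫ u, g u ∂ρ) (hmp i))
  have h0 : ∀ i, ∫ u, e i u ∂(Measure.pi fun _ : Fin n => (volume : Measure I)) = 0 := fun i =>
    (hint _ ((hFx i).sub_const _) i).trans (hmean i)
  have h2 : ∀ i, ∫ u, e i u ^ 2 ∂(Measure.pi fun _ : Fin n => (volume : Measure I)) = w i :=
    fun i => (hint (fun u => (F (x i) u - m (x i)) ^ 2) (((hFx i).sub_const _).pow_const 2) i).trans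
      (hw i)
  have hB : ∀ i, ∫⁻ u, ENNReal.ofReal (|e i u| ^ q)
      ∂(Measure.pi fun _ : Fin n => (volume : Measure I)) ≤ ENNReal.ofReal B := by
    intro i
    have hg : Measurable fun u => ENNReal.ofReal (|F (x i) u - m (x i)| ^ q) := by
      have := hFx i
      fun_prop
    refine le_trans (le_of_eq ?_) (hmom i)
    have h1 := lintegral_map (μ := Measure.pi fun _ : Fin n => (volume : Measure I)) hg
      (measurable_pi_apply i)
    exact h1.symm.trans (congrArg (fun ρ : Measure I =>
      ∫⁻ u, ENNReal.ofReal (|F (x i) u - m (x i)| ^ q) ∂ρ) (hmp i))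
  -- The variance is at least v times the sum of the squared weights, so a share ε ≤ v θ² bounds
  -- each standardized weight by θ.
  have hsq : ∀ i, (diffWeight K h d x i / s) ^ 2 ≤ θ ^ 2 := by
    intro i
    rw [div_pow, div_le_iff₀ (by positivity), hs2, diffVar_eq]
    calc diffWeight K h d x i ^ 2 ≤ ε * ∑ j, diffWeight K h d x j ^ 2 := hgood.2 i
      _ ≤ v * θ ^ 2 * ∑ j, diffWeight K h d x j ^ 2 := by gcongr
      _ = θ ^ 2 * ∑ j, diffWeight K h d x j ^ 2 * v := by rw [← Finset.sum_mul]; ring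
      _ ≤ _ := by
        gcongr with j
        exact hvw j
  have hsum : ∑ i, (diffWeight K h d x i / s) ^ 2 * w i = 1 := by
    have : ∀ i, (diffWeight K h d x i / s) ^ 2 * w i = diffWeight K h d x i ^ 2 * w i / s ^ 2 :=
      fun i => by rw [div_pow]; ring
    simp only [this, ← Finset.sum_div]
    rw [← diffVar_eq, hs2, div_self hpos.ne']
  have hβ : |diffBias K h d x m / s| ≤ diffBiasBound M K h d x / s := by
    rw [abs_div, abs_of_pos hs0]
    gcongr
    exact abs_diffBias_le hK (isUnit_gram_of_twoPoints hK hgood.1) hm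
  have hdecomp : ∀ u : Fin n → I, |diffEstimate K h d x fun i => F (x i) (u i)| / s =
      |diffBias K h d x m / s + ∑ i, diffWeight K h d x i / s * e i u| := by
    intro u
    rw [← abs_of_pos hs0, ← abs_div, abs_of_pos hs0, diffEstimate_eq, diffBias, Finset.sum_div,
      Finset.sum_div, ← Finset.sum_add_distrib]
    congr 1
    exact Finset.sum_congr rfl fun i _ => by rw [he]; ring
  simp only [hdecomp]
  refine measure_foldedTail_le hβ hτ (fun t => ?_) fun t => ?_
  · refine htail _ _ n e _ hem hind h0 hB (fun i => (hvw i).trans_eq (h2 i).symm) ?_ ?_ t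
    · simpa only [h2] using hsum
    · exact fun i => abs_le_of_sq_le_sq (hsq i) hθ.le
  -- The lower tail is the upper tail for the negated weights.
  · have := htail _ _ n e (fun i => -(diffWeight K h d x i / s)) hem hind h0 hB
      (fun i => (hvw i).trans_eq (h2 i).symm) (by simpa only [h2, neg_sq] using hsum)
      (fun i => by rw [abs_neg]; exact abs_le_of_sq_le_sq (hsq i) hθ.le) t
    simpa only [neg_mul, Finset.sum_neg_distrib] using this

lemma measurable_run : Measurable run := by unfold run; fun_prop

lemma sampleLaw_runs {P : Measure Obs} [IsProbabilityMeasure P] {n : ℕ} {A : Set (Fin n → ℝ)}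
    (hA : MeasurableSet A) :
    sampleLaw n P {ω | runs ω ∈ A} = (Measure.pi fun _ : Fin n => P.map run) A := by
  have : IsProbabilityMeasure (P.map run) :=
    Measure.isProbabilityMeasure_map measurable_run.aemeasurable
  have hr := measurable_run
  rw [← Measure.pi_map_pi (μ := fun _ : Fin n => P) (f := fun _ => run)
    (fun _ => hr.aemeasurable), Measure.map_apply (by fun_prop) hA]
  rfl

/-- Almost surely, under the null hypothesis, the errors around the natural regression function are
centred, with bounded moments and variance `σsq`. -/
lemma ae_errors {f : ℝ → ℝ} {q B v : ℝ} {L : NNReal} {d : ℝ} {P : Measure Obs}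
    [IsProbabilityMeasure P] {m μ σsq : ℝ → ℝ} (hP : IsDonutDGP f q B v L d P m μ σsq)
    (hnull : NullHypothesis d m μ) {F : ℝ → I → ℝ} (hF : Measurable (Function.uncurry F))
    (hFκ : ∀ x, volume.map (F x) = condDistrib outcome run P x) :
    ∀ᵐ x ∂(P.map run), ∫ u, (F x u - m x) = 0 ∧
      ∫⁻ u, ENNReal.ofReal (|F x u - m x| ^ q) ≤ ENNReal.ofReal B ∧
      ∫ u, (F x u - m x) ^ 2 = σsq x ∧ v ≤ σsq x := by
  have hac : P.map run ≪ volume := by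
    rw [hP.density]; exact withDensity_absolutelyContinuous _ _
  have hne : ∀ c : ℝ, ∀ᵐ x ∂(P.map run), x ≠ c := fun c =>
    hac.ae_le (compl_mem_ae_iff.mpr (measure_singleton c))
  -- The points 0 and ±d are null because X has a density: the variance bound excludes 0, and the
  -- hypotheses say nothing about the means at |x| = d.
  filter_upwards [hP.mean, hP.variance, hP.moment, hne 0, hne d, hne (-d),
    Measure.support_mem_ae (μ := P.map run)] with x h1 h2 h3 h4 h5 h6 h7
  have hmx : μ x = m x := by
    rcases lt_trichotomy |x| d with hx | hx | hx
    · exact (hnull.2 x hx).symm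
    · rcases abs_choice x with hc | hc
      · exact absurd (hc.symm.trans hx) h5
      · exact absurd (by linarith) h6
    · exact (hnull.1 x hx).symm
  have hFx : Measurable (F x) := hF.comp measurable_prodMk_left
  rw [hmx] at h1 h2 h3
  rw [← hFκ x] at h1 h2 h3
  obtain ⟨hi, hmean⟩ := h1
  rw [integral_map hFx.aemeasurable (by fun_prop)] at hmean
  rw [integral_map hFx.aemeasurable (by fun_prop)] at h2
  rw [lintegral_map (by fun_prop) hFx] at h3
  have hi' : Integrable (F x) volume := (integrable_map_measure (by fun_prop) hFx.aemeasurable).mp hi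
  refine ⟨?_, h3, h2, hP.variance_pos x h7 h4⟩
  rw [integral_sub hi' (integrable_const _), hmean]
  simp

/-- Finite-sample bound for the probability of a false rejection. -/
lemma measure_reject_le {α M q B B' v η θ ε₁ ε₂ δ : ℝ} (hα₀ : 0 < α) (hα₁ : α < 1) (hδ : 0 < δ)
    {K : ℝ → ℝ} (hK : IsKernel K) (hv : 0 < v) (hθ : 0 < θ) (hε : ε₂ ≤ v * θ ^ 2)
    (htail : TailBound q B' v η θ) (hBB : ENNReal.ofReal B ≤ ENNReal.ofReal B')
    (htol : ∀ S T : ℝ, 0 < S → |T - S| ≤ ε₁ * S →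
      0 < T ∧ 1 / 2 ≤ √S / √T ∧ 4 * |√S / √T - 1| ≤ δ)
    {f : ℝ → ℝ} {L : NNReal} {h d : ℝ} {P : Measure Obs} [IsProbabilityMeasure P]
    {m μ σsq : ℝ → ℝ} (hm : m ∈ smoothClass M) (hP : IsDonutDGP f q B v L d P m μ σsq)
    (hnull : NullHypothesis d m μ) (n : ℕ) (σhat : (Fin n → ℝ) → (Fin n → ℝ) → Fin n → ℝ) :
    sampleLaw n P {ω |
      testCriticalValue α M K h d (runs ω) (σhat (runs ω) (outcomes ω)) ≤
        |tStat K h d (runs ω) (outcomes ω) (σhat (runs ω) (outcomes ω))|} ≤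
    sampleLaw n P {ω |
        ε₁ * diffVar K h d (runs ω) (fun i => σsq (runs ω i)) <
          |diffVar K h d (runs ω) (σhat (runs ω) (outcomes ω)) -
            diffVar K h d (runs ω) (fun i => σsq (runs ω i))|} +
      (Measure.pi fun _ : Fin n => P.map run) {x | ¬ GoodDesign ε₂ K h d x} +
      ENNReal.ofReal (α + δ + 2 * η) := by
  have : IsProbabilityMeasure (P.map run) :=
    Measure.isProbabilityMeasure_map measurable_run.aemeasurable
  obtain ⟨F, hF, hFκ⟩ := Kernel.exists_measurable_map_eq_unitInterval (condDistrib outcome run P)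
  have hmm := measurable_of_mem_smoothClass hm
  -- A measurable version of the conditional variance; `σsq` itself is not assumed to be measurable.
  set w : ℝ → ℝ := fun x => ∫ u, (F x u - m x) ^ 2 with hw
  have hwm : Measurable w := by
    have : StronglyMeasurable (Function.uncurry fun x (u : I) => (F x u - m x) ^ 2) :=
      ((hF.sub (hmm.comp measurable_fst)).pow_const 2).stronglyMeasurable
    exact (this.integral_prod_right (ν := (volume : Measure I))).measurable
  set Q : ℝ → Prop := fun x => ∫ u, (F x u - m x) = 0 ∧
      ∫⁻ u, ENNReal.ofReal (|F x u - m x| ^ q) ≤ ENNReal.ofReal B ∧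
      ∫ u, (F x u - m x) ^ 2 = σsq x ∧ v ≤ σsq x with hQ
  have hQae : ∀ᵐ x ∂(P.map run), Q x := ae_errors hP hnull hF hFκ
  have hQpi : ∀ᵐ x ∂(Measure.pi fun _ : Fin n => P.map run), ∀ i, Q (x i) :=
    ae_all_iff.mpr fun i => (Measure.tendsto_eval_ae_ae (i := i)).eventually hQae
  -- A measurable hull of the exceptional samples with the same measure, so measurability of the
  -- good designs is never needed.
  set A := toMeasurable (Measure.pi fun _ : Fin n => P.map run)
    ({x | ¬ GoodDesign ε₂ K h d x} ∪ {x | ¬ ∀ i, Q (x i)}) with hA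
  have hAm : MeasurableSet A := measurableSet_toMeasurable _ _
  have hAle : (Measure.pi fun _ : Fin n => P.map run) A ≤
      (Measure.pi fun _ : Fin n => P.map run) {x | ¬ GoodDesign ε₂ K h d x} := by
    rw [hA, measure_toMeasurable]
    refine (measure_union_le _ _).trans ?_
    rw [ae_iff.mp hQpi, add_zero]
  have hAgood : ∀ x, x ∉ A → GoodDesign ε₂ K h d x ∧ ∀ i, Q (x i) := by
    intro x hx
    have : x ∉ ({x | ¬ GoodDesign ε₂ K h d x} ∪ {x | ¬ ∀ i, Q (x i)}) :=
      fun h => hx (subset_toMeasurable _ _ h)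
    simp only [Set.mem_union, Set.mem_ofPred_eq, not_or, not_not] at this
    exact this
  -- This event does not involve `σhat`, so it is measurable even if the variance estimates are
  -- arbitrary functions of the data.
  set S : Set ((Fin n → ℝ) × (Fin n → ℝ)) := {p | (p.1 ∉ A ∧
    0 < diffVar K h d p.1 fun i => w (p.1 i)) ∧
    foldedTail (diffBiasBound M K h d p.1 / √(diffVar K h d p.1 fun i => w (p.1 i)))
      (|diffEstimate K h d p.1 p.2| / √(diffVar K h d p.1 fun i => w (p.1 i))) ≤ α + δ} with hS
  have hKm := hK.measurable
  have hVm : Measurable fun p : (Fin n → ℝ) × (Fin n → ℝ) =>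
      diffVar K h d p.1 fun i => w (p.1 i) := (measurable_diffVar hKm hwm).comp measurable_fst
  have hSm : MeasurableSet S := by
    have hT : Measurable fun p : (Fin n → ℝ) × (Fin n → ℝ) =>
        foldedTail (diffBiasBound M K h d p.1 / √(diffVar K h d p.1 fun i => w (p.1 i)))
          (|diffEstimate K h d p.1 p.2| / √(diffVar K h d p.1 fun i => w (p.1 i))) :=
      continuous_foldedTail.measurable.comp
        ((((measurable_diffBiasBound hKm M).comp measurable_fst).div hVm.sqrt).prodMk
          ((continuous_abs.measurable.comp (measurable_diffEstimate hKm)).div hVm.sqrt))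
    have h1 : MeasurableSet {p : (Fin n → ℝ) × (Fin n → ℝ) | p.1 ∉ A} := measurable_fst hAm.compl
    have h2 := measurableSet_lt (measurable_const (a := (0 : ℝ))) hVm
    exact (h1.inter h2).inter (measurableSet_le hT measurable_const)
  have hSle : sampleLaw n P {ω | (runs ω, outcomes ω) ∈ S} ≤ ENNReal.ofReal (α + δ + 2 * η) := by
    refine sampleLaw_le_of_forall hF hFκ n hSm (Eventually.of_forall fun x => ?_)
    by_cases hx : x ∉ A ∧ 0 < diffVar K h d x fun i => w (x i)
    · obtain ⟨hg, hq⟩ := hAgood x hx.1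
      refine (measure_mono fun u hu => hu.2).trans
        (measure_conditional_le hK.nonneg hθ (add_pos hα₀ hδ) hε htail hF hm hg
          (w := fun i => w (x i)) (fun i => (hq i).1) (fun i => (hq i).2.1.trans hBB)
          (fun i => rfl) (fun i => ?_) hx.2)
      exact (hq i).2.2.2.trans_eq (hq i).2.2.1.symm
    · refine le_trans (le_of_eq ?_) zero_le
      have he : {u : Fin n → I | (x, fun i => F (x i) (u i)) ∈ S} = ∅ :=
        Set.eq_empty_of_forall_notMem fun u hu => hx hu.1
      rw [he, measure_empty]
  refine (measure_mono (t := ({ω |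
        ε₁ * diffVar K h d (runs ω) (fun i => σsq (runs ω i)) <
          |diffVar K h d (runs ω) (σhat (runs ω) (outcomes ω)) -
            diffVar K h d (runs ω) (fun i => σsq (runs ω i))|} ∪ {ω | runs ω ∈ A}) ∪
      {ω | (runs ω, outcomes ω) ∈ S}) ?_).trans ((measure_union_le _ _).trans
        (add_le_add ((measure_union_le _ _).trans (add_le_add le_rfl ?_)) hSle))
  · intro ω hω
    by_contra hcon
    simp only [Set.mem_union, Set.mem_ofPred_eq, not_or, not_lt] at hcon
    obtain ⟨⟨hvar, hnA⟩, hnS⟩ := hcon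
    obtain ⟨-, hq⟩ := hAgood _ hnA
    have hwσ : (fun i => w (runs ω i)) = fun i => σsq (runs ω i) :=
      funext fun i => (hq i).2.2.1
    -- If the variance were zero, all difference weights would vanish, since `σsq ≥ v > 0` at the
    -- observations, and the test could not reject.
    have hpos : 0 < diffVar K h d (runs ω) fun i => σsq (runs ω i) := by
      by_contra hle
      rw [diffVar_eq, not_lt] at hle
      refine not_reject_of_degenerate hα₀ hα₁ _ _ _ (fun i => ?_) hω
      have hnn : ∀ j ∈ Finset.univ, 0 ≤ diffWeight K h d (runs ω) j ^ 2 * σsq (runs ω j) :=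
        fun j _ => mul_nonneg (sq_nonneg _) (hv.le.trans (hq j).2.2.2)
      have hz := (Finset.sum_eq_zero_iff_of_nonneg hnn).mp
        (le_antisymm hle (Finset.sum_nonneg hnn)) i (Finset.mem_univ i)
      rcases mul_eq_zero.mp hz with hz | hz
      · exact pow_eq_zero_iff two_ne_zero |>.mp hz
      · exact absurd hz (hv.trans_le (hq i).2.2.2).ne'
    obtain ⟨hT, hρ, hδ4⟩ := htol _ _ hpos hvar
    refine hnS ⟨⟨hnA, ?_⟩, ?_⟩
    · simpa only [hwσ] using hpos
    · simp only [hwσ]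
      exact (foldedTail_le_of_reject hα₀ hα₁ (Real.sqrt_pos.mpr hpos) (Real.sqrt_pos.mpr hT)
        hρ hω).trans (by linarith)
  · rw [sampleLaw_runs hAm]
    exact hAle

/-- The test controls size asymptotically, uniformly over the class of regression functions. -/
theorem limsup_reject_le
    {M α : ℝ} (hα₀ : 0 < α) (hα₁ : α < 1) {K : ℝ → ℝ} (hK : IsKernel K) {h d : ℕ → ℝ}
    (hasymp : SmallDonut h d ∨ (LargeDonut h d ∧ EndpointRegular K))
    {f : ℝ → ℝ} {a b : ℝ} (hf : DensityRegular f a b d)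
    {q B v : ℝ} {L : NNReal} (hq : 2 < q) (hv : 0 < v)
    {G : Set (ℝ → ℝ)} (hG : G ⊆ smoothClass M)
    {P : ℕ → (ℝ → ℝ) → ProbabilityMeasure Obs} {μ σsq : ℕ → (ℝ → ℝ) → ℝ → ℝ}
    (hP : ∀ n, ∀ m ∈ G,
      IsDonutDGP f q B v L (d n) (P n m : Measure Obs) m (μ n m) (σsq n m))
    (hnull : ∀ n, ∀ m ∈ G, NullHypothesis (d n) m (μ n m))
    {σhat : (n : ℕ) → (Fin n → ℝ) → (Fin n → ℝ) → Fin n → ℝ}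
    (hvar : ∀ ε : ℝ, 0 < ε → Tendsto (fun n : ℕ => ⨆ m ∈ G,
      sampleLaw n (P n m : Measure Obs) {ω |
        ε * diffVar K (h n) (d n) (runs ω) (fun i => σsq n m (runs ω i)) <
          |diffVar K (h n) (d n) (runs ω) (σhat n (runs ω) (outcomes ω)) -
            diffVar K (h n) (d n) (runs ω) (fun i => σsq n m (runs ω i))|})
      atTop (𝓝 0)) :
    limsup (fun n : ℕ => ⨆ m ∈ G, sampleLaw n (P n m : Measure Obs) {ω |
      testCriticalValue α M K (h n) (d n) (runs ω) (σhat n (runs ω) (outcomes ω)) ≤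
        |tStat K (h n) (d n) (runs ω) (outcomes ω) (σhat n (runs ω) (outcomes ω))|})
      atTop ≤ ENNReal.ofReal α := by
  rcases G.eq_empty_or_nonempty with rfl | ⟨m₀, hm₀⟩
  · simp
  set ν : Measure ℝ := volume.withDensity fun x => ENNReal.ofReal (f x) with hν
  have hνP : ∀ n, ∀ m ∈ G, (P n m : Measure Obs).map run = ν := fun n m hm => (hP n m hm).density
  have hνprob : IsProbabilityMeasure ν := by
    rw [← hνP 0 m₀ hm₀]
    exact Measure.isProbabilityMeasure_map measurable_run.aemeasurable
  obtain ⟨l, hl, hfl⟩ := hf.bounded_below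
  have hνl : ∀ A, MeasurableSet A → A ⊆ Set.Ioo a b → l * volume.real A ≤ ν.real A := by
    intro A hA hAs
    have hle : ENNReal.ofReal l * volume A ≤ ν A := by
      rw [hν, withDensity_apply _ hA, ← setLIntegral_const]
      exact setLIntegral_mono' hA fun x hx => ENNReal.ofReal_le_ofReal (hfl x (hAs hx))
    have := ENNReal.toReal_mono (measure_ne_top ν A) hle
    rwa [ENNReal.toReal_mul, ENNReal.toReal_ofReal hl.le] at this
  have fw : Framework K h d := by
    rcases hasymp with hs | ⟨hs, hE⟩
    · exact hs.framework hK
    · exact hs.framework hK hE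
  have hsub := eventually_Icc_subset hf (hasymp.imp_right And.left)
  refine ENNReal.le_of_forall_pos_le_add fun δ hδ _ => ?_
  have hδ' : (0 : ℝ) < δ := hδ
  -- The error budget δ is split into quarters: critical value, normal approximation (twice δ/8),
  -- variance estimate and design.
  obtain ⟨ε₁, hε₁, htol⟩ := exists_variance_tolerance (δ := δ / 4) (by positivity)
  -- B may be negative; replacing it by max B 0 leaves the moment bound valid.
  obtain ⟨θ, hθ, htail⟩ := normal_tail_bound (η := δ / 8) hq (le_max_right B 0) hv (by positivity)
  have hε₂ : 0 < v * θ ^ 2 := by positivity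
  have hgood := fw.tendsto_not_goodDesign hK hl hνl hsub hε₂
  have hev1 : ∀ᶠ n in atTop, (⨆ m ∈ G, sampleLaw n (P n m : Measure Obs) {ω |
        ε₁ * diffVar K (h n) (d n) (runs ω) (fun i => σsq n m (runs ω i)) <
          |diffVar K (h n) (d n) (runs ω) (σhat n (runs ω) (outcomes ω)) -
            diffVar K (h n) (d n) (runs ω) (fun i => σsq n m (runs ω i))|}) ≤
      ENNReal.ofReal (δ / 4) :=
    (hvar ε₁ hε₁).eventually (ge_mem_nhds (by simpa using hδ'))
  have hev2 := hgood.eventually (ge_mem_nhds (show (0 : ℝ) < δ / 4 by positivity))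
  refine limsup_le_of_le (by isBoundedDefault) ?_
  filter_upwards [hev1, hev2] with n h1 h2
  refine iSup₂_le fun m hm => ?_
  refine (measure_reject_le hα₀ hα₁ (by positivity) hK hv hθ le_rfl htail
    (ENNReal.ofReal_le_ofReal (le_max_left B 0)) htol (hG hm) (hP n m hm) (hnull n m hm) n
    (σhat n)).trans ?_
  have t1 := (le_iSup₂ (f := fun m (_ : m ∈ G) => sampleLaw n (P n m : Measure Obs) {ω |
        ε₁ * diffVar K (h n) (d n) (runs ω) (fun i => σsq n m (runs ω i)) <
          |diffVar K (h n) (d n) (runs ω) (σhat n (runs ω) (outcomes ω)) -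
            diffVar K (h n) (d n) (runs ω) (fun i => σsq n m (runs ω i))|}) m hm).trans h1
  have t2 : (Measure.pi fun _ : Fin n => (P n m : Measure Obs).map run)
      {x | ¬ GoodDesign (v * θ ^ 2) K (h n) (d n) x} ≤ ENNReal.ofReal (δ / 4) := by
    rw [hνP n m hm, ← ofReal_measureReal]
    exact ENNReal.ofReal_le_ofReal h2
  refine (add_le_add (add_le_add t1 t2) le_rfl).trans (le_of_eq ?_)
  rw [← ENNReal.ofReal_coe_nnreal, ← ENNReal.ofReal_add (by positivity) (by positivity),
    ← ENNReal.ofReal_add (by positivity) (by positivity),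
    ← ENNReal.ofReal_add (by positivity) (by positivity)]
  congr 1
  ring

end DonutRD

end

open MeasureTheory Filter Topology DonutRD in
theorem theorem3
    (M α : ℝ) (hM : 0 < M) (hα₀ : 0 < α) (hα₁ : α < 1)
    (K : ℝ → ℝ) (hK : IsKernel K)
    -- bandwidths and donut sizes, under either asymptotic framework
    (h d : ℕ → ℝ)
    (hasymp : SmallDonut h d ∨ (LargeDonut h d ∧ EndpointRegular K))
    -- regularity conditions, with uniform constants
    (f : ℝ → ℝ) (a b : ℝ) (hf : DensityRegular f a b d)
    (q B v : ℝ) (L : NNReal) (hq : 2 < q) (hv : 0 < v)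
    -- for every natural regression function `m` in the class, a population law
    (G : Set (ℝ → ℝ)) (hG : G ⊆ smoothClass M)
    (P : ℕ → (ℝ → ℝ) → ProbabilityMeasure Obs)
    (μ σsq : ℕ → (ℝ → ℝ) → ℝ → ℝ)
    (hP : ∀ n, ∀ m ∈ G,
      IsDonutDGP f q B v L (d n) (P n m : Measure Obs) m (μ n m) (σsq n m))
    (hnull : ∀ n, ∀ m ∈ G, NullHypothesis (d n) m (μ n m))
    -- variance estimates, as functions of the data
    (σhat : (n : ℕ) → (Fin n → ℝ) → (Fin n → ℝ) → Fin n → ℝ)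
    (hvar : ∀ ε : ℝ, 0 < ε → Tendsto (fun n : ℕ => ⨆ m ∈ G,
      sampleLaw n (P n m : Measure Obs) {ω |
        ε * diffVar K (h n) (d n) (runs ω) (fun i => σsq n m (runs ω i)) <
          |diffVar K (h n) (d n) (runs ω) (σhat n (runs ω) (outcomes ω)) -
            diffVar K (h n) (d n) (runs ω) (fun i => σsq n m (runs ω i))|})
      atTop (𝓝 0)) :
    -- finite-sample sharp bias bound
    (∀ (n : ℕ) (x : Fin n → ℝ) (h' d' : ℝ), 0 ≤ d' → d' < h' →
      IsUnit (gram K h' d' x).det →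
      IsLUB {r | ∃ m ∈ smoothClass M, r = |diffBias K h' d' x m|}
        (diffBiasBound M K h' d' x)) ∧
    -- uniform asymptotic size
    limsup (fun n : ℕ => ⨆ m ∈ G, sampleLaw n (P n m : Measure Obs) {ω |
      testCriticalValue α M K (h n) (d n) (runs ω) (σhat n (runs ω) (outcomes ω)) ≤
        |tStat K (h n) (d n) (runs ω) (outcomes ω) (σhat n (runs ω) (outcomes ω))|})
      atTop ≤ ENNReal.ofReal α := by
  exact ⟨fun _ _ _ _ _ _ hdet => isLUB_diffBias hK.nonneg hdet hM.le,
    limsup_reject_le hα₀ hα₁ hK hasymp hf hq hv hG hP hnull hvar⟩
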